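/- **Parameters.** Let $q_1,q_2,q_3\in\mathbb C^\times$, $q_1q_2q_3=1$, be generic: $q_1^aq_2^b=1$ with $a,b\in\mathbb Z$ only if $a=b=0$. Fix logarithms with $\log q_1+\log q_2+\log q_3=0$, put $q_i^\alpha=e^{\alpha\log q_i}$, $s_1=q_1^{1/2}$, $\kappa_r=\prod_{i=1}^3(1-q_i^r)$, $c_1=\kappa_1/(s_1-s_1^{-1})$, and $$\omega(x)=\frac{(1-q_2x)(1-q_3x)}{(1-x)(1-q_2q_3x)},\qquad p_s(x)=\prod_{r=0}^{s}\frac{q_2^{-1}q_1^r-x}{q_1^r-x},\qquad g(z,w)=\prod_{i=1}^3(z-q_iw).$$ For a rational function $p$, $p^+$ and $p^-$ denote its expansions at $0$ and at $\infty$. Let $(\check q_1,\check q_2,\check q_3)=(q_1^{-1},q_2,q_1^2q_3)$ with logarithms $-\log q_1,\ \log q_2,\ 2\log q_1+\log q_3$; a check on any symbol means that the parameters are replaced by $\check q_i$. Fix $\beta$ with $q_1^{-\beta}=q_3$ and put $\check\beta=2-\beta$. Let $\delta(x)=\sum_{k\in\mathbb Z}x^k$. **The algebra $\mathcal E_1=\mathcal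 E_1(q_1,q_2,q_3)$** is generated by $e_k,f_k$ ($k\in\mathbb Z$), $h_r$ ($r\in\mathbb Z\setminus\{0\}$) and invertible central $C,\psi_0$. With $e(z)=\sum e_kz^{-k}$, $f(z)=\sum f_kz^{-k}$, $\psi^\pm(z)=\psi_0^{\pm1}\exp\bigl(\sum_{r\ge1}\kappa_rh_{\pm r}z^{\mp r}\bigr)$, the relations are $$[h_r,h_s]=\delta_{r+s,0}\frac{C^r-C^{-r}}{r\,\kappa_r},$$ $$g(C^{(1\pm1)/2}z,w)\psi^\pm(z)e(w)+g(w,C^{(1\pm1)/2}z)e(w)\psi^\pm(z)=0,$$ $$g(w,C^{(1\mp1)/2}z)\psi^\pm(z)f(w)+g(C^{(1\mp1)/2}z,w)f(w)\psi^\pm(z)=0,$$ $$[e(z),f(w)]=\tfrac1{\kappa_1}\bigl(\delta(Cw/z)\psi^+(w)-\delta(Cz/w)\psi^-(z)\bigr),$$ $$g(z,w)e(z)e(w)+g(w,z)e(w)e(z)=0,\qquad g(w,z)f(z)f(w)+g(z,w)f(w)f(z)=0,$$ $$\operatorname{Sym}_{z_1,z_2,z_3}z_1z_2^2[e(z_1),[e(z_2),e(z_3)]]=0,\qquad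 \operatorname{Sym}_{z_1,z_2,z_3}z_1z_2^2[f(z_1),[f(z_2),f(z_3)]]=0.$$ $\check{\mathcal E}_1$ is the same algebra with parameters $\check q_i$ and generators $\check e_k,\check f_k,\check h_r,\check C,\check\psi_0$. **The Fock module $\mathcal F_1(v)$**, $v\in\mathbb C^\times$, is the $\mathcal E_1$-module $\mathbb C[h_r]_{r<0}$ on which $C=s_1$, $\psi_0=1$, $h_r$ ($r<0$) acts by multiplication, $h_r$ ($r>0$) acts by $-(rs_1^r(1-q_2^r)(1-q_3^r))^{-1}\partial_{h_{-r}}$, and $$e(z)=\tfrac{s_1^{-1}v}{(1-q_2)(1-q_3)}\exp\Bigl(\sum_{r>0}(1-q_2^r)(1-q_3^r)h_{-r}z^r\Bigr)\exp\Bigl(\sum_{r>0}(1-q_2^{-r})(1-q_3^{-r})s_1^{-r}h_rz^{-r}\Bigr),$$ $$f(z)=\tfrac{-s_1^{-1}v^{-1}}{(1-q_2)(1-q_3)}\exp\Bigl(-\sum_{r>0}(1-q_2^r)(1-q_3^r)s_1^rh_{-r}z^r\Bigr)\exp\Bigl(-\sum_{r>0}(1-q_2^{-r})(1-q_3^{-r})h_rz^{-r}\Bigr).$$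 $\check{\mathcal F}_1(v)$ is the $\check{\mathcal E}_1$-module given by the same formulas with $\check q_i$, $\check s_1=\check q_1^{1/2}$. **The currents $k_r^\pm$.** For an invertible operator $K$ put $k_0^\pm(z)=K^{\pm1}\exp\bigl(\sum_{r>0}\frac{\kappa_r}{q_1^{\mp r}-1}h_{\pm r}z^{\mp r}\bigr)$ and, for $r\ge0$, $$k_r^+(z)=(-c_1)^rf(q_1^{r-1}z)\cdots f(q_1z)f(z)\,k_0^+(z),\qquad k_r^-(z)=k_0^-(z)\,c_1^r\,e(z)e(q_1z)\cdots e(q_1^{r-1}z),$$ where products of $e$'s or of $f$'s are fused currents: matrix coefficients of $e(z_1)\cdots e(z_r)$ and $f(z_1)\cdots f(z_r)$ are expansions of rational functions, which are evaluated at the indicated points. $\check k_r^\pm$ is defined likewise from $\check{\mathcal E}_1$, $\check K$, $\check q_i$. **The algebra $\mathcal A_1=\mathcal A_1(q_1,q_2,q_3)$** is generated by commuting copies of $\mathcal E_1$ and $\check{\mathcal E}_1$ with $\psi_0=\check\psi_0=1$ and $C=q_1^{1/2}\check C$, invertible elements $K,\check K$ commuting with $\mathcal E_1$, $\check{\mathcal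 E}_1$ and each other, and $X^+_{i,k}$ ($i\in\mathbb Z+\frac12$), $X^-_{i,k}$ ($i\in\mathbb Z$), $k\in\mathbb Z$, with $X_i^\pm(z)=\sum_kX^\pm_{i,k}z^{-k}$. Its relations, understood as identities of operators on an admissible module (defined below), are the following. First, $C$ is central, $KX_i^\pm(z)K^{-1}=q_2^{\pm\beta/2}X_i^\pm(z)$, $\check KX_i^\pm(z)\check K^{-1}=\check q_2^{\pm\check\beta/2}X_i^\pm(z)$, and $$e(u)X_i^+(z)-\omega^-(\tfrac zu)X_i^+(z)e(u)=\tfrac1{s_1^{-1}-s_1}\delta(\tfrac zu)X_{i-1}^+(q_1z),\qquad [f(u),X_i^+(z)]=\tfrac1{s_1^{-1}-s_1}\delta(\tfrac{q_1^{-1}z}{Cu})X_{i+1}^+(q_1^{-1}z)\psi^+(u),$$ $$\psi^\pm(u)X_i^+(z)\psi^\pm(u)^{-1}=\omega^\pm(\tfrac z{C^{(1\pm1)/2}u})X_i^+(z),$$ $$\check e(u)X_i^+(z)-\check\omega^-(\tfrac{q_1^iz}u)X_i^+(z)\check e(u)=\tfrac1{\check s_1^{-1}-\check s_1}\delta(\tfrac{q_1^iz}u)X_{i-1}^+(z),\qquad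 [\check f(u),X_i^+(z)]=\tfrac1{\check s_1^{-1}-\check s_1}\delta(\tfrac{q_1^{i+1}z}{\check Cu})X_{i+1}^+(z)\check\psi^+(u),$$ $$\check\psi^\pm(u)X_i^+(z)\check\psi^\pm(u)^{-1}=\check\omega^\pm(\tfrac{q_1^iz}{\check C^{(1\pm1)/2}u})X_i^+(z),$$ $$[X_i^-(z),e(u)]=\tfrac1{s_1^{-1}-s_1}\delta(\tfrac z{Cq_1u})\psi^-(u)X_{i-1}^-(q_1^{-1}z),\qquad X_i^-(z)f(u)-\omega^+(\tfrac zu)f(u)X_i^-(z)=\tfrac1{s_1^{-1}-s_1}\delta(\tfrac zu)X_{i+1}^-(q_1z),$$ $$\psi^\pm(u)^{-1}X_i^-(z)\psi^\pm(u)=\omega^\pm(\tfrac z{C^{(1\mp1)/2}u})X_i^-(z),$$ $$[X_i^-(z),\check e(u)]=\tfrac1{\check s_1^{-1}-\check s_1}\delta(\tfrac{q_1^{1-i}z}{\check Cu})\check\psi^-(u)X_{i-1}^-(z),\qquad X_i^-(z)\check f(u)-\check\omega^+(\tfrac{q_1^{-i}z}u)\check f(u)X_i^-(z)=\tfrac1{\check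 s_1^{-1}-\check s_1}\delta(\tfrac{q_1^{-i}z}u)X_{i+1}^-(z),$$ $$\check\psi^\pm(u)^{-1}X_i^-(z)\check\psi^\pm(u)=\check\omega^\pm(\tfrac{q_1^{-i}z}{\check C^{(1\mp1)/2}u})X_i^-(z).$$ Second, for $j-i$ a positive integer, $$(z-q_2w)X_i^+(z)X_i^+(w)+(w-q_2z)X_i^+(w)X_i^+(z)=0,\qquad (q_2z-w)X_i^-(z)X_i^-(w)+(q_2w-z)X_i^-(w)X_i^-(z)=0,$$ $$\prod_{r=1}^{j-i-1}(z-q_1^rw)X_i^+(z)X_j^+(w)+(-1)^{j-i}q_2\,p_{j-i}^+(z/w)\prod_{r=0}^{j-i-2}(q_3^{-1}q_1^rw-z)X_j^+(w)X_i^+(z)=0,$$ $$\prod_{r=1}^{j-i-1}(w-q_1^rz)X_i^-(z)X_j^-(w)+(-1)^{j-i}q_2\,p_{j-i}^-(w/z)\prod_{r=0}^{j-i-2}(q_3^{-1}q_1^rz-w)X_j^-(w)X_i^-(z)=0.$$ Third, with $r,\check r$ running over non-negative integers, $$[X_i^+(z),X_j^-(w)]=\sum_{r+\check r=i+j+\frac12}\delta\Bigl(\frac{Cw}{q_1^rz}\Bigr)k_r^+(q_1^{-r}w)\check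 k_{\check r}^+(\check q_1^{-\check r}q_1^{-j}w)+\sum_{r+\check r=-i-j+\frac12}\delta\Bigl(\frac{Cz}{q_1^rw}\Bigr)k_r^-(q_1^{-r}z)\check k_{\check r}^-(\check q_1^{-\check r}q_1^iz).$$ **Admissible modules.** Degrees: $\deg e_k=\deg f_k=\deg\check e_k=\deg\check f_k=\deg X^\pm_{i,k}=k$, $\deg h_r=\deg\check h_r=r$, and $0$ for $C,\check C,K,\check K$. Weights: $\pm1$ for $X_{i,k}^\pm$ and $0$ for the other generators. An $\mathcal A_1$-module $W$ is admissible if $W=\bigoplus_{d_1,d_2\in\mathbb Z}W_{d_1,d_2}$ with finite-dimensional $W_{d_1,d_2}$, generators of degree $a$ and weight $b$ map $W_{d_1,d_2}$ to $W_{d_1+a,d_2+b}$, and for each $d_2$ there is $d$ with $W_{d_1,d_2}=0$ for all $d_1>d$. **Lemma.** Let $v\in\mathbb C^\times$ and let $v^{1/2}$ be any square root of $v$. 1. The $\mathcal E_1$-module $\mathcal F_1(v)$ extends to an admissible $\mathcal A_1$-module in which $X_i^\pm(z),\check e(z),\check f(z)$ act by $0$, $\check\psi_0,\check C,\check K$ act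 by $1$, and $K$ acts by $v^{1/2}$. 2. The $\check{\mathcal E}_1$-module $\check{\mathcal F}_1(v)$ extends to an admissible $\mathcal A_1$-module in which $X_i^\pm(z),e(z),f(z)$ act by $0$, $\psi_0,C,K$ act by $1$, and $\check K$ acts by $v^{1/2}$. (In particular $K$ and $\check K$ may both be taken to act by $1$ when $v=1$.) -/

import Mathlib

open Module

namespace Toroidal

noncomputable section

/-! ### Parameters -/

/-- A choice of logarithms `l₁ + l₂ + l₃ = 0` of the parameters `q₁ q₂ q₃ = 1`. -/
structure Params where
  l₁ : ℂ
  l₂ : ℂ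
  l₃ : ℂ
  sum_eq : l₁ + l₂ + l₃ = 0

namespace Params

variable (P : Params)

def q₁ : ℂ := Complex.exp P.l₁
def q₂ : ℂ := Complex.exp P.l₂
def q₃ : ℂ := Complex.exp P.l₃

/-- `s₁ = q₁ ^ (1/2)`, with the chosen logarithm. -/
def s₁ : ℂ := Complex.exp (P.l₁ / 2)

/-- `q₁, q₂` are generic. -/
def Generic : Prop := ∀ a b : ℤ, P.q₁ ^ a * P.q₂ ^ b = 1 → a = 0 ∧ b = 0

/-- `κ_r = (1 - q₁^r)(1 - q₂^r)(1 - q₃^r)`. -/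
def κ (r : ℤ) : ℂ := (1 - P.q₁ ^ r) * (1 - P.q₂ ^ r) * (1 - P.q₃ ^ r)

/-- `c₁ = κ₁ / (s₁ - s₁⁻¹)`. -/
def c₁ : ℂ := P.κ 1 / (P.s₁ - P.s₁⁻¹)

/-- `q₁ ^ (i + 1/2)`, with the chosen logarithm. -/
def q₁half (i : ℤ) : ℂ := Complex.exp (((i : ℂ) + 1 / 2) * P.l₁)

/-- The parameters `(q₁⁻¹, q₂, q₁² q₃)` of the second (checked) algebra. -/
def check : Params where
  l₁ := -P.l₁
  l₂ := P.l₂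
  l₃ := 2 * P.l₁ + P.l₃
  sum_eq := by linear_combination P.sum_eq

open PowerSeries in
/-- The expansion of `ω(x) = (1 - q₂x)(1 - q₃x) / ((1 - x)(1 - q₂q₃x))` at `x = 0`,
a power series in `x`. -/
def ωp : PowerSeries ℂ :=
  (1 - C P.q₂ * X) * (1 - C P.q₃ * X) * ((1 - X) * (1 - C (P.q₂ * P.q₃) * X))⁻¹

open PowerSeries in
/-- The expansion of `ω(x)` at `x = ∞`, a power series in `y = x⁻¹`; indeed
`ω(y⁻¹) = (y - q₂)(y - q₃) / ((y - 1)(y - q₂q₃))`. -/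
def ωm : PowerSeries ℂ :=
  (X - C P.q₂) * (X - C P.q₃) * ((X - 1) * (X - C (P.q₂ * P.q₃)))⁻¹

open PowerSeries in
/-- The expansion of `p_s(x) = ∏_{r=0}^{s} (q₂⁻¹ q₁^r - x) / (q₁^r - x)` at `x = 0`,
a power series in `x`. -/
def pp (s : ℕ) : PowerSeries ℂ :=
  ∏ r ∈ Finset.range (s + 1), (C (P.q₂⁻¹ * P.q₁ ^ r) - X) * (C (P.q₁ ^ r) - X)⁻¹

open PowerSeries in
/-- The expansion of `p_s(x)` at `x = ∞`, a power series in `y = x⁻¹`; indeed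
`p_s(y⁻¹) = ∏_{r=0}^{s} (q₂⁻¹ q₁^r y - 1) / (q₁^r y - 1)`. -/
def pm (s : ℕ) : PowerSeries ℂ :=
  ∏ r ∈ Finset.range (s + 1), (C (P.q₂⁻¹ * P.q₁ ^ r) * X - 1) * (C (P.q₁ ^ r) * X - 1)⁻¹

end Params

/-! ### Formal currents

A current `a(z) = ∑ a_k z^{-k}` of operators on `W` is the family `k ↦ a_k`.
A series `F(x, y) = ∑ F_{m,n} x^{-m} y^{-n}` in two variables is the family `m n ↦ F_{m,n}`. -/

variable {W : Type*} [AddCommGroup W] [Module ℂ W]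

/-- Currents. -/
abbrev Cur (W : Type*) [AddCommGroup W] [Module ℂ W] := ℤ → End ℂ W

/-- Two-variable series. -/
abbrev Cur₂ (W : Type*) [AddCommGroup W] [Module ℂ W] := ℤ → ℤ → End ℂ W

open Classical in
/-- The sum of a family of operators of which only finitely many are nonzero on each vector
(by convention `0` for other families, which do not arise in admissible modules). -/
def locSum {ι : Type*} (F : ι → End ℂ W) : End ℂ W :=
  if h : ∀ w, (Function.support fun i => F i w).Finite then
    { toFun := fun w => ∑ᶠ i, F i w
      map_add' := fun u w => by
        simp only [map_add]
        exact finsum_add_distrib (h u) (h w)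
      map_smul' := fun c w => by
        simp only [map_smul, RingHom.id_apply]
        exact (smul_finsum' c (h w)).symm }
  else 0

/-- `∑_{n ≥ 0} c_n z^{-n}`. -/
def posCur (c : ℕ → End ℂ W) : Cur W := fun k => if 0 ≤ k then c k.toNat else 0

/-- `∑_{n ≥ 0} c_n z^{n}`. -/
def negCur (c : ℕ → End ℂ W) : Cur W := fun k => if k ≤ 0 then c (-k).toNat else 0

/-- The constant current `1`. -/
def oneCur : Cur W := fun k => if k = 0 then 1 else 0

/-- The coefficient of `t^n` in `exp (∑_{r ≥ 1} a_r t^r)`. -/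
def expCoeff (a : ℕ → End ℂ W) (n : ℕ) : End ℂ W :=
  ∑ k ∈ Finset.range (n + 1), ((k.factorial : ℂ)⁻¹) •
    PowerSeries.coeff n ((PowerSeries.mk fun r => if r = 0 then 0 else a r) ^ k)

/-- The current `a(cz)`. -/
def rescale (c : ℂ) (a : Cur W) : Cur W := fun k => c ^ (-k) • a k

/-- The product `a(z) b(z)` of two currents in the same variable. -/
def mulCur (a b : Cur W) : Cur W := fun k => locSum fun n : ℤ => a (k - n) * b n

/-- `a(x) b(y)`. -/
def prodXY (a b : Cur W) : Cur₂ W := fun m n => a m * b n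

/-- `b(y) a(x)`. -/
def prodYX (b a : Cur W) : Cur₂ W := fun m n => b n * a m

/-- `a(x)` as a series in `x, y`. -/
def inX (a : Cur W) : Cur₂ W := fun m n => if n = 0 then a m else 0

/-- `b(y)` as a series in `x, y`. -/
def inY (b : Cur W) : Cur₂ W := fun m n => if m = 0 then b n else 0

/-- `(a x + b y) F(x, y)`. -/
def linMul (a b : End ℂ W) (F : Cur₂ W) : Cur₂ W :=
  fun m n => a * F (m + 1) n + b * F m (n + 1)

/-- `δ(c x / y) F(x, y)`, where `δ(t) = ∑_{k ∈ ℤ} t^k`. -/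
def deltaXY (c : (End ℂ W)ˣ) (F : Cur₂ W) : Cur₂ W :=
  fun m n => locSum fun k : ℤ => ((c ^ k : (End ℂ W)ˣ) : End ℂ W) * F (m + k) (n - k)

/-- `δ(c y / x) F(x, y)`. -/
def deltaYX (c : (End ℂ W)ˣ) (F : Cur₂ W) : Cur₂ W :=
  fun m n => locSum fun k : ℤ => ((c ^ k : (End ℂ W)ˣ) : End ℂ W) * F (m - k) (n + k)

/-- `φ(c x / y) F(x, y)` for a power series `φ`. -/
def seriesXY (φ : PowerSeries ℂ) (c : (End ℂ W)ˣ) (F : Cur₂ W) : Cur₂ W :=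
  fun m n => locSum fun k : ℕ =>
    PowerSeries.coeff k φ • (((c ^ k : (End ℂ W)ˣ) : End ℂ W) * F (m + k) (n - k))

/-- `φ(c y / x) F(x, y)` for a power series `φ`. -/
def seriesYX (φ : PowerSeries ℂ) (c : (End ℂ W)ˣ) (F : Cur₂ W) : Cur₂ W :=
  fun m n => locSum fun k : ℕ =>
    PowerSeries.coeff k φ • (((c ^ k : (End ℂ W)ˣ) : End ℂ W) * F (m - k) (n + k))

/-- The invertible operator of multiplication by `exp l`. -/
def expUnit (W : Type*) [AddCommGroup W] [Module ℂ W] (l : ℂ) : (End ℂ W)ˣ :=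
  Units.map (algebraMap ℂ (End ℂ W)).toMonoidHom
    (Units.mk0 (Complex.exp l) (Complex.exp_ne_zero l))

/-- The fused current `a(αz) b(βz)`. Here `Q` is a polynomial such that `Q(y/x) a(x) b(y)` has
Laurent polynomial matrix coefficients and `Q(β/α) ≠ 0`; the fused current is the value of
`Q(y/x) a(x) b(y)` at `x = αz`, `y = βz`, divided by `Q(β/α)`. -/
def fuse (Q : Polynomial ℂ) (α β : ℂ) (a b : Cur W) : Cur W := fun k =>
  (Q.eval (β / α))⁻¹ • locSum fun n : ℤ =>
    (α ^ (-(k - n)) * β ^ (-n)) • Q.sum fun i c => c • (a (k - n - i) * b (n + i))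

/-! ### Quantum toroidal `gl₁` -/

/-- Operators on `W` for the generators of `E₁[K]`, apart from `K`. -/
structure GL1Data (W : Type*) [AddCommGroup W] [Module ℂ W] where
  e : Cur W
  f : Cur W
  h : ℤ → End ℂ W
  C : (End ℂ W)ˣ
  ψ₀ : (End ℂ W)ˣ

namespace GL1Data

variable (P : Params) (D : GL1Data W)

/-- The operators of the generators. -/
def gens : Set (End ℂ W) :=
  Set.range D.e ∪ Set.range D.f ∪ Set.range D.h ∪ {(D.C : End ℂ W), (D.ψ₀ : End ℂ W)}

/-- `ψ⁺(z) = ψ₀ exp (∑_{r ≥ 1} κ_r h_r z^{-r})`. -/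
def ψp : Cur W := posCur fun n =>
  (D.ψ₀ : End ℂ W) * expCoeff (fun r => P.κ r • D.h r) n

/-- `ψ⁻(z) = ψ₀⁻¹ exp (∑_{r ≥ 1} κ_r h_{-r} z^{r})`. -/
def ψm : Cur W := negCur fun n =>
  ((D.ψ₀⁻¹ : (End ℂ W)ˣ) : End ℂ W) * expCoeff (fun r => P.κ r • D.h (-(r : ℤ))) n

end GL1Data

/-- `g(a x, b y) F(x, y)`, where `g(z, w) = (z - q₁w)(z - q₂w)(z - q₃w)`. -/
def gXY (P : Params) (a b : End ℂ W) (F : Cur₂ W) : Cur₂ W :=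
  linMul a (-(P.q₁ • b)) (linMul a (-(P.q₂ • b)) (linMul a (-(P.q₃ • b)) F))

/-- `g(b y, a x) F(x, y)`. -/
def gYX (P : Params) (a b : End ℂ W) (F : Cur₂ W) : Cur₂ W :=
  linMul (-(P.q₁ • a)) b (linMul (-(P.q₂ • a)) b (linMul (-(P.q₃ • a)) b F))

/-- The operators satisfy the relations of the quantum toroidal algebra `E₁(q₁, q₂, q₃)`.
(`h_0` is not a generator; it is `0` by convention.) The variables are `x = z`, `y = w`. -/
structure IsGL1 (P : Params) (D : GL1Data W) : Prop where
  h_zero : D.h 0 = 0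
  C_central : ∀ a ∈ D.gens, Commute (D.C : End ℂ W) a
  ψ₀_central : ∀ a ∈ D.gens, Commute (D.ψ₀ : End ℂ W) a
  hh : ∀ r s : ℤ, r ≠ 0 → s ≠ 0 → ⁅D.h r, D.h s⁆ =
    if r + s = 0 then ((r : ℂ) * P.κ r)⁻¹ •
      (((D.C ^ r : (End ℂ W)ˣ) : End ℂ W) - ((D.C ^ (-r) : (End ℂ W)ˣ) : End ℂ W)) else 0
  ψp_e : gXY P D.C 1 (prodXY (D.ψp P) D.e) + gYX P D.C 1 (prodYX D.e (D.ψp P)) = 0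
  ψm_e : gXY P 1 1 (prodXY (D.ψm P) D.e) + gYX P 1 1 (prodYX D.e (D.ψm P)) = 0
  ψp_f : gYX P 1 1 (prodXY (D.ψp P) D.f) + gXY P 1 1 (prodYX D.f (D.ψp P)) = 0
  ψm_f : gYX P D.C 1 (prodXY (D.ψm P) D.f) + gXY P D.C 1 (prodYX D.f (D.ψm P)) = 0
  ef : prodXY D.e D.f - prodYX D.f D.e =
    (P.κ 1)⁻¹ • (deltaYX D.C (inY (D.ψp P)) - deltaXY D.C (inX (D.ψm P)))
  ee : gXY P 1 1 (prodXY D.e D.e) + gYX P 1 1 (prodYX D.e D.e) = 0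
  ff : gYX P 1 1 (prodXY D.f D.f) + gXY P 1 1 (prodYX D.f D.f) = 0
  /-- `Sym z₁ z₂² [e(z₁), [e(z₂), e(z₃)]] = 0`, coefficientwise. -/
  serre_e : ∀ n : Fin 3 → ℤ, ∑ σ : Equiv.Perm (Fin 3),
    ⁅D.e (n (σ 0) + 1), ⁅D.e (n (σ 1) + 2), D.e (n (σ 2))⁆⁆ = 0
  serre_f : ∀ n : Fin 3 → ℤ, ∑ σ : Equiv.Perm (Fin 3),
    ⁅D.f (n (σ 0) + 1), ⁅D.f (n (σ 1) + 2), D.f (n (σ 2))⁆⁆ = 0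

/-! ### The currents `k_r^±` -/

namespace GL1Data

variable (P : Params) (D : GL1Data W)

open Polynomial in
/-- The fused current `c₁^r e(z) e(q₁z) ⋯ e(q₁^{r-1}z)`. In the step, `x` and `y` are the arguments
of the two factors, and `∏_{s<r} g(q₁^s x, y) = x^{3r} Q(y/x)` clears the poles. -/
def eFused : ℕ → Cur W
  | 0 => oneCur
  | r + 1 => P.c₁ • fuse
      (∏ s ∈ Finset.range r, (Polynomial.C (P.q₁ ^ s) - Polynomial.C P.q₁ * X) *
        (Polynomial.C (P.q₁ ^ s) - Polynomial.C P.q₂ * X) * (Polynomial.C (P.q₁ ^ s) - Polynomial.C P.q₃ * X))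
      1 (P.q₁ ^ r) (eFused r) D.e

open Polynomial in
/-- The fused current `(-c₁)^r f(q₁^{r-1}z) ⋯ f(q₁z) f(z)`. In the step,
`∏_{s<r} g(q₁^s y, x) = x^{3r} Q(y/x)` clears the poles. -/
def fFused : ℕ → Cur W
  | 0 => oneCur
  | r + 1 => (-P.c₁) • fuse
      (∏ s ∈ Finset.range r, (Polynomial.C (P.q₁ ^ s) * X - Polynomial.C P.q₁) *
        (Polynomial.C (P.q₁ ^ s) * X - Polynomial.C P.q₂) * (Polynomial.C (P.q₁ ^ s) * X - Polynomial.C P.q₃))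
      (P.q₁ ^ r) 1 D.f (fFused r)

/-- `k_0⁺(z) = K exp (∑_{r ≥ 1} κ_r (q₁^{-r} - 1)⁻¹ h_r z^{-r})`. -/
def k₀p (K : (End ℂ W)ˣ) : Cur W := posCur fun n =>
  (K : End ℂ W) * expCoeff (fun r => (P.κ r / (P.q₁ ^ (-(r : ℤ)) - 1)) • D.h r) n

/-- `k_0⁻(z) = K⁻¹ exp (∑_{r ≥ 1} κ_r (q₁^{r} - 1)⁻¹ h_{-r} z^{r})`. -/
def k₀m (K : (End ℂ W)ˣ) : Cur W := negCur fun n =>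
  ((K⁻¹ : (End ℂ W)ˣ) : End ℂ W) *
    expCoeff (fun r => (P.κ r / (P.q₁ ^ (r : ℤ) - 1)) • D.h (-(r : ℤ))) n

/-- `k_r⁺(z)`: the fused current of the `f`'s times `k_0⁺(z)`. -/
def kp (K : (End ℂ W)ˣ) (r : ℕ) : Cur W := mulCur (D.fFused P r) (D.k₀p P K)

/-- `k_r⁻(z)`: `k_0⁻(z)` times the fused current of the `e`'s. -/
def km (K : (End ℂ W)ˣ) (r : ℕ) : Cur W := mulCur (D.k₀m P K) (D.eFused P r)

end GL1Data

/-! ### The shifted algebra `A₁` -/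

/-- Operators on `W` for the generators of `A₁`: two copies `E`, `Ec` of the `gl₁` generators,
`K`, `Kc`, and `X^±`. The index of `X⁺` is a half-integer and that of `X⁻` an integer:
`Xp i k` is `X⁺_{i+1/2, k}` and `Xm j k` is `X⁻_{j, k}`. -/
structure A1Data (W : Type*) [AddCommGroup W] [Module ℂ W] where
  E : GL1Data W
  Ec : GL1Data W
  K : (End ℂ W)ˣ
  Kc : (End ℂ W)ˣ
  Xp : ℤ → Cur W
  Xm : ℤ → Cur W

/-- The sum of `F r r'` over `r, r' ≥ 0` with `r + r' = M` (zero if `M < 0`). -/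
def sumPairs {G : Type*} [AddCommMonoid G] (M : ℤ) (F : ℕ → ℕ → G) : G :=
  if 0 ≤ M then ∑ p ∈ Finset.HasAntidiagonal.antidiagonal M.toNat, F p.1 p.2 else 0

/-- Multiplication by a complex number, as an operator. -/
def sca (c : ℂ) : End ℂ W := algebraMap ℂ (End ℂ W) c

/-- The relations of `K₁`, the tensor product of the two toroidal `gl₁` algebras, extended by
`K` and `Kc` and with `ψ₀ = ψ₀ᶜ = 1`, `C = q₁^{1/2} Cᶜ`. -/
structure A1Cartan (P : Params) (A : A1Data W) : Prop where
  E_rel : IsGL1 P A.E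
  Ec_rel : IsGL1 P.check A.Ec
  E_Ec : ∀ a ∈ A.E.gens, ∀ b ∈ A.Ec.gens, Commute a b
  K_central : ∀ a ∈ A.E.gens ∪ A.Ec.gens, Commute (A.K : End ℂ W) a
  Kc_central : ∀ a ∈ A.E.gens ∪ A.Ec.gens, Commute (A.Kc : End ℂ W) a
  K_Kc : Commute (A.K : End ℂ W) A.Kc
  ψ₀_eq : A.E.ψ₀ = 1
  ψ₀c_eq : A.Ec.ψ₀ = 1
  C_eq : (A.E.C : End ℂ W) = P.s₁ • (A.Ec.C : End ℂ W)

/-- The relations between `X^±` and `K₁`. Variables `x = u`, `y = z`; conjugations by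
`ψ^±(u)` are written with the inverse moved to the other side. The powers `q₁^i` with `i` a
half-integer are `P.q₁half`. -/
structure A1First (P : Params) (β : ℂ) (A : A1Data W) : Prop where
  C_Xp : ∀ i k, Commute (A.E.C : End ℂ W) (A.Xp i k)
  C_Xm : ∀ i k, Commute (A.E.C : End ℂ W) (A.Xm i k)
  K_Xp : ∀ i k, (A.K : End ℂ W) * A.Xp i k = Complex.exp (β / 2 * P.l₂) • (A.Xp i k * A.K)
  K_Xm : ∀ i k, (A.K : End ℂ W) * A.Xm i k = Complex.exp (-(β / 2) * P.l₂) • (A.Xm i k * A.K)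
  Kc_Xp : ∀ i k, (A.Kc : End ℂ W) * A.Xp i k =
    Complex.exp ((2 - β) / 2 * P.check.l₂) • (A.Xp i k * A.Kc)
  Kc_Xm : ∀ i k, (A.Kc : End ℂ W) * A.Xm i k =
    Complex.exp (-((2 - β) / 2) * P.check.l₂) • (A.Xm i k * A.Kc)
  e_Xp : ∀ i, prodXY A.E.e (A.Xp i) - seriesXY P.ωm 1 (prodYX (A.Xp i) A.E.e) =
    (P.s₁⁻¹ - P.s₁)⁻¹ • deltaYX 1 (inY (rescale P.q₁ (A.Xp (i - 1))))
  f_Xp : ∀ i, prodXY A.E.f (A.Xp i) - prodYX (A.Xp i) A.E.f =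
    (P.s₁⁻¹ - P.s₁)⁻¹ • deltaYX (expUnit W (-P.l₁) * A.E.C⁻¹)
      (prodYX (rescale P.q₁⁻¹ (A.Xp (i + 1))) (A.E.ψp P))
  ψp_Xp : ∀ i, prodXY (A.E.ψp P) (A.Xp i) =
    seriesYX P.ωp A.E.C⁻¹ (prodYX (A.Xp i) (A.E.ψp P))
  ψm_Xp : ∀ i, prodXY (A.E.ψm P) (A.Xp i) =
    seriesXY P.ωm 1 (prodYX (A.Xp i) (A.E.ψm P))
  ec_Xp : ∀ i : ℤ, prodXY A.Ec.e (A.Xp i) -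
      seriesXY P.check.ωm (expUnit W (-((i + 1 / 2) * P.l₁))) (prodYX (A.Xp i) A.Ec.e) =
    (P.check.s₁⁻¹ - P.check.s₁)⁻¹ • deltaYX (expUnit W ((i + 1 / 2) * P.l₁))
      (inY (A.Xp (i - 1)))
  fc_Xp : ∀ i : ℤ, prodXY A.Ec.f (A.Xp i) - prodYX (A.Xp i) A.Ec.f =
    (P.check.s₁⁻¹ - P.check.s₁)⁻¹ • deltaYX (expUnit W ((i + 1 / 2 + 1) * P.l₁) * A.Ec.C⁻¹)
      (prodYX (A.Xp (i + 1)) (A.Ec.ψp P.check))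
  ψpc_Xp : ∀ i : ℤ, prodXY (A.Ec.ψp P.check) (A.Xp i) =
    seriesYX P.check.ωp (expUnit W ((i + 1 / 2) * P.l₁) * A.Ec.C⁻¹)
      (prodYX (A.Xp i) (A.Ec.ψp P.check))
  ψmc_Xp : ∀ i : ℤ, prodXY (A.Ec.ψm P.check) (A.Xp i) =
    seriesXY P.check.ωm (expUnit W (-((i + 1 / 2) * P.l₁)))
      (prodYX (A.Xp i) (A.Ec.ψm P.check))
  e_Xm : ∀ j, prodYX (A.Xm j) A.E.e - prodXY A.E.e (A.Xm j) =
    (P.s₁⁻¹ - P.s₁)⁻¹ • deltaYX (expUnit W (-P.l₁) * A.E.C⁻¹)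
      (prodXY (A.E.ψm P) (rescale P.q₁⁻¹ (A.Xm (j - 1))))
  f_Xm : ∀ j, prodYX (A.Xm j) A.E.f - seriesYX P.ωp 1 (prodXY A.E.f (A.Xm j)) =
    (P.s₁⁻¹ - P.s₁)⁻¹ • deltaYX 1 (inY (rescale P.q₁ (A.Xm (j + 1))))
  ψp_Xm : ∀ j, prodYX (A.Xm j) (A.E.ψp P) =
    seriesYX P.ωp 1 (prodXY (A.E.ψp P) (A.Xm j))
  ψm_Xm : ∀ j, prodYX (A.Xm j) (A.E.ψm P) =
    seriesXY P.ωm A.E.C (prodXY (A.E.ψm P) (A.Xm j))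
  ec_Xm : ∀ j : ℤ, prodYX (A.Xm j) A.Ec.e - prodXY A.Ec.e (A.Xm j) =
    (P.check.s₁⁻¹ - P.check.s₁)⁻¹ • deltaYX (expUnit W ((1 - j) * P.l₁) * A.Ec.C⁻¹)
      (prodXY (A.Ec.ψm P.check) (A.Xm (j - 1)))
  fc_Xm : ∀ j : ℤ, prodYX (A.Xm j) A.Ec.f -
      seriesYX P.check.ωp (expUnit W (-j * P.l₁)) (prodXY A.Ec.f (A.Xm j)) =
    (P.check.s₁⁻¹ - P.check.s₁)⁻¹ • deltaYX (expUnit W (-j * P.l₁)) (inY (A.Xm (j + 1)))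
  ψpc_Xm : ∀ j : ℤ, prodYX (A.Xm j) (A.Ec.ψp P.check) =
    seriesYX P.check.ωp (expUnit W (-j * P.l₁)) (prodXY (A.Ec.ψp P.check) (A.Xm j))
  ψmc_Xm : ∀ j : ℤ, prodYX (A.Xm j) (A.Ec.ψm P.check) =
    seriesXY P.check.ωm (expUnit W (j * P.l₁) * A.Ec.C) (prodXY (A.Ec.ψm P.check) (A.Xm j))

/-- `∏_{r ∈ S} (a_r x + b_r y) F(x, y)` for the list `S` of the pairs `(a_r, b_r)`. -/
def linProd (S : List (ℂ × ℂ)) (F : Cur₂ W) : Cur₂ W :=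
  S.foldr (fun p G => linMul (sca p.1) (sca p.2) G) F

/-- The relations among the `X⁺` and among the `X⁻`. Variables `x = z`, `y = w`; in the relations
for different indices the second index is `i + d + 1`. -/
structure A1Second (P : Params) (A : A1Data W) : Prop where
  XpXp_same : ∀ i, linMul 1 (-sca P.q₂) (prodXY (A.Xp i) (A.Xp i)) +
    linMul (-sca P.q₂) 1 (prodYX (A.Xp i) (A.Xp i)) = 0
  XmXm_same : ∀ i, linMul (sca P.q₂) (-1) (prodXY (A.Xm i) (A.Xm i)) +
    linMul (-1) (sca P.q₂) (prodYX (A.Xm i) (A.Xm i)) = 0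
  XpXp : ∀ (i : ℤ) (d : ℕ),
    linProd ((List.range d).map fun r => (1, -P.q₁ ^ (r + 1)))
        (prodXY (A.Xp i) (A.Xp (i + d + 1))) +
      ((-1) ^ (d + 1) * P.q₂) • seriesXY (P.pp (d + 1)) 1
        (linProd ((List.range d).map fun r => (-1, P.q₃⁻¹ * P.q₁ ^ r))
          (prodYX (A.Xp (i + d + 1)) (A.Xp i))) = 0
  XmXm : ∀ (i : ℤ) (d : ℕ),
    linProd ((List.range d).map fun r => (-P.q₁ ^ (r + 1), 1))
        (prodXY (A.Xm i) (A.Xm (i + d + 1))) +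
      ((-1) ^ (d + 1) * P.q₂) • seriesXY (P.pm (d + 1)) 1
        (linProd ((List.range d).map fun r => (P.q₃⁻¹ * P.q₁ ^ r, -1))
          (prodYX (A.Xm (i + d + 1)) (A.Xm i))) = 0

/-- The relations between `X⁺_{i+1/2}(z)` and `X⁻_j(w)`, with shift `N = 1`: here
`(i + 1/2) + j + N/2 = i + j + 1`, `-(i + 1/2) - j + N/2 = -i - j` and `-(-1)^N = 1`.
Variables `x = z`, `y = w`. -/
def A1Third (P : Params) (A : A1Data W) : Prop :=
  ∀ i j : ℤ, prodXY (A.Xp i) (A.Xm j) - prodYX (A.Xm j) (A.Xp i) =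
    sumPairs (i + j + 1) (fun r r' =>
      deltaYX (A.E.C * expUnit W (-r * P.l₁)) (inY (mulCur
        (rescale (P.q₁ ^ (-(r : ℤ))) (A.E.kp P A.K r))
        (rescale (P.check.q₁ ^ (-(r' : ℤ)) * P.q₁ ^ (-j)) (A.Ec.kp P.check A.Kc r'))))) +
    sumPairs (-i - j) (fun r r' =>
      deltaXY (A.E.C * expUnit W (-r * P.l₁)) (inX (mulCur
        (rescale (P.q₁ ^ (-(r : ℤ))) (A.E.km P A.K r))
        (rescale (P.check.q₁ ^ (-(r' : ℤ)) * P.q₁half i) (A.Ec.km P.check A.Kc r')))))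

/-- The operators satisfy the relations of `A₁(q₁, q₂, q₃)`. -/
structure IsA1 (P : Params) (β : ℂ) (A : A1Data W) : Prop where
  cartan : A1Cartan P A
  first : A1First P β A
  second : A1Second P A
  third : A1Third P A

/-- `T` has degree `a` and weight `b` for the bigrading `V`. -/
def HasDeg (V : ℤ × ℤ → Submodule ℂ W) (a b : ℤ) (T : End ℂ W) : Prop :=
  ∀ d : ℤ × ℤ, ∀ w ∈ V d, T w ∈ V (d.1 + a, d.2 + b)

/-- The generators of a toroidal `gl₁` have their degrees and weight `0`. -/
structure GL1Data.Graded (V : ℤ × ℤ → Submodule ℂ W) (D : GL1Data W) : Prop where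
  e : ∀ k, HasDeg V k 0 (D.e k)
  f : ∀ k, HasDeg V k 0 (D.f k)
  h : ∀ r, HasDeg V r 0 (D.h r)
  C : HasDeg V 0 0 D.C
  C_inv : HasDeg V 0 0 ((D.C⁻¹ : (End ℂ W)ˣ) : End ℂ W)
  ψ₀ : HasDeg V 0 0 D.ψ₀
  ψ₀_inv : HasDeg V 0 0 ((D.ψ₀⁻¹ : (End ℂ W)ˣ) : End ℂ W)

/-- The action is graded by degree and weight, `W = ⨁ W_{d₁,d₂}` with finite-dimensional
components, and for each `d₂` the degrees `d₁` with `W_{d₁,d₂} ≠ 0` are bounded above. -/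
structure A1Data.IsAdmissibleFor (V : ℤ × ℤ → Submodule ℂ W) (A : A1Data W) : Prop where
  internal : DirectSum.IsInternal V
  finite : ∀ d, FiniteDimensional ℂ (V d)
  bounded : ∀ d₂ : ℤ, ∃ d : ℤ, ∀ d₁ > d, V (d₁, d₂) = ⊥
  E : A.E.Graded V
  Ec : A.Ec.Graded V
  K : HasDeg V 0 0 A.K
  K_inv : HasDeg V 0 0 ((A.K⁻¹ : (End ℂ W)ˣ) : End ℂ W)
  Kc : HasDeg V 0 0 A.Kc
  Kc_inv : HasDeg V 0 0 ((A.Kc⁻¹ : (End ℂ W)ˣ) : End ℂ W)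
  Xp : ∀ i k, HasDeg V k 1 (A.Xp i k)
  Xm : ∀ i k, HasDeg V k (-1) (A.Xm i k)

/-- The operators `A` make `W` an admissible `A₁(q₁, q₂, q₃)`-module. -/
def IsAdmissibleA1Module (P : Params) (β : ℂ) (A : A1Data W) : Prop :=
  IsA1 P β A ∧ ∃ V : ℤ × ℤ → Submodule ℂ W, A.IsAdmissibleFor V

/-! ### The Fock module of color 1 -/

/-- The space `ℂ[h_r]_{r<0}`; the variable with index `n` is `h_{-n}`. -/
abbrev FockSpace := MvPolynomial ℕ+ ℂ

/-- `h_{-n}` acts by multiplication, `h_n` by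
`-(n s₁^n (1 - q₂^n)(1 - q₃^n))⁻¹ ∂ / ∂h_{-n}`, for `n ≥ 1`. -/
def fockH (P : Params) : ℤ → End ℂ FockSpace
  | Int.ofNat 0 => 0
  | Int.ofNat (n + 1) =>
      (-(((n + 1 : ℕ) : ℂ) * P.s₁ ^ (n + 1) * (1 - P.q₂ ^ (n + 1)) * (1 - P.q₃ ^ (n + 1)))⁻¹) •
        (MvPolynomial.pderiv (R := ℂ) n.succPNat).toLinearMap
  | Int.negSucc n => LinearMap.mulLeft ℂ (MvPolynomial.X n.succPNat)

/-- The vertex operator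
`exp (∑_{r ≥ 1} a_r h_{-r} z^r) exp (∑_{r ≥ 1} b_r h_r z^{-r})`. -/
def fockVertex (P : Params) (a b : ℕ → ℂ) : Cur FockSpace :=
  mulCur (negCur (expCoeff fun r => a r • fockH P (-(r : ℤ))))
    (posCur (expCoeff fun r => b r • fockH P r))

/-- The Fock representation `F₁(v)` of color 1 of `E₁(q₁, q₂, q₃)`: level `C = s₁`, `ψ₀ = 1`. -/
def fock (P : Params) (v : ℂ) : GL1Data FockSpace where
  e := (P.s₁⁻¹ * v / ((1 - P.q₂) * (1 - P.q₃))) • fockVertex P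
    (fun r => (1 - P.q₂ ^ r) * (1 - P.q₃ ^ r))
    (fun r => (1 - P.q₂⁻¹ ^ r) * (1 - P.q₃⁻¹ ^ r) * P.s₁⁻¹ ^ r)
  f := (-(P.s₁⁻¹ * v⁻¹) / ((1 - P.q₂) * (1 - P.q₃))) • fockVertex P
    (fun r => -((1 - P.q₂ ^ r) * (1 - P.q₃ ^ r) * P.s₁ ^ r))
    (fun r => -((1 - P.q₂⁻¹ ^ r) * (1 - P.q₃⁻¹ ^ r)))
  h := fockH P
  C := expUnit FockSpace (P.l₁ / 2)
  ψ₀ := 1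

end

end Toroidal

open Toroidal

namespace Toroidal

noncomputable section

/-! Since `X^±` act by zero, the relations linear or quadratic in them are empty, and the toroidal
factor with `e = f = h = 0` satisfies its own relations trivially. Two things remain: the toroidal
relations on the Fock space, including the Serre relations, and the vanishing of the right side of
the relation for `[X⁺, X⁻]`.

The currents on the Fock space are vertex operators `A(z) B(z)`, a creation exponential times an
annihilation exponential. By Wick's theorem (`Contracts.prodXY_eq`, `fockPair_contracts`) a product
of two of them is a normally ordered product, symmetric in the two factors, times a contraction: the
expansion of an explicit rational function of the ratio of the arguments. The relations of `ψ^±`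
with `e`, `f` and the quadratic relations thus become identities of power series. In `[e, f]` the
same function is expanded in two regions; by partial fractions (`coeff_gMixed`) the difference is a
sum of two delta functions, on whose supports the normally ordered product collapses to `ψ⁺` or
`ψ⁻`.

The Serre relation is a rational identity among six products of three contractions, each expanded in
its own region. Scaling the poles by a formal parameter `ε` puts all expansions in one ring, where
the identity is algebraic (`serre_sum`). On a given vector high powers of the ratios act by zero, so
`ε` can be set to `1` (`Vanishes.sum_coeff_scaledG`).

For the last relation, the contraction of `e(x) e(y)` vanishes at `y = q₁ x`, and that of `f(x)
f(y)` at `x = q₁ y`; hence `k_r^± = 0` for `r ≥ 2` (`eFused_fock`, `fFused_fock`). In `k₁^±` one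
half of the vertex operator is cancelled by `k₀^±`, so that, up to a shift of the argument, `k₁⁻ =
-k₀⁺` and `k₁⁺ = -k₀⁻`, provided that `K² = v`. The terms on the right side therefore vanish or
cancel in pairs.

Exponentials of operators are handled through the differential equation `t E' = t c' E`, and all
infinite sums are locally finite because the degrees on the Fock space are bounded above. -/

/-! ### Exponentials of power series over a noncommutative algebra -/

section Exponential

open PowerSeries Finset

variable {R : Type*} [Ring R] [Algebra ℂ R]

/-- The Euler operator `t d/dt`. -/
def euler (E : R⟦X⟧) : R⟦X⟧ := PowerSeries.mk fun n => (n : ℂ) • coeff n E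

@[simp] lemma coeff_euler (E : R⟦X⟧) (n : ℕ) : coeff n (euler E) = (n : ℂ) • coeff n E := by
  simp [euler]

lemma euler_add (E F : R⟦X⟧) : euler (E + F) = euler E + euler F := by
  ext n; simp

lemma euler_one : euler (1 : R⟦X⟧) = 0 := by
  ext n
  rcases n with _ | n <;> simp [coeff_one]

lemma euler_mul (E F : R⟦X⟧) : euler (E * F) = euler E * F + E * euler F := by
  ext n
  simp only [coeff_euler, map_add, coeff_mul, smul_sum]
  rw [← sum_add_distrib]
  refine sum_congr rfl fun p hp => ?_
  rw [HasAntidiagonal.mem_antidiagonal] at hp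
  rw [← hp, smul_mul_assoc, mul_smul_comm, ← add_smul]
  push_cast
  rfl

/-- `E = exp c`, as a formal power series whose constant term is `1`; the constant term of `c` is
disregarded. -/
structure IsExp (c E : R⟦X⟧) : Prop where
  const : coeff 0 E = 1
  euler_eq : euler E = euler c * E

/-- The term with `p.1 = 0` is zero, so over `ℂ` each coefficient is determined by lower ones. The
inductions on exponentials run along this recursion. -/
lemma IsExp.recursion {c E : R⟦X⟧} (h : IsExp c E) (n : ℕ) : (n : ℂ) • coeff n E =
    ∑ p ∈ antidiagonal n, (p.1 : ℂ) • (coeff p.1 c * coeff p.2 E) := by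
  rw [← coeff_euler, h.euler_eq, coeff_mul]
  simp

/-- Induction along the recursion satisfied by the coefficients of an exponential. -/
lemma IsExp.unique {c E F : R⟦X⟧} (hE : IsExp c E) (hF : IsExp c F) : E = F := by
  ext n
  induction n using Nat.strong_induction_on with
  | _ n ih =>
    rcases Nat.eq_zero_or_pos n with rfl | hn
    · rw [hE.const, hF.const]
    · have hn' : (n : ℂ) ≠ 0 := by exact_mod_cast hn.ne'
      refine smul_right_injective R hn' ?_
      simp only
      rw [hE.recursion, hF.recursion]
      refine sum_congr rfl fun p hp => ?_
      rw [HasAntidiagonal.mem_antidiagonal] at hp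
      rcases Nat.eq_zero_or_pos p.1 with h0 | h0
      · simp [h0]
      · rw [ih p.2 (by omega)]

lemma IsExp.zero : IsExp (0 : R⟦X⟧) 1 :=
  ⟨by simp, by simp [euler_one, show euler (0 : R⟦X⟧) = 0 by ext; simp]⟩

omit [Algebra ℂ R] in
lemma commute_of_coeff {E F : R⟦X⟧} (h : ∀ i j, Commute (coeff i E) (coeff j F)) :
    Commute E F := by
  ext n
  rw [coeff_mul, coeff_mul, ← Nat.sum_antidiagonal_swap]
  exact sum_congr rfl fun p _ => h _ _

lemma IsExp.commute_coeff {c E : R⟦X⟧} (hE : IsExp c E) {x : R}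
    (hx : ∀ r, 0 < r → Commute x (coeff r c)) (n : ℕ) : Commute x (coeff n E) := by
  induction n using Nat.strong_induction_on with
  | _ n ih =>
    rcases Nat.eq_zero_or_pos n with rfl | hn
    · rw [hE.const]; exact Commute.one_right x
    · have hn' : (n : ℂ) ≠ 0 := by exact_mod_cast hn.ne'
      have key : Commute x ((n : ℂ) • coeff n E) := by
        rw [hE.recursion]
        refine Commute.sum_right _ _ _ fun p hp => ?_
        rw [HasAntidiagonal.mem_antidiagonal] at hp
        rcases Nat.eq_zero_or_pos p.1 with h0 | h0
        · simp [h0]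
        · exact ((hx _ h0).mul_right (ih _ (by omega))).smul_right _
      have := key.smul_right ((n : ℂ)⁻¹)
      rwa [inv_smul_smul₀ hn'] at this

/-- In the product rule `E` has to pass `euler d`, and it can, since its coefficients are built from
those of `c`. -/
lemma IsExp.mul {c d E F : R⟦X⟧} (hE : IsExp c E) (hF : IsExp d F)
    (h : ∀ i j, 0 < i → 0 < j → Commute (coeff i c) (coeff j d)) :
    IsExp (c + d) (E * F) := by
  refine ⟨by simp [coeff_mul, hE.const, hF.const], ?_⟩
  have hc : Commute E (euler d) := by
    refine commute_of_coeff fun i j => ?_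
    rw [coeff_euler]
    rcases Nat.eq_zero_or_pos j with rfl | hj
    · simp
    · exact ((hE.commute_coeff (fun r hr => (h r j hr hj).symm) i).symm).smul_right _
  rw [euler_mul, hE.euler_eq, hF.euler_eq, euler_add, ← mul_assoc E, hc.eq]
  simp only [add_mul, mul_assoc]

lemma IsExp.rescale {c E : R⟦X⟧} (hE : IsExp c E) (a : ℂ) :
    IsExp (PowerSeries.mk fun n => a ^ n • coeff n c)
      (PowerSeries.mk fun n => a ^ n • coeff n E) := by
  refine ⟨by simp [hE.const], ?_⟩
  ext n
  simp only [coeff_euler, coeff_mk, coeff_mul]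
  rw [smul_comm, hE.recursion, smul_sum]
  refine sum_congr rfl fun p hp => ?_
  rw [HasAntidiagonal.mem_antidiagonal] at hp
  rw [← hp, pow_add]
  simp only [smul_mul_assoc, mul_smul_comm, smul_smul]
  congr 1; ring

/-- Moving an exponential of operators across a family that they shift. -/
lemma IsExp.mul_shift {c E : R⟦X⟧} (hE : IsExp c E) {ν g : PowerSeries ℂ} (hg : IsExp ν g)
    {T : ℤ → R} (hT : ∀ r : ℕ, 0 < r → ∀ n : ℤ,
      coeff r c * T n = T n * coeff r c + coeff r ν • T (n - r)) (m : ℕ) (n : ℤ) :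
    coeff m E * T n = ∑ p ∈ antidiagonal m, coeff p.1 g • (T (n - p.1) * coeff p.2 E) := by
  induction m using Nat.strong_induction_on generalizing n with
  | _ m ih =>
  rcases Nat.eq_zero_or_pos m with rfl | hm
  · simp [hE.const, hg.const]
  have hm' : (m : ℂ) ≠ 0 := by exact_mod_cast hm.ne'
  refine smul_right_injective R hm' ?_
  simp only
  rw [← smul_mul_assoc, hE.recursion, sum_mul]
  -- Commuting the coefficients of `c` past `T` gives two sums. In one the recursion for `E`
  -- restores a coefficient of `E` with weight `p.2` (`e2`); in the other the shifts compose and the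
  -- recursion for `g` gives weight `p.1` (`e3`). The weights add up to `m`.
  have e1 : ∀ p ∈ antidiagonal m, ((p.1 : ℂ) • (coeff p.1 c * coeff p.2 E)) * T n =
      ∑ q ∈ antidiagonal p.2, ((coeff q.1 g • (T (n - q.1) *
          ((p.1 : ℂ) • (coeff p.1 c * coeff q.2 E)))) +
        (((p.1 : ℂ) * coeff p.1 ν * coeff q.1 g) • (T (n - (q.1 + p.1 : ℕ)) * coeff q.2 E))) := by
    intro p hp
    rw [HasAntidiagonal.mem_antidiagonal] at hp
    rcases Nat.eq_zero_or_pos p.1 with h0 | h0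
    · simp [h0]
    rw [smul_mul_assoc, mul_assoc, ih p.2 (by omega), mul_sum, smul_sum]
    refine sum_congr rfl fun q _ => ?_
    rw [mul_smul_comm, ← mul_assoc, hT _ h0, add_mul, smul_add, smul_add]
    congr 1
    · rw [mul_smul_comm, smul_comm, mul_assoc]
    · rw [smul_mul_assoc, smul_smul, smul_smul, sub_sub]
      push_cast
      congr 1; ring
  rw [sum_congr rfl e1]
  simp only [sum_add_distrib]
  have e2 : ∑ p ∈ antidiagonal m, ∑ q ∈ antidiagonal p.2,
      (coeff q.1 g • (T (n - q.1) * ((p.1 : ℂ) • (coeff p.1 c * coeff q.2 E)))) =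
      ∑ p ∈ antidiagonal m, coeff p.1 g • (T (n - p.1) * ((p.2 : ℂ) • coeff p.2 E)) := by
    simp_rw [hE.recursion, mul_sum, smul_sum]
    rw [sum_sigma', sum_sigma']
    refine sum_bij' (fun x _ => ⟨(x.2.1, x.1.1 + x.2.2), (x.1.1, x.2.2)⟩)
      (fun x _ => ⟨(x.2.1, x.1.1 + x.2.2), (x.1.1, x.2.2)⟩) ?_ ?_ ?_ ?_ ?_
    · rintro ⟨⟨a, b⟩, ⟨c, d⟩⟩ h; simp at h ⊢; omega
    · rintro ⟨⟨a, b⟩, ⟨c, d⟩⟩ h; simp at h ⊢; omega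
    · rintro ⟨⟨a, b⟩, ⟨c, d⟩⟩ h; simp at h ⊢; omega
    · rintro ⟨⟨a, b⟩, ⟨c, d⟩⟩ h; simp at h ⊢; omega
    · rintro ⟨⟨a, b⟩, ⟨c, d⟩⟩ h; rfl
  have e3 : ∑ p ∈ antidiagonal m, ∑ q ∈ antidiagonal p.2,
      (((p.1 : ℂ) * coeff p.1 ν * coeff q.1 g) • (T (n - (q.1 + p.1 : ℕ)) * coeff q.2 E)) =
      ∑ p ∈ antidiagonal m, ((p.1 : ℂ) * coeff p.1 g) • (T (n - p.1) * coeff p.2 E) := by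
    have hr : ∀ k : ℕ, (k : ℂ) * coeff k g =
        ∑ p ∈ antidiagonal k, (p.1 : ℂ) * coeff p.1 ν * coeff p.2 g := fun k => by
      rw [← smul_eq_mul, hg.recursion]
      simp only [smul_eq_mul, mul_assoc]
    simp_rw [hr, sum_smul]
    rw [sum_sigma', sum_sigma']
    refine sum_bij' (fun x _ => ⟨(x.1.1 + x.2.1, x.2.2), (x.1.1, x.2.1)⟩)
      (fun x _ => ⟨(x.2.1, x.2.2 + x.1.2), (x.2.2, x.1.2)⟩) ?_ ?_ ?_ ?_ ?_
    · rintro ⟨⟨a, b⟩, ⟨c, d⟩⟩ h; simp at h ⊢; omega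
    · rintro ⟨⟨a, b⟩, ⟨c, d⟩⟩ h; simp at h ⊢; omega
    · rintro ⟨⟨a, b⟩, ⟨c, d⟩⟩ h; simp at h ⊢; omega
    · rintro ⟨⟨a, b⟩, ⟨c, d⟩⟩ h; simp at h ⊢; omega
    · rintro ⟨⟨a, b⟩, ⟨c, d⟩⟩ h; simp only [add_comm]
  rw [e2, e3, ← sum_add_distrib, smul_sum]
  refine sum_congr rfl fun p hp => ?_
  rw [HasAntidiagonal.mem_antidiagonal] at hp
  rw [mul_smul_comm, smul_smul, smul_smul, ← add_smul, ← hp]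
  push_cast
  congr 1; ring

omit [Algebra ℂ R] in
-- This is why the finite sum in `expCoeff` is the full exponential sum.
lemma coeff_pow_eq_zero {p : R⟦X⟧} (hp : coeff 0 p = 0) (k : ℕ) :
    ∀ n < k, coeff n (p ^ k) = 0 := by
  induction k with
  | zero => simp
  | succ k ih =>
    intro n hn
    rw [pow_succ', coeff_mul]
    refine sum_eq_zero fun q hq => ?_
    rw [HasAntidiagonal.mem_antidiagonal] at hq
    rcases Nat.eq_zero_or_pos q.1 with h0 | h0
    · rw [h0, hp, zero_mul]
    · rw [ih q.2 (by omega), mul_zero]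

lemma euler_pow_succ {p : R⟦X⟧} (hp : Commute p (euler p)) (k : ℕ) :
    euler (p ^ (k + 1)) = ((k : ℂ) + 1) • (euler p * p ^ k) := by
  induction k with
  | zero => simp
  | succ k ih =>
    rw [pow_succ', euler_mul, ih, mul_smul_comm, ← mul_assoc, hp.eq, mul_assoc, ← pow_succ']
    push_cast
    module

end Exponential

/-! ### The exponential sum solves the differential equation -/

section ExpCoeff

open PowerSeries Finset

variable {W : Type*} [AddCommGroup W] [Module ℂ W]

/-- Termwise differentiation turns `p ^ (k + 1) / (k + 1)!` into `euler p * p ^ k / k!`; this needs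
`p` to commute with its derivative, hence the hypothesis on the `a i`. -/
lemma isExp_expCoeff (a : ℕ → End ℂ W) (ha : ∀ i j, 0 < i → 0 < j → Commute (a i) (a j)) :
    IsExp (PowerSeries.mk a) (PowerSeries.mk (expCoeff a)) := by
  set p : (End ℂ W)⟦X⟧ := PowerSeries.mk fun r => if r = 0 then 0 else a r with hp
  have hp0 : coeff 0 p = 0 := by simp [hp]
  have hE : ∀ n N : ℕ, n < N → expCoeff a n =
      ∑ k ∈ range N, ((k.factorial : ℂ)⁻¹) • coeff n (p ^ k) := by
    intro n N h
    rw [expCoeff]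
    refine sum_subset (range_subset_range.2 h) fun k _ hk => ?_
    rw [mem_range, not_lt] at hk
    rw [coeff_pow_eq_zero hp0 k n (by omega), smul_zero]
  have heu : euler (PowerSeries.mk a) = euler p := by
    ext1 n
    rcases n with _ | n <;> simp [hp]
  have hcomm : Commute p (euler p) := by
    refine commute_of_coeff fun i j => ?_
    rw [coeff_euler]
    refine Commute.smul_right ?_ _
    rcases Nat.eq_zero_or_pos i with rfl | hi
    · simp [hp]
    rcases Nat.eq_zero_or_pos j with rfl | hj
    · simp [hp]
    · simpa [hp, hi.ne', hj.ne'] using ha i j hi hj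
  refine ⟨by simp [expCoeff], ?_⟩
  rw [heu]
  ext1 n
  rw [coeff_euler, coeff_mk, hE n (n + 1) (by omega), sum_range_succ', smul_add]
  -- The term `k = 0` is the constant series `1`, which the Euler operator kills.
  have h0 : (n : ℂ) • (((Nat.factorial 0 : ℂ)⁻¹) • coeff n (p ^ 0)) = 0 := by
    rcases n with _ | n <;> simp [coeff_one]
  rw [h0, add_zero, smul_sum, coeff_mul]
  have h1 : ∀ k ∈ range n, (n : ℂ) • ((((k + 1).factorial : ℕ) : ℂ)⁻¹ • coeff n (p ^ (k + 1))) =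
      ∑ q ∈ antidiagonal n, coeff q.1 (euler p) * ((k.factorial : ℂ)⁻¹ • coeff q.2 (p ^ k)) := by
    intro k _
    rw [smul_comm, ← coeff_euler, euler_pow_succ hcomm, coeff_smul, smul_smul, coeff_mul, smul_sum]
    refine sum_congr rfl fun q _ => ?_
    rw [mul_smul_comm]
    congr 1
    have : ((k : ℂ) + 1) ≠ 0 := by exact_mod_cast Nat.succ_ne_zero k
    have h2 : (k.factorial : ℂ) ≠ 0 := by exact_mod_cast k.factorial_ne_zero
    rw [Nat.factorial_succ]
    push_cast
    field_simp
  rw [sum_congr rfl h1, sum_comm]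
  refine sum_congr rfl fun q hq => ?_
  rw [HasAntidiagonal.mem_antidiagonal] at hq
  rcases Nat.eq_zero_or_pos q.1 with h0 | h0
  · simp [h0]
  -- Here `q.1 > 0`, so `q.2 < n` and `n` terms of the exponential sum suffice.
  · rw [coeff_mk, hE q.2 n (by omega), mul_sum]

end ExpCoeff

/-! ### Linear factors and geometric series as exponentials -/

section Scalar

open PowerSeries Finset

/-- The logarithm of `(1 - xt)⁻¹`. -/
def logInv (x : ℂ) : PowerSeries ℂ := PowerSeries.mk fun r => x ^ r / r

/-- The expansion of `(1 - xt)⁻¹`. -/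
def geom (x : ℂ) : PowerSeries ℂ := PowerSeries.mk fun r => x ^ r

lemma one_sub_mul_geom (x : ℂ) : (1 - C x * X) * geom x = 1 := by
  ext n
  rcases n with _ | n
  · simp [geom, sub_mul, mul_assoc]
  · simp [geom, sub_mul, mul_assoc, coeff_succ_X_mul, coeff_one, pow_succ']

lemma euler_logInv (x : ℂ) : (1 - C x * X) * euler (logInv x) = C x * X := by
  ext n
  rcases n with _ | n
  · rw [coeff_zero_eq_constantCoeff_apply, map_mul, ← coeff_zero_eq_constantCoeff_apply (euler _),
      coeff_euler]
    simp
  · rcases n with _ | n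
    · simp [sub_mul, mul_assoc, coeff_succ_X_mul, logInv]
    · have h1 : ((n : ℂ) + 1 + 1) ≠ 0 := by exact_mod_cast Nat.succ_ne_zero (n + 1)
      have h2 : ((n : ℂ) + 1) ≠ 0 := by exact_mod_cast Nat.succ_ne_zero n
      simp [sub_mul, mul_assoc, coeff_succ_X_mul, logInv]
      field_simp
      ring

lemma euler_one_sub (x : ℂ) : euler (1 - C x * X : PowerSeries ℂ) = -(C x * X) := by
  ext n
  rcases n with _ | _ | n
  · simp
  · simp [coeff_one]
  · simp [coeff_one]

lemma isExp_one_sub (x : ℂ) : IsExp (-logInv x) (1 - C x * X) := by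
  refine ⟨by simp, ?_⟩
  have h : euler (-logInv x) = -euler (logInv x) := by ext; simp
  rw [euler_one_sub, h, neg_mul, mul_comm (euler _), euler_logInv]

/-- Differentiate `(1 - xt) * geom x = 1` and cancel `1 - xt`. -/
lemma isExp_geom (x : ℂ) : IsExp (logInv x) (geom x) := by
  refine ⟨by simp [geom], ?_⟩
  have h0 : (1 - C x * X : PowerSeries ℂ) ≠ 0 := fun h => by
    have := one_sub_mul_geom x
    rw [h, zero_mul] at this
    exact zero_ne_one this
  refine mul_left_cancel₀ h0 ?_
  have h1 := euler_mul (1 - C x * X) (geom x)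
  rw [one_sub_mul_geom, euler_one, euler_one_sub] at h1
  rw [← mul_assoc, euler_logInv]
  linear_combination -h1

lemma IsExp.mul_scalar {c d E F : PowerSeries ℂ} (hE : IsExp c E) (hF : IsExp d F) :
    IsExp (c + d) (E * F) := hE.mul hF fun _ _ _ _ => Commute.all _ _

end Scalar

/-! ### Locally finite sums -/

section LocSum

variable {W : Type*} [AddCommGroup W] [Module ℂ W]

lemma locSum_apply {ι : Type*} {F : ι → End ℂ W}
    (h : ∀ w, (Function.support fun i => F i w).Finite) (w : W) :
    locSum F w = ∑ᶠ i, F i w := by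
  rw [locSum, dif_pos h]; rfl

/-- No finiteness is assumed: if one family is not locally finite, neither is the other, and both
sides are the default value `0`. -/
lemma locSum_congr_equiv {ι κ : Type*} (e : ι ≃ κ) (F : κ → End ℂ W) :
    locSum (fun i => F (e i)) = locSum F := by
  by_cases h : ∀ w, (Function.support fun i => F i w).Finite
  · have h' : ∀ w, (Function.support fun i => F (e i) w).Finite := fun w =>
      (h w).preimage e.injective.injOn
    ext w
    rw [locSum_apply h, locSum_apply h']
    exact finsum_comp_equiv e (f := fun i => F i w)
  · have h' : ¬ ∀ w, (Function.support fun i => F (e i) w).Finite := fun h' => h fun w => by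
      have := (h' w).preimage (f := e.symm) e.symm.injective.injOn
      refine this.subset fun i hi => ?_
      simpa using hi
    rw [locSum, locSum, dif_neg h, dif_neg h']

lemma locSum_zero {ι : Type*} : locSum (fun _ : ι => (0 : End ℂ W)) = 0 := by
  ext w
  rw [locSum_apply (by intro w; simp)]
  simp

/-- A locally finite sum with at most one nonzero term. -/
lemma locSum_eq_single {ι : Type*} {F : ι → End ℂ W} (i₀ : ι) (h : ∀ i ≠ i₀, F i = 0) :
    locSum F = F i₀ := by
  ext w
  rw [locSum_apply, finsum_eq_single _ i₀ fun i hi => by rw [h i hi]; rfl]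
  intro w
  refine (Set.finite_singleton i₀).subset fun i hi => ?_
  by_contra hne
  exact hi (show F i w = 0 by rw [h i hne]; rfl)

lemma finsum_swap {ι κ M : Type*} [AddCommMonoid M] {F : ι → κ → M}
    (h : (Function.support fun p : ι × κ => F p.1 p.2).Finite) :
    ∑ᶠ i, ∑ᶠ j, F i j = ∑ᶠ j, ∑ᶠ i, F i j := by
  rw [← finsum_curry (fun p : ι × κ => F p.1 p.2) h]
  rw [← finsum_comp_equiv (Equiv.prodComm κ ι), finsum_curry]
  · rfl
  · exact h.preimage (Equiv.prodComm κ ι).injective.injOn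

lemma finsum_eq_sum_range {M : Type*} [AddCommMonoid M] {f : ℕ → M} {L : ℕ}
    (h : ∀ k, L ≤ k → f k = 0) : ∑ᶠ k, f k = ∑ k ∈ Finset.range L, f k := by
  refine finsum_eq_sum_of_support_subset _ fun k hk => ?_
  rw [Finset.coe_range, Set.mem_Iio]
  by_contra hlt
  exact hk (h k (not_lt.1 hlt))

end LocSum

/-! ### Normally ordered exponentials -/

variable {W : Type*} [AddCommGroup W] [Module ℂ W]

/-- The coefficients of two currents `A(z) = ∑_{i ≥ 0} A_i z^i` and `B(z) = ∑_{n ≥ 0} B_n z^{-n}`,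
where `B_n` is locally nilpotent in the sense that only finitely many of them are nonzero on each
vector. -/
structure VertexPair (W : Type*) [AddCommGroup W] [Module ℂ W] where
  A : ℤ → End ℂ W
  B : ℤ → End ℂ W
  A_neg : ∀ i < 0, A i = 0
  B_neg : ∀ n < 0, B n = 0
  smooth : ∀ w, ∃ M : ℤ, ∀ n > M, B n w = 0

namespace VertexPair

variable (V V' : VertexPair W)

/-- The coefficient of `z^{-m}` in `A(z) T B(z)`. -/
def dress (m : ℤ) (T : End ℂ W) : End ℂ W := locSum fun i : ℤ => V.A i * (T * V.B (m + i))

/-- The vertex operator `A(z) B(z)`. -/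
def cur : Cur W := fun m => V.dress m 1

lemma dress_support (m : ℤ) (T : End ℂ W) (w : W) :
    (Function.support fun i : ℤ => V.A i (T (V.B (m + i) w))).Finite := by
  obtain ⟨M, hM⟩ := V.smooth w
  refine (Set.finite_Icc 0 (M - m)).subset fun i hi => ?_
  rw [Set.mem_Icc]
  by_contra h
  refine hi ?_
  rcases lt_or_ge i 0 with h0 | h0
  · simp [V.A_neg i h0]
  · simp [hM (m + i) (by omega)]

lemma dress_apply (m : ℤ) (T : End ℂ W) (w : W) :
    V.dress m T w = ∑ᶠ i : ℤ, V.A i (T (V.B (m + i) w)) :=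
  locSum_apply (V.dress_support m T) w

lemma dress_eq_zero {m : ℤ} {T : End ℂ W} {w : W} (h : ∀ q, T (V.B q w) = 0) :
    V.dress m T w = 0 := by
  rw [dress_apply]
  simp [h]

lemma dress_eq_zero_of_lt {m M : ℤ} (T : End ℂ W) {w : W} (hM : ∀ n > M, V.B n w = 0)
    (hm : M < m) : V.dress m T w = 0 := by
  rw [dress_apply]
  refine finsum_eq_zero_of_forall_eq_zero fun i => ?_
  rcases lt_or_ge i 0 with h0 | h0
  · simp [V.A_neg i h0]
  · simp [hM (m + i) (by omega)]

lemma dress_smul (m : ℤ) (c : ℂ) (T : End ℂ W) : V.dress m (c • T) = c • V.dress m T := by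
  ext w
  simp only [dress_apply, LinearMap.smul_apply, map_smul]
  rw [smul_finsum' c (V.dress_support m T w)]

lemma dress_mul {m : ℤ} {T X : End ℂ W} (h : ∀ n, Commute X (V.B n)) :
    V.dress m (T * X) = V.dress m T * X := by
  ext w
  simp only [dress_apply, Module.End.mul_apply]
  refine finsum_congr fun i => ?_
  rw [← Module.End.mul_apply X, (h _).eq]
  rfl

/-- Two families of creation operators, and of annihilation operators, commute. -/
structure Compatible : Prop where
  A_comm : ∀ i j, Commute (V.A i) (V'.A j)
  B_comm : ∀ i j, Commute (V.B i) (V'.B j)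

variable {V V'}

lemma Compatible.symm (h : Compatible V V') : Compatible V' V :=
  ⟨fun i j => (h.A_comm j i).symm, fun i j => (h.B_comm j i).symm⟩

/-- Fubini for the double sum over creation indices. Its support is finite: the indices are
nonnegative, and since the annihilation operators commute, either of them may be applied to `w`
first, which bounds both indices above. -/
lemma Compatible.dress_comm (h : Compatible V V') (m n : ℤ) (T : End ℂ W) :
    V.dress m (V'.dress n T) = V'.dress n (V.dress m T) := by
  ext w
  obtain ⟨M, hM⟩ := V.smooth w
  obtain ⟨M', hM'⟩ := V'.smooth w
  have h1 : ∀ i j : ℤ, V.A i (V'.A j (T (V'.B (n + j) (V.B (m + i) w)))) =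
      V'.A j (V.A i (T (V.B (m + i) (V'.B (n + j) w)))) := fun i j => by
    rw [← Module.End.mul_apply (V.A i), (h.A_comm i j).eq, Module.End.mul_apply,
      ← Module.End.mul_apply (V.B _), (h.B_comm _ _).eq, Module.End.mul_apply]
  have h2 : ∀ i, V.A i (V'.dress n T (V.B (m + i) w)) =
      ∑ᶠ j, V.A i (V'.A j (T (V'.B (n + j) (V.B (m + i) w)))) := fun i => by
    rw [dress_apply]
    exact (V.A i).toAddMonoidHom.map_finsum (V'.dress_support n T _)
  have h3 : ∀ j, V'.A j (V.dress m T (V'.B (n + j) w)) =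
      ∑ᶠ i, V'.A j (V.A i (T (V.B (m + i) (V'.B (n + j) w)))) := fun j => by
    rw [dress_apply]
    exact (V'.A j).toAddMonoidHom.map_finsum (V.dress_support m T _)
  rw [dress_apply, dress_apply, finsum_congr h2, finsum_congr h3, finsum_swap]
  · exact finsum_congr fun j => finsum_congr fun i => h1 i j
  · refine (Set.finite_Icc ((0, 0) : ℤ × ℤ) (M - m, M' - n)).subset fun p hp => ?_
    rw [Set.mem_Icc, Prod.mk_le_mk, Prod.mk_le_mk]
    by_contra hne
    refine hp ?_
    rcases lt_or_ge p.1 0 with h0 | h0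
    · simp [V.A_neg _ h0]
    rcases lt_or_ge p.2 0 with h0' | h0'
    · simp [V'.A_neg _ h0']
    simp only [h1]
    rcases le_or_gt (m + p.1) M with h4 | h4
    · rw [hM' (n + p.2) (by omega)]; simp
    · rw [← Module.End.mul_apply (V.B _), (h.B_comm _ _).eq, Module.End.mul_apply, hM _ h4]; simp

/-- `B(x) A'(y) = g(y/x) A'(y) B(x)`. -/
def Contracts (V V' : VertexPair W) (g : PowerSeries ℂ) : Prop :=
  ∀ (p i : ℤ) (L : ℕ), p < L → V.B p * V'.A i =
    ∑ k ∈ Finset.range L, PowerSeries.coeff k g • (V'.A (i - k) * V.B (p - k))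

/-- Only the creation half of `V'` is crossed here, so `T` remains arbitrary; the shift `n + k`
comes from reindexing the creation index. -/
lemma Contracts.B_mul_dress {g : PowerSeries ℂ} (hg : Contracts V V' g) {p : ℤ} {L : ℕ}
    (hL : p < L) (n : ℤ) (T : End ℂ W) : V.B p * V'.dress n T =
    ∑ k ∈ Finset.range L, PowerSeries.coeff k g • V'.dress (n + k) (V.B (p - k) * T) := by
  ext w
  have h1 : ∀ i, V.B p (V'.A i (T (V'.B (n + i) w))) = ∑ k ∈ Finset.range L,
      PowerSeries.coeff k g • V'.A (i - k) (V.B (p - k) (T (V'.B (n + i) w))) := fun i => by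
    rw [← Module.End.mul_apply, hg p i L hL]
    simp
  have h2 : ∀ k : ℕ, ∑ᶠ i, PowerSeries.coeff k g •
        V'.A (i - k) (V.B (p - k) (T (V'.B (n + i) w))) =
      PowerSeries.coeff k g • V'.dress (n + k) (V.B (p - k) * T) w := fun k => by
    rw [dress_apply, smul_finsum' _ (V'.dress_support _ _ w),
      ← finsum_comp_equiv (Equiv.addRight (k : ℤ))]
    refine finsum_congr fun i => ?_
    simp [add_assoc, add_comm i]
  rw [Module.End.mul_apply, dress_apply]
  erw [(V.B p).toAddMonoidHom.map_finsum (V'.dress_support n T w)]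
  refine (finsum_congr h1).trans ?_
  rw [finsum_sum_comm]
  · rw [LinearMap.sum_apply]
    exact Finset.sum_congr rfl fun k _ => h2 k
  · intro k _
    have := (V'.dress_support (n + k) (V.B (p - k) * T) w).preimage
      (f := Equiv.subRight (k : ℤ)) (Equiv.injective _).injOn
    refine this.subset fun i hi => ?_
    rw [Set.mem_preimage, Function.mem_support]
    intro h0
    refine hi ?_
    have h3 : n + k + (i - k) = n + i := by ring
    simp only [Equiv.subRight_apply, h3] at h0
    exact (congrArg _ h0).trans (smul_zero _)

/-- The product of a vertex operator with an operator, from the commutation of the latter with the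
annihilation part. -/
lemma cur_mul_apply {T : End ℂ W} {S : ℕ → End ℂ W}
    (hT : ∀ (p : ℤ) (L : ℕ), p < L → V.B p * T = ∑ k ∈ Finset.range L, S k * V.B (p - k))
    {w : W} {L : ℕ} (hL : ∀ k, L ≤ k → ∀ q, S k (V.B q w) = 0) (m : ℤ) :
    V.cur m (T w) = ∑ k ∈ Finset.range L, V.dress (m - k) (S k) w := by
  obtain ⟨M, hM⟩ := V.smooth w
  have h1 : ∀ i, V.A i (V.B (m + i) (T w)) =
      ∑ k ∈ Finset.range L, V.A i (S k (V.B (m + i - k) w)) := fun i => by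
    -- `hT` requires a range beyond `m + i`, while the result needs a range independent of `i`; the
    -- terms with `k ≥ L` vanish on `w`.
    have hlt : m + i < ((max L (m + i + 1).toNat : ℕ) : ℤ) := by
      have := Int.self_le_toNat (m + i + 1)
      push_cast
      omega
    rw [← Module.End.mul_apply (V.B _), hT _ _ hlt, LinearMap.sum_apply, map_sum]
    refine (Finset.sum_subset (Finset.range_subset_range.2 (le_max_left _ _)) fun k _ hk => ?_).symm
    rw [Finset.mem_range, not_lt] at hk
    rw [Module.End.mul_apply, hL k hk, map_zero]
  rw [cur, dress_apply]
  simp only [Module.End.one_apply]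
  rw [finsum_congr h1, finsum_sum_comm]
  · refine Finset.sum_congr rfl fun k _ => ?_
    rw [dress_apply]
    refine finsum_congr fun i => ?_
    rw [show m - k + i = m + i - k by ring]
  · intro k _
    refine (V.dress_support (m - k) (S k) w).subset fun i hi => ?_
    rw [Function.mem_support, show m - k + i = m + i - k by ring]
    exact hi

lemma Contracts.B_mul_cur {g : PowerSeries ℂ} (hg : Contracts V V' g) (hc : Compatible V V')
    {p : ℤ} {L : ℕ} (hL : p < L) (n : ℤ) : V.B p * V'.cur n =
    ∑ k ∈ Finset.range L, (PowerSeries.coeff k g • V'.cur (n + k)) * V.B (p - k) := by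
  rw [cur, hg.B_mul_dress hL]
  refine Finset.sum_congr rfl fun k _ => ?_
  rw [mul_one, smul_mul_assoc, cur, ← V'.dress_mul fun n => hc.B_comm _ _, one_mul]

lemma Compatible.cur_B_eq_zero (hc : Compatible V V') {M : ℤ} {w : W}
    (hM : ∀ n > M, V'.B n w = 0) {n : ℤ} (hn : M < n) (q : ℤ) : V'.cur n (V.B q w) = 0 := by
  rw [cur, ← Module.End.mul_apply, ← V'.dress_mul fun n => hc.B_comm _ _]
  exact dress_eq_zero_of_lt _ _ hM hn

end VertexPair

/-! ### Series in the ratio of two variables -/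

/-- A two-variable series bounded in both variables on each vector. -/
def Smooth₂ (F : Cur₂ W) : Prop := ∀ w, ∃ M : ℤ, ∀ m n, M < m ∨ M < n → F m n w = 0

/-- `x F(x, y)`. -/
def shiftX (F : Cur₂ W) : Cur₂ W := fun m n => F (m + 1) n

/-- `y F(x, y)`. -/
def shiftY (F : Cur₂ W) : Cur₂ W := fun m n => F m (n + 1)

lemma Smooth₂.shiftX {F : Cur₂ W} (h : Smooth₂ F) : Smooth₂ (shiftX F) := fun w => by
  obtain ⟨M, hM⟩ := h w
  exact ⟨M, fun m n hmn => hM _ _ (by omega)⟩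

lemma Smooth₂.shiftY {F : Cur₂ W} (h : Smooth₂ F) : Smooth₂ (shiftY F) := fun w => by
  obtain ⟨M, hM⟩ := h w
  exact ⟨M, fun m n hmn => hM _ _ (by omega)⟩

lemma Smooth₂.flip {F : Cur₂ W} (h : Smooth₂ F) : Smooth₂ (fun m n => F n m) := fun w => by
  obtain ⟨M, hM⟩ := h w
  exact ⟨M, fun m n hmn => hM _ _ (by omega)⟩

lemma seriesYX_apply {F : Cur₂ W} (hF : Smooth₂ F) (φ : PowerSeries ℂ) {w : W} {n : ℤ} {L : ℕ}
    (hL : ∀ m' n', n + L ≤ n' → F m' n' w = 0) (m : ℤ) :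
    seriesYX φ 1 F m n w =
      ∑ k ∈ Finset.range L, PowerSeries.coeff k φ • F (m - k) (n + k) w := by
  rw [seriesYX, locSum_apply, finsum_eq_sum_range (L := L)]
  · simp
  · intro k hk
    simp [hL (m - k) (n + k) (by omega)]
  · intro w
    obtain ⟨M, hM⟩ := hF w
    refine (Set.finite_Icc 0 (M - n).toNat).subset fun k hk => ?_
    rw [Set.mem_Icc]
    by_contra hne
    refine hk ?_
    simp [hM (m - k) (n + k) (by omega)]

/-- The bound needed to evaluate a series on a vector. -/
lemma Smooth₂.exists_bound {F : Cur₂ W} (hF : Smooth₂ F) (w : W) (n : ℤ) :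
    ∃ L₀ : ℕ, ∀ L, L₀ ≤ L → ∀ m' n' : ℤ, n + L ≤ n' → F m' n' w = 0 := by
  obtain ⟨M, hM⟩ := hF w
  exact ⟨(M - n + 1).toNat, fun L hL m' n' h => hM _ _ (by omega)⟩

lemma seriesXY_eq_flip (φ : PowerSeries ℂ) (c : (End ℂ W)ˣ) (F : Cur₂ W) :
    seriesXY φ c F = fun m n => seriesYX φ c (fun m n => F n m) n m := rfl

lemma seriesYX_add {F : Cur₂ W} (hF : Smooth₂ F) (φ χ : PowerSeries ℂ) :
    seriesYX (φ + χ) 1 F = seriesYX φ 1 F + seriesYX χ 1 F := by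
  ext m n w
  obtain ⟨L, hL⟩ := hF.exists_bound w n
  have := hL L le_rfl
  simp only [Pi.add_apply, LinearMap.add_apply, seriesYX_apply hF _ this, map_add, add_smul,
    Finset.sum_add_distrib]

lemma seriesYX_zero (F : Cur₂ W) : seriesYX 0 1 F = 0 := by
  ext m n w
  simp [seriesYX, locSum_zero]

lemma seriesYX_one {F : Cur₂ W} (hF : Smooth₂ F) : seriesYX 1 1 F = F := by
  ext m n w
  obtain ⟨L, hL⟩ := hF.exists_bound w n
  rw [seriesYX_apply hF _ (hL (L + 1) (by omega)), Finset.sum_range_succ']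
  simp [PowerSeries.coeff_one]

lemma sca_apply (c : ℂ) (w : W) : sca c w = c • w := by
  simp [sca, Algebra.algebraMap_eq_smul_one]

lemma sca_one : (sca 1 : End ℂ W) = 1 := map_one _

lemma sca_neg (c : ℂ) : (sca (-c) : End ℂ W) = -sca c := map_neg _ _

lemma smul_sca (c d : ℂ) : c • (sca d : End ℂ W) = sca (c * d) := by
  ext w; simp [sca_apply, smul_smul]

lemma sca_mul (c : ℂ) (T : End ℂ W) : sca c * T = c • T := by
  ext w; simp [sca_apply]

lemma linMul_sca_apply (a b : ℂ) (F : Cur₂ W) (m n : ℤ) :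
    linMul (sca a) (sca b) F m n = a • F (m + 1) n + b • F m (n + 1) := by
  simp [linMul, sca_mul]

-- Factor out `x`: `a x + b y = x (a + b (y / x))`. Polynomial prefactors are thereby absorbed into
-- the power series.
open PowerSeries in
lemma linMul_seriesYX {F : Cur₂ W} (hF : Smooth₂ F) (a b : ℂ) (φ : PowerSeries ℂ) :
    linMul (sca a) (sca b) (seriesYX φ 1 F) =
      seriesYX ((C a + C b * X) * φ) 1 (shiftX F) := by
  ext m n w
  obtain ⟨L, hL⟩ := hF.exists_bound w n
  have h1 := hL (L + 1) (by omega)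
  have h2 : ∀ m' n' : ℤ, n + 1 + L ≤ n' → F m' n' w = 0 := fun m' n' h => h1 m' n' (by
    push_cast; omega)
  have h3 : ∀ m' n' : ℤ, n + (L + 1 : ℕ) ≤ n' → shiftX F m' n' w = 0 := fun m' n' h =>
    h1 _ n' (by push_cast at h ⊢; omega)
  rw [linMul_sca_apply, LinearMap.add_apply, LinearMap.smul_apply, LinearMap.smul_apply,
    seriesYX_apply hF _ h1, seriesYX_apply hF _ h2, seriesYX_apply hF.shiftX _ h3]
  have h4 : ∀ k, coeff k ((C a + C b * X) * φ) = a * coeff k φ +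
      b * coeff k (X * φ) := fun k => by
    rw [add_mul, map_add, mul_assoc, coeff_C_mul, coeff_C_mul]
  simp only [h4, add_smul, Finset.sum_add_distrib, Finset.smul_sum, smul_smul, shiftX]
  congr 1
  · refine Finset.sum_congr rfl fun k _ => ?_
    rw [show m + 1 - (k : ℤ) = m - k + 1 by ring]
  · rw [Finset.sum_range_succ']
    simp only [coeff_succ_X_mul, coeff_zero_X_mul, mul_zero, zero_smul, add_zero]
    refine Finset.sum_congr rfl fun k _ => ?_
    push_cast
    rw [show m - ((k : ℤ) + 1) + 1 = m - k by ring, show n + 1 + (k : ℤ) = n + (k + 1) by ring]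

lemma linMul_flip (a b : End ℂ W) (F : Cur₂ W) :
    linMul a b (fun m n => F n m) = fun m n => linMul b a F n m := by
  ext m n w
  simp [linMul, add_comm]

open PowerSeries in
lemma linMul_seriesXY {F : Cur₂ W} (hF : Smooth₂ F) (a b : ℂ) (φ : PowerSeries ℂ) :
    linMul (sca a) (sca b) (seriesXY φ 1 F) =
      seriesXY ((C b + C a * X) * φ) 1 (shiftY F) := by
  rw [seriesXY_eq_flip, linMul_flip, linMul_seriesYX hF.flip]
  rfl

lemma seriesXY_one {F : Cur₂ W} (hF : Smooth₂ F) : seriesXY 1 1 F = F := by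
  rw [seriesXY_eq_flip, seriesYX_one hF.flip]

lemma seriesXY_add {F : Cur₂ W} (hF : Smooth₂ F) (φ χ : PowerSeries ℂ) :
    seriesXY (φ + χ) 1 F = seriesXY φ 1 F + seriesXY χ 1 F := by
  rw [seriesXY_eq_flip, seriesYX_add hF.flip]
  rfl

lemma seriesXY_zero (F : Cur₂ W) : seriesXY 0 1 F = 0 := by
  rw [seriesXY_eq_flip, seriesYX_zero]
  rfl

lemma gXY_sca (P : Params) (a b : ℂ) (F : Cur₂ W) : gXY P (sca a) (sca b) F =
    linMul (sca a) (sca (-(P.q₁ * b))) (linMul (sca a) (sca (-(P.q₂ * b)))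
      (linMul (sca a) (sca (-(P.q₃ * b))) F)) := by
  simp only [gXY, smul_sca, sca_neg]

lemma gYX_sca (P : Params) (a b : ℂ) (F : Cur₂ W) : gYX P (sca a) (sca b) F =
    linMul (sca (-(P.q₁ * a))) (sca b) (linMul (sca (-(P.q₂ * a))) (sca b)
      (linMul (sca (-(P.q₃ * a))) (sca b) F)) := by
  simp only [gYX, smul_sca, sca_neg]

/-! ### Wick's theorem for two vertex operators -/

namespace VertexPair

variable {V V' : VertexPair W}

/-- The normally ordered product `:V(x) V'(y):`. -/
def normal (V V' : VertexPair W) : Cur₂ W := fun m n => V.dress m (V'.cur n)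

lemma Compatible.normal_comm (h : Compatible V V') (m n : ℤ) :
    normal V V' m n = normal V' V n m := h.dress_comm m n 1

lemma Compatible.smooth_normal (h : Compatible V V') : Smooth₂ (normal V V') := fun w => by
  obtain ⟨M, hM⟩ := V.smooth w
  obtain ⟨M', hM'⟩ := V'.smooth w
  refine ⟨max M M', fun m n hmn => ?_⟩
  rcases hmn with hm | hn
  · exact dress_eq_zero_of_lt _ _ hM (lt_of_le_of_lt (le_max_left _ _) hm)
  · rw [h.normal_comm]
    exact dress_eq_zero_of_lt _ _ hM' (lt_of_le_of_lt (le_max_right _ _) hn)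

/-- Moving the annihilation half of `V` past the creation half of `V'` produces the series `g(y /
x)`; moving it on past the annihilation half of `V'` costs nothing and leaves normal order. -/
lemma Contracts.prodXY_eq {g : PowerSeries ℂ} (hg : Contracts V V' g) (hc : Compatible V V') :
    prodXY V.cur V'.cur = seriesYX g 1 (normal V V') := by
  ext m n w
  obtain ⟨M', hM'⟩ := V'.smooth w
  have h1 : ∀ k, (M' - n + 1).toNat ≤ k → ∀ q,
      (PowerSeries.coeff k g • V'.cur (n + k)) (V.B q w) = 0 := fun k hk q => by
    rw [LinearMap.smul_apply, hc.cur_B_eq_zero hM' (by omega), smul_zero]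
  have h2 : ∀ m' n' : ℤ, n + ((M' - n + 1).toNat : ℤ) ≤ n' → normal V V' m' n' w = 0 :=
    fun m' n' h => by
      rw [hc.normal_comm]
      exact dress_eq_zero_of_lt _ _ hM' (by omega)
  rw [prodXY, Module.End.mul_apply, cur_mul_apply (fun p L hL => hg.B_mul_cur hc hL n) h1,
    seriesYX_apply hc.smooth_normal _ h2]
  refine Finset.sum_congr rfl fun k _ => ?_
  rw [dress_smul]
  rfl

/-- The normally ordered product is symmetric, so the opposite order involves the same two-variable
current, now with a series in `x / y`. -/
lemma Contracts.prodYX_eq {g : PowerSeries ℂ} (hg : Contracts V' V g) (hc : Compatible V V') :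
    prodYX V'.cur V.cur = seriesXY g 1 (normal V V') := by
  have h := hg.prodXY_eq hc.symm
  have h' : normal V' V = fun m n => normal V V' n m := by
    ext1 m; ext1 n; exact (hc.normal_comm n m).symm
  rw [seriesXY_eq_flip, ← h', ← h]
  rfl

end VertexPair

/-! ### Commutators with exponentials -/

section Exponential

open PowerSeries Finset

variable {R : Type*} [Ring R] [Algebra ℂ R]

lemma eq_zero_of_euler_eq {c D : R⟦X⟧} (h0 : coeff 0 D = 0) (h : euler D = euler c * D) :
    D = 0 := by
  ext n
  induction n using Nat.strong_induction_on with
  | _ n ih =>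
    rcases Nat.eq_zero_or_pos n with rfl | hn
    · simpa using h0
    · have hn' : (n : ℂ) ≠ 0 := by exact_mod_cast hn.ne'
      refine smul_right_injective R hn' ?_
      simp only
      rw [← coeff_euler, h, coeff_mul, map_zero, smul_zero]
      refine sum_eq_zero fun p hp => ?_
      rw [HasAntidiagonal.mem_antidiagonal] at hp
      rcases Nat.eq_zero_or_pos p.1 with h1 | h1
      · simp [h1]
      · rw [ih p.2 (by omega), map_zero, mul_zero]

/-- An operator with a scalar commutator with one of the exponents shifts the exponential. -/
lemma IsExp.commutator {c E : R⟦X⟧} (hE : IsExp c E) {x : R} {r : ℕ} (hr : 0 < r) {ν : ℂ}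
    (hx : ∀ s, 0 < s → x * coeff s c = coeff s c * x + if s = r then ν • 1 else 0) (n : ℕ) :
    x * coeff n E = coeff n E * x + if r ≤ n then ν • coeff (n - r) E else 0 := by
  have hXE : ∀ F : R⟦X⟧, F * X ^ r = X ^ r * F := fun F => X_pow_mul.symm
  have e1 : euler (C x) = 0 := by
    ext k
    rcases k with _ | k <;> simp [coeff_C]
  have e2 : euler (X ^ r : R⟦X⟧) = (r : ℂ) • X ^ r := by
    ext k
    rw [coeff_euler, coeff_smul, coeff_X_pow]
    split_ifs with h
    · rw [h]
    · simp
  have e3 : C x * euler c = euler c * C x + (ν * r) • X ^ r := by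
    ext k
    rw [coeff_C_mul, map_add, coeff_mul_C, coeff_euler, coeff_smul, coeff_X_pow]
    rcases Nat.eq_zero_or_pos k with rfl | hk
    · simp [hr.ne]
    rw [mul_smul_comm, hx k hk, smul_add, smul_mul_assoc]
    congr 1
    split_ifs with h
    · rw [h, smul_smul, mul_comm]
    · simp
  -- The difference has zero constant term and solves the same homogeneous equation as `E`, so it
  -- vanishes.
  have key : C x * E - E * C x - ν • (X ^ r * E) = 0 := by
    refine eq_zero_of_euler_eq (c := c) ?_ ?_
    · rw [map_sub, map_sub, coeff_C_mul, coeff_mul_C, hE.const]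
      simp [coeff_X_pow_mul', hr.ne']
    · have hs : ∀ F G : R⟦X⟧, euler (F - G) = euler F - euler G := fun F G => by
        ext; simp [smul_sub]
      have hm : ∀ (a : ℂ) (F : R⟦X⟧), euler (a • F) = a • euler F := fun a F => by
        ext; rw [coeff_euler, coeff_smul, coeff_smul, coeff_euler, smul_comm]
      rw [hs, hs, hm, euler_mul, euler_mul, euler_mul, e1, e2, hE.euler_eq, ← mul_assoc (C x), e3]
      have h4 : X ^ r * (euler c * E) = euler c * (X ^ r * E) := by
        rw [← mul_assoc, ← hXE (euler c), mul_assoc]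
      rw [h4]
      simp only [zero_mul, zero_add, mul_zero, add_zero, add_mul, mul_sub, smul_mul_assoc,
        mul_smul_comm, mul_assoc]
      module
  have := congrArg (coeff n) key
  rw [map_sub, map_sub, coeff_C_mul, coeff_mul_C, coeff_smul, coeff_X_pow_mul', map_zero,
    sub_eq_zero, sub_eq_iff_eq_add] at this
  rw [this, add_comm]
  congr 1
  split_ifs <;> simp

end Exponential

variable {W : Type*} [AddCommGroup W] [Module ℂ W]

/-! ### Evaluation of a normally ordered product on a line -/

lemma finsum_int_eq {M : Type*} [AddCommMonoid M] {f : ℤ → M} {L : ℕ}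
    (h : ∀ k : ℕ, L ≤ k → f k = 0) (h' : ∀ k : ℕ, L ≤ k → f (-((k : ℤ) + 1)) = 0) :
    ∑ᶠ k, f k = ∑ k ∈ Finset.range L, f k + ∑ k ∈ Finset.range L, f (-((k : ℤ) + 1)) := by
  have hinj : Function.Injective fun k : ℕ => -((k : ℤ) + 1) := fun a b hab => by
    simp only at hab; omega
  have hdisj : Disjoint ((Finset.range L).map ⟨fun k : ℕ => (k : ℤ), Nat.cast_injective⟩)
      ((Finset.range L).map ⟨fun k : ℕ => -((k : ℤ) + 1), hinj⟩) := by
    rw [Finset.disjoint_left]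
    intro x hx hx'
    simp only [Finset.mem_map, Function.Embedding.coeFn_mk] at hx hx'
    obtain ⟨a, _, ha⟩ := hx
    obtain ⟨b, _, hb⟩ := hx'
    omega
  rw [finsum_eq_sum_of_support_subset f (s := Finset.disjUnion _ _ hdisj), Finset.sum_disjUnion,
    Finset.sum_map, Finset.sum_map]
  · rfl
  · intro x hx
    rw [Finset.coe_disjUnion, Set.mem_union, Finset.mem_coe, Finset.mem_coe, Finset.mem_map,
      Finset.mem_map]
    rcases le_or_gt 0 x with h0 | h0
    · left
      refine ⟨x.toNat, ?_, ?_⟩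
      · rw [Finset.mem_range]
        by_contra hge
        refine hx ?_
        have := h x.toNat (not_lt.1 hge)
        rwa [Int.toNat_of_nonneg h0] at this
      · exact Int.toNat_of_nonneg h0
    · right
      have hx1 : -(((-x - 1).toNat : ℤ) + 1) = x := by omega
      refine ⟨(-x - 1).toNat, ?_, hx1⟩
      rw [Finset.mem_range]
      by_contra hge
      refine hx ?_
      have := h' (-x - 1).toNat (not_lt.1 hge)
      rwa [hx1] at this

lemma finsum_curry₃ {M : Type*} [AddCommMonoid M] {f : ℤ × ℤ × ℤ → M}
    (hf : (Function.support f).Finite) : ∑ᶠ x, f x = ∑ᶠ k, ∑ᶠ i, ∑ᶠ j, f (k, i, j) := by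
  rw [finsum_curry f hf]
  refine finsum_congr fun k => ?_
  exact finsum_curry (fun x => f (k, x)) (hf.preimage (Prod.mk_right_injective k).injOn)

/-- The sum of `c^k F_{m-k, n+k}` over all integers `k`: the value of `F` at `x = c y`. -/
def onLine (c : ℂ) (F : Cur₂ W) (m n : ℤ) (w : W) : W := ∑ᶠ k : ℤ, c ^ k • F (m - k) (n + k) w

/-- The two expansions share only their constant terms, which cancel. As the other coefficients are
odd under `s ↦ s⁻¹`, the powers of `y / x` and of `x / y` fit together into `ρ (δ(s y / x) - δ(s⁻¹ y
/ x))`. -/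
lemma seriesYX_sub_seriesXY {F : Cur₂ W} (hF : Smooth₂ F) {γ : PowerSeries ℂ} {ρ s : ℂ}
    (hγ : ∀ k : ℕ, 0 < k → PowerSeries.coeff k γ = ρ * (s ^ k - s⁻¹ ^ k)) (m n : ℤ) (w : W) :
    seriesYX γ 1 F m n w - seriesXY γ 1 F m n w =
      ρ • (onLine s F m n w - onLine s⁻¹ F m n w) := by
  obtain ⟨M, hM⟩ := hF w
  obtain ⟨L, hL⟩ : ∃ L : ℕ, M < m + L ∧ M < n + L :=
    ⟨(max (M - m) (M - n) + 1).toNat, by omega, by omega⟩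
  have h1 : ∀ m' n' : ℤ, n + (L + 1 : ℕ) ≤ n' → F m' n' w = 0 := fun m' n' h =>
    hM _ _ (Or.inr (by push_cast at h; omega))
  have h2 : ∀ n' m' : ℤ, m + (L + 1 : ℕ) ≤ m' → F m' n' w = 0 := fun n' m' h =>
    hM _ _ (Or.inl (by push_cast at h; omega))
  have h3 : ∀ (c : ℂ) (k : ℕ), L + 1 ≤ k → c ^ (k : ℤ) • F (m - k) (n + k) w = 0 := fun c k hk => by
    rw [hM _ _ (Or.inr (by omega)), smul_zero]
  have h4 : ∀ (c : ℂ) (k : ℕ), L ≤ k → c ^ (-((k : ℤ) + 1)) •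
      F (m - -((k : ℤ) + 1)) (n + -((k : ℤ) + 1)) w = 0 := fun c k hk => by
    rw [hM _ _ (Or.inl (by omega)), smul_zero]
  rw [seriesXY_eq_flip]
  simp only
  rw [seriesYX_apply hF _ h1, seriesYX_apply hF.flip _ h2, onLine, onLine,
    finsum_int_eq (h3 s) (fun k hk => h4 s k (by omega)),
    finsum_int_eq (h3 s⁻¹) (fun k hk => h4 s⁻¹ k (by omega))]
  rw [Finset.sum_range_succ' _ L, Finset.sum_range_succ' _ L, Finset.sum_range_succ' _ L,
    Finset.sum_range_succ _ L, Finset.sum_range_succ' _ L, Finset.sum_range_succ _ L,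
    h4 s L le_rfl, h4 s⁻¹ L le_rfl]
  have h5 : ∀ k : ℕ, m - -((k : ℤ) + 1) = m + (k + 1 : ℕ) := fun k => by push_cast; ring
  have h6 : ∀ k : ℕ, n + -((k : ℤ) + 1) = n - (k + 1 : ℕ) := fun k => by push_cast; ring
  have h7 : ∀ k : ℕ, s ^ (-((k : ℤ) + 1)) = s⁻¹ ^ (k + 1) := fun k => by
    rw [zpow_neg, inv_pow]; norm_cast
  have h8 : ∀ k : ℕ, s⁻¹ ^ (-((k : ℤ) + 1)) = s ^ (k + 1) := fun k => by
    rw [zpow_neg, inv_zpow, inv_inv]; norm_cast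
  simp only [h5, h6, h7, h8, hγ _ (Nat.succ_pos _), Nat.succ_eq_add_one, zpow_natCast]
  simp only [mul_sub, sub_smul, Finset.sum_sub_distrib, mul_smul, ← Finset.smul_sum]
  simp
  module

namespace VertexPair

variable {V V' V'' : VertexPair W}

/-- The normally ordered product of two vertex operators at `x = c y` is a vertex operator. -/
lemma Compatible.onLine_normal (h : Compatible V V') {c : ℂ} (hc : c ≠ 0)
    (hA : ∀ K w, ∑ᶠ i : ℤ, c ^ i • V.A i (V'.A (K - i) w) = V''.A K w)
    (hB : ∀ q w, ∑ᶠ p : ℤ, c ^ (-p) • V.B p (V'.B (q - p) w) = V''.B q w) (m n : ℤ) (w : W) :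
    onLine c (normal V V') m n w = c ^ m • V''.cur (m + n) w := by
  obtain ⟨M, hM⟩ := V.smooth w
  obtain ⟨M', hM'⟩ := V'.smooth w
  set G : ℤ × ℤ × ℤ → W := fun x =>
    c ^ x.1 • V.A x.2.1 (V'.A x.2.2 (V'.B (n + x.1 + x.2.2) (V.B (m - x.1 + x.2.1) w))) with hG
  have hGfin : (Function.support G).Finite := by
    -- Nonnegativity of the creation indices and the bounds `M`, `M'` on the annihilation indices
    -- confine `i`, `j` and `k`; the absolute values are a crude common bound.
    refine (Set.finite_Icc ((-(M' + n).natAbs - (M + M' - m - n).natAbs - (M + m).natAbs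
      - M'.natAbs - M.natAbs - m.natAbs - n.natAbs, 0, 0) : ℤ × ℤ × ℤ)
      ((M' + n).natAbs + (M + M' - m - n).natAbs + (M + m).natAbs + M'.natAbs + M.natAbs +
        m.natAbs + n.natAbs, M + M' - m - n, M + M' - m - n)).subset fun x hx => ?_
    obtain ⟨k, i, j⟩ := x
    simp only [Set.mem_Icc, Prod.mk_le_mk]
    rcases lt_or_ge i 0 with h0 | h0
    · exact absurd (by simp [hG, V.A_neg i h0]) hx
    rcases lt_or_ge j 0 with h0' | h0'
    · exact absurd (by simp [hG, V'.A_neg j h0']) hx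
    rcases lt_or_ge M (m - k + i) with h1 | h1
    · exact absurd (by simp [hG, hM _ h1]) hx
    rcases lt_or_ge M' (n + k + j) with h2 | h2
    · refine absurd ?_ hx
      simp only [hG]
      rw [← Module.End.mul_apply (V'.B _), ← (h.B_comm _ _).eq, Module.End.mul_apply, hM' _ h2]
      simp
    omega
  have hL : onLine c (normal V V') m n w = ∑ᶠ x, G x := by
    rw [finsum_curry₃ hGfin, onLine]
    refine finsum_congr fun k => ?_
    rw [normal, dress_apply, smul_finsum' _ (V.dress_support _ _ w)]
    refine finsum_congr fun i => ?_
    rw [cur, dress_apply]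
    erw [(V.A i).toAddMonoidHom.map_finsum (V'.dress_support (n + k) 1 _)]
    rw [smul_finsum']
    · rfl
    · exact (V'.dress_support (n + k) 1 (V.B (m - k + i) w)).subset fun j hj h0 =>
        hj ((congrArg (V.A i) h0).trans (map_zero _))
  set H : ℤ × ℤ × ℤ → W := fun y =>
    c ^ m • (c ^ y.2.1 • V.A y.2.1 (V'.A (y.1 - y.2.1)
      (c ^ (-y.2.2) • V.B y.2.2 (V'.B (m + n + y.1 - y.2.2) w)))) with hH
  -- The new indices are the total creation degree, the creation index of `V` and the annihilation
  -- index of `V`. In them `c ^ k` is `c ^ m` times one power of `c` for each half, and the triple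
  -- sum factors.
  let e : ℤ × ℤ × ℤ ≃ ℤ × ℤ × ℤ :=
    { toFun := fun x => (x.2.1 + x.2.2, x.2.1, m - x.1 + x.2.1)
      invFun := fun y => (m + y.2.1 - y.2.2, y.2.1, y.1 - y.2.1)
      left_inv := fun x => by ext <;> simp
      right_inv := fun y => by ext <;> simp; ring }
  have hGH : ∀ x, G x = H (e x) := fun x => by
    obtain ⟨k, i, j⟩ := x
    have h1 : i + j - i = j := by ring
    have h2 : m + n + (i + j) - (m - k + i) = n + k + j := by ring
    have h3 : c ^ m * (c ^ i * c ^ (-(m - k + i))) = c ^ k := by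
      rw [← zpow_add₀ hc, ← zpow_add₀ hc]; congr 1; ring
    simp only [hG, hH, e, Equiv.coe_fn_mk, map_smul, smul_smul, h1, h2, h3]
    rw [← Module.End.mul_apply (V.B _), (h.B_comm _ _).eq, Module.End.mul_apply]
  have hHfin : (Function.support H).Finite := by
    have : Function.support H ⊆ e '' Function.support G := fun y hy =>
      ⟨e.symm y, by rw [Function.mem_support, hGH, Equiv.apply_symm_apply]; exact hy,
        Equiv.apply_symm_apply _ _⟩
    exact (hGfin.image e).subset this
  have hR : c ^ m • V''.cur (m + n) w = ∑ᶠ y, H y := by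
    rw [finsum_curry₃ hHfin, cur, dress_apply, smul_finsum' _ (V''.dress_support _ _ w)]
    refine finsum_congr fun K => ?_
    have hAfin : ∀ u, (Function.support fun i : ℤ => c ^ i • V.A i (V'.A (K - i) u)).Finite :=
      fun u => by
        refine (Set.finite_Icc 0 K).subset fun i hi => ?_
        rw [Set.mem_Icc]
        by_contra hne
        refine hi ?_
        rcases lt_or_ge i 0 with h0 | h0
        · simp [V.A_neg i h0]
        · simp [V'.A_neg (K - i) (by omega)]
    have hBfin : (Function.support fun p : ℤ =>
        c ^ (-p) • V.B p (V'.B (m + n + K - p) w)).Finite := by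
      refine (Set.finite_Icc 0 (m + n + K)).subset fun i hi => ?_
      rw [Set.mem_Icc]
      by_contra hne
      refine hi ?_
      rcases lt_or_ge i 0 with h0 | h0
      · simp [V.B_neg i h0]
      · simp [V'.B_neg (m + n + K - i) (by omega)]
    rw [Module.End.one_apply, ← hA, smul_finsum' _ (hAfin _)]
    refine finsum_congr fun i => ?_
    rw [← hB]
    have h5 := (c ^ m • c ^ i • (V.A i ∘ₗ V'.A (K - i))).toAddMonoidHom.map_finsum hBfin
    exact h5
  rw [hL, hR]
  exact (finsum_congr hGH).trans (finsum_comp_equiv e)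

/-- The product of two vertex operators in the same variable, when it needs no normal ordering. -/
lemma Compatible.mulCur_eq (h : Compatible V V') (hg : Contracts V V' 1)
    (hA : ∀ K w, ∑ᶠ i : ℤ, V.A i (V'.A (K - i) w) = V''.A K w)
    (hB : ∀ q w, ∑ᶠ p : ℤ, V.B p (V'.B (q - p) w) = V''.B q w)
    (hfin : ∀ k w, (Function.support fun n : ℤ => normal V V' (k - n) n w).Finite) :
    mulCur V.cur V'.cur = V''.cur := by
  ext k w
  have h1 : ∀ m n, V.cur m * V'.cur n = normal V V' m n := fun m n => by
    have := hg.prodXY_eq h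
    rw [seriesYX_one h.smooth_normal] at this
    rw [← this]; rfl
  -- Multiplication in one variable is evaluation on the line `x = y`.
  have h2 := h.onLine_normal (c := 1) one_ne_zero (V'' := V'') (by simpa using hA)
    (by simpa using hB) k 0 w
  simp only [one_zpow, one_smul, add_zero] at h2
  rw [← h2, onLine, mulCur]
  simp only [h1]
  rw [locSum_apply (hfin k)]
  simp

end VertexPair

/-! ### Quadratic relations -/

-- The cubic `p(t) = c (1 - qt)(1 - t)(1 - q⁻¹t)` satisfies `t³ p(1 / t) = -p(t)`. Hence `x³ p(y /
-- x) + y³ p(x / y) = 0` already as polynomials, and the region of expansion does not matter.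
open PowerSeries in
lemma series_cubic {N : Cur₂ W} (hN : Smooth₂ N) {q : ℂ} (hq : q ≠ 0) (c : ℂ) :
    seriesYX (C c * ((1 - C q * X) * ((1 - X) * (1 - C q⁻¹ * X)))) 1 (shiftX (shiftX (shiftX N))) +
      seriesXY (C c * ((1 - C q * X) * ((1 - X) * (1 - C q⁻¹ * X)))) 1
        (shiftY (shiftY (shiftY N))) = 0 := by
  have hX : C c * ((1 - C q * X) * ((1 - X) * (1 - C q⁻¹ * X))) =
      (C c + C (-(c * q)) * X) * ((C 1 + C (-1) * X) * ((C 1 + C (-q⁻¹) * X) * 1)) := by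
    simp only [map_neg, map_one, map_mul]; ring
  rw [hX, ← linMul_seriesYX hN.shiftX.shiftX, ← linMul_seriesYX hN.shiftX, ← linMul_seriesYX hN,
    ← linMul_seriesXY hN.shiftY.shiftY, ← linMul_seriesXY hN.shiftY, ← linMul_seriesXY hN,
    seriesYX_one hN, seriesXY_one hN]
  funext m n
  simp only [Pi.add_apply, linMul_sca_apply, Pi.zero_apply]
  have h1 : q * q⁻¹ = 1 := mul_inv_cancel₀ hq
  match_scalars <;>
    first
    | ring1
    | linear_combination (-c) * h1
    | linear_combination c * h1

open PowerSeries in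
/-- `∏ (a - q_i b t)`. -/
def gPoly (P : Params) (a b : ℂ) : PowerSeries ℂ :=
  (C a + C (-(P.q₁ * b)) * X) * ((C a + C (-(P.q₂ * b)) * X) * (C a + C (-(P.q₃ * b)) * X))

open PowerSeries in
/-- `∏ (b t - q_i a)`. -/
def gPolyRev (P : Params) (a b : ℂ) : PowerSeries ℂ :=
  (C (-(P.q₁ * a)) + C b * X) * ((C (-(P.q₂ * a)) + C b * X) * (C (-(P.q₃ * a)) + C b * X))

section

variable {N : Cur₂ W} (hN : Smooth₂ N) (P : Params) (a b : ℂ) (φ : PowerSeries ℂ)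

include hN

lemma gXY_seriesYX : gXY P (sca a) (sca b) (seriesYX φ 1 N) =
    seriesYX (gPoly P a b * φ) 1 (shiftX (shiftX (shiftX N))) := by
  rw [gXY_sca, linMul_seriesYX hN, linMul_seriesYX hN.shiftX, linMul_seriesYX hN.shiftX.shiftX,
    gPoly, mul_assoc, mul_assoc]

lemma gYX_seriesYX : gYX P (sca a) (sca b) (seriesYX φ 1 N) =
    seriesYX (gPolyRev P a b * φ) 1 (shiftX (shiftX (shiftX N))) := by
  rw [gYX_sca, linMul_seriesYX hN, linMul_seriesYX hN.shiftX, linMul_seriesYX hN.shiftX.shiftX,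
    gPolyRev, mul_assoc, mul_assoc]

lemma gXY_seriesXY : gXY P (sca a) (sca b) (seriesXY φ 1 N) =
    seriesXY (gPolyRev P b a * φ) 1 (shiftY (shiftY (shiftY N))) := by
  rw [gXY_sca, linMul_seriesXY hN, linMul_seriesXY hN.shiftY, linMul_seriesXY hN.shiftY.shiftY,
    gPolyRev, mul_assoc, mul_assoc]

lemma gYX_seriesXY : gYX P (sca a) (sca b) (seriesXY φ 1 N) =
    seriesXY (gPoly P b a * φ) 1 (shiftY (shiftY (shiftY N))) := by
  rw [gYX_sca, linMul_seriesXY hN, linMul_seriesXY hN.shiftY, linMul_seriesXY hN.shiftY.shiftY,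
    gPoly, mul_assoc, mul_assoc]

end

lemma gXY_smul (P : Params) (a b : End ℂ W) (c : ℂ) (F : Cur₂ W) :
    gXY P a b (c • F) = c • gXY P a b F := by
  have h : ∀ (a b : End ℂ W) (F : Cur₂ W), linMul a b (c • F) = c • linMul a b F := fun a b F => by
    funext m n; simp [linMul]
  simp only [gXY, h]

lemma gYX_smul (P : Params) (a b : End ℂ W) (c : ℂ) (F : Cur₂ W) :
    gYX P a b (c • F) = c • gYX P a b F := by
  have h : ∀ (a b : End ℂ W) (F : Cur₂ W), linMul a b (c • F) = c • linMul a b F := fun a b F => by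
    funext m n; simp [linMul]
  simp only [gYX, h]

lemma prodXY_smul (c d : ℂ) (a b : Cur W) : prodXY (c • a) (d • b) = (c * d) • prodXY a b := by
  funext m n; simp [prodXY, smul_smul, mul_comm]

lemma prodYX_smul (c d : ℂ) (a b : Cur W) : prodYX (c • a) (d • b) = (c * d) • prodYX a b := by
  funext m n; simp [prodYX, smul_smul, mul_comm]

lemma deltaYX_inY (c : (End ℂ W)ˣ) (G : Cur W) (m n : ℤ) :
    deltaYX c (inY G) m n = ((c ^ m : (End ℂ W)ˣ) : End ℂ W) * G (m + n) := by
  rw [deltaYX, locSum_eq_single m]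
  · simp [inY, add_comm]
  · intro k hk
    rw [inY, if_neg (by omega), mul_zero]

lemma deltaXY_inX (c : (End ℂ W)ˣ) (G : Cur W) (m n : ℤ) :
    deltaXY c (inX G) m n = ((c ^ n : (End ℂ W)ˣ) : End ℂ W) * G (m + n) := by
  rw [deltaXY, locSum_eq_single n]
  · simp [inX]
  · intro k hk
    rw [inX, if_neg (by omega), mul_zero]

lemma coe_expUnit_zpow (l : ℂ) (m : ℤ) :
    ((expUnit W l ^ m : (End ℂ W)ˣ) : End ℂ W) = sca (Complex.exp l ^ m) := by
  rw [expUnit, ← map_zpow]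
  change algebraMap ℂ (End ℂ W) ((Units.mk0 _ (Complex.exp_ne_zero l) ^ m : ℂˣ) : ℂ) = _
  rw [Units.val_zpow_eq_zpow_val]
  rfl

/-! ### Exponentials of combinations of commuting operators -/

section Convolution

open PowerSeries Finset

variable {W : Type*} [AddCommGroup W] [Module ℂ W]

lemma mk_smul_eq_zero {h : ℕ → End ℂ W} (h0 : h 0 = 0) {a : ℕ → ℂ} (ha : ∀ r, 0 < r → a r = 0) :
    PowerSeries.mk (fun r => a r • h r) = 0 := by
  ext1 n
  rcases Nat.eq_zero_or_pos n with rfl | hn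
  · simp [h0]
  · simp [ha n hn]

variable {h : ℕ → End ℂ W} (hcomm : ∀ i j, Commute (h i) (h j)) (h0 : h 0 = 0)

include hcomm

lemma isExp_expCoeff_smul (a : ℕ → ℂ) :
    IsExp (PowerSeries.mk fun r => a r • h r) (PowerSeries.mk (expCoeff fun r => a r • h r)) :=
  isExp_expCoeff _ fun i j _ _ => ((hcomm i j).smul_left _).smul_right _

include h0

lemma expCoeff_of_zero {a : ℕ → ℂ} (ha : ∀ r, 0 < r → a r = 0) (n : ℕ) :
    expCoeff (fun r => a r • h r) n = if n = 0 then 1 else 0 := by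
  have h1 := isExp_expCoeff_smul hcomm a
  rw [mk_smul_eq_zero h0 ha] at h1
  have := congrArg (coeff n) (h1.unique IsExp.zero)
  rwa [coeff_mk, coeff_one] at this

/-- Used to merge the halves of two vertex operators at proportional arguments. -/
lemma expCoeff_conv {c : ℂ} {a a' a'' : ℕ → ℂ} (ha : ∀ r, 0 < r → a'' r = c ^ r * a r + a' r)
    (n : ℕ) : expCoeff (fun r => a'' r • h r) n = ∑ p ∈ antidiagonal n,
      c ^ p.1 • (expCoeff (fun r => a r • h r) p.1 * expCoeff (fun r => a' r • h r) p.2) := by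
  have h1 := ((isExp_expCoeff_smul hcomm a).rescale c).mul (isExp_expCoeff_smul hcomm a')
    (fun i j _ _ => by
      simp only [coeff_mk]
      exact (((hcomm i j).smul_left _).smul_right _).smul_left _)
  have h2 : (PowerSeries.mk fun n => c ^ n • coeff n (PowerSeries.mk fun r => a r • h r)) +
      (PowerSeries.mk fun r => a' r • h r) = PowerSeries.mk fun r => a'' r • h r := by
    ext1 r
    rcases Nat.eq_zero_or_pos r with rfl | hr
    · simp [h0]
    · simp [ha r hr, add_smul, mul_smul]
  rw [h2] at h1
  have := congrArg (coeff n) ((isExp_expCoeff_smul hcomm a'').unique h1)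
  rw [coeff_mk, coeff_mul] at this
  rw [this]
  simp

end Convolution

/-! ### One-sided currents -/

section PosCur

variable {W : Type*} [AddCommGroup W] [Module ℂ W]

lemma posCur_natCast (E : ℕ → End ℂ W) (n : ℕ) : posCur E n = E n := by
  simp [posCur]

lemma posCur_of_neg (E : ℕ → End ℂ W) {n : ℤ} (hn : n < 0) : posCur E n = 0 := by
  simp [posCur, not_le.2 hn]

lemma negCur_eq (E : ℕ → End ℂ W) (n : ℤ) : negCur E n = posCur E (-n) := by
  simp [posCur, negCur]

lemma finsum_posCur_conv {E E' E'' : ℕ → End ℂ W} {c : ℂ}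
    (h : ∀ n, E'' n = ∑ p ∈ Finset.HasAntidiagonal.antidiagonal n, c ^ p.1 • (E p.1 * E' p.2))
    (K : ℤ) (w : W) :
    ∑ᶠ i : ℤ, c ^ i • posCur E i (posCur E' (K - i) w) = posCur E'' K w := by
  rcases lt_or_ge K 0 with hK | hK
  · rw [posCur_of_neg _ hK]
    refine finsum_eq_zero_of_forall_eq_zero fun i => ?_
    rcases lt_or_ge i 0 with hi | hi
    · simp [posCur_of_neg _ hi]
    · simp [posCur_of_neg E' (show K - i < 0 by omega)]
  obtain ⟨n, rfl⟩ := Int.eq_ofNat_of_zero_le hK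
  rw [posCur_natCast, h, Finset.Nat.sum_antidiagonal_eq_sum_range_succ_mk,
    finsum_int_eq (L := n + 1)]
  · rw [Finset.sum_eq_zero (s := Finset.range (n + 1))
      (f := fun k : ℕ => c ^ (-((k : ℤ) + 1)) • _), add_zero, LinearMap.sum_apply]
    · refine Finset.sum_congr rfl fun k hk => ?_
      rw [Finset.mem_range] at hk
      rw [← Nat.cast_sub (by omega : k ≤ n), posCur_natCast, posCur_natCast, zpow_natCast]
      rfl
    · intro k _
      rw [posCur_of_neg E (show -((k : ℤ) + 1) < 0 by omega), LinearMap.zero_apply, smul_zero]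
  · intro k hk
    simp [posCur_of_neg E' (show (n : ℤ) - k < 0 by omega)]
  · intro k _
    rw [posCur_of_neg E (show -((k : ℤ) + 1) < 0 by omega), LinearMap.zero_apply, smul_zero]

end PosCur

/-! ### Degrees -/

section Degree

variable {W : Type*} [AddCommGroup W] [Module ℂ W] {V : ℤ × ℤ → Submodule ℂ W}

lemma hasDeg_zero (a b : ℤ) : HasDeg V a b 0 := fun _ _ _ => Submodule.zero_mem _

lemma hasDeg_one : HasDeg V 0 0 1 := fun d w hw => by simpa using hw

lemma HasDeg.smul {a b : ℤ} {T : End ℂ W} (h : HasDeg V a b T) (c : ℂ) : HasDeg V a b (c • T) :=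
  fun d w hw => Submodule.smul_mem _ _ (h d w hw)

lemma HasDeg.mul {a b a' b' : ℤ} {T T' : End ℂ W} (h : HasDeg V a b T) (h' : HasDeg V a' b' T') :
    HasDeg V (a + a') (b + b') (T * T') := fun d w hw => by
  have := h _ _ (h' d w hw)
  rwa [show (d.1 + a' + a, d.2 + b' + b) = (d.1 + (a + a'), d.2 + (b + b')) by
    ext <;> ring] at this

lemma HasDeg.sum {ι : Type*} {s : Finset ι} {a b : ℤ} {T : ι → End ℂ W}
    (h : ∀ i ∈ s, HasDeg V a b (T i)) : HasDeg V a b (∑ i ∈ s, T i) := fun d w hw => by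
  rw [LinearMap.sum_apply]
  exact Submodule.sum_mem _ fun i hi => h i hi d w hw

lemma HasDeg.locSum {ι : Type*} {a b : ℤ} {T : ι → End ℂ W} (h : ∀ i, HasDeg V a b (T i)) :
    HasDeg V a b (locSum T) := fun d w hw => by
  rw [Toroidal.locSum]
  split_ifs with hf
  · exact finsum_mem_induction (s := Set.univ) (p := (· ∈ V (d.1 + a, d.2 + b)))
      (Submodule.zero_mem _) (fun _ _ => Submodule.add_mem _) (fun i _ => h i d w hw) |> fun h => by
        simpa using h
  · exact Submodule.zero_mem _

lemma hasDeg_sca (c : ℂ) : HasDeg V 0 0 (sca c) := by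
  have : (sca c : End ℂ W) = c • 1 := by ext; simp [sca_apply]
  rw [this]
  exact hasDeg_one.smul c

lemma IsExp.hasDeg {c E : PowerSeries (End ℂ W)} (hE : IsExp c E) {σ : ℤ}
    (hc : ∀ r : ℕ, 0 < r → HasDeg V (σ * r) 0 (PowerSeries.coeff r c)) (n : ℕ) :
    HasDeg V (σ * n) 0 (PowerSeries.coeff n E) := by
  induction n using Nat.strong_induction_on with
  | _ n ih =>
    rcases Nat.eq_zero_or_pos n with rfl | hn
    · rw [hE.const]; simpa using hasDeg_one
    · have hn' : (n : ℂ) ≠ 0 := by exact_mod_cast hn.ne'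
      have key : HasDeg V (σ * n) 0 ((n : ℂ) • PowerSeries.coeff n E) := by
        rw [hE.recursion]
        refine HasDeg.sum fun p hp => ?_
        rw [Finset.HasAntidiagonal.mem_antidiagonal] at hp
        rcases Nat.eq_zero_or_pos p.1 with h0 | h0
        · simpa [h0] using hasDeg_zero _ _
        · have := ((hc _ h0).mul (ih p.2 (by omega))).smul (p.1 : ℂ)
          rwa [← mul_add, ← Nat.cast_add, hp, add_zero] at this
      have := key.smul ((n : ℂ)⁻¹)
      rwa [inv_smul_smul₀ hn'] at this

lemma VertexPair.hasDeg_cur {X : VertexPair W} (hA : ∀ i, HasDeg V (-i) 0 (X.A i))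
    (hB : ∀ n, HasDeg V n 0 (X.B n)) (m : ℤ) : HasDeg V m 0 (X.cur m) := by
  refine HasDeg.locSum fun i => ?_
  have := (hA i).mul (hB (m + i))
  rw [one_mul]
  rwa [show -i + (m + i) = m by ring, add_zero] at this

end Degree

/-! ### The Heisenberg algebra on the Fock space -/

/-- The commutator of `h_r` and `h_{-r}` on the Fock space, for `r > 0`. -/
def fockLevel (P : Params) (r : ℕ) : ℂ :=
  -((r : ℂ) * P.s₁ ^ r * (1 - P.q₂ ^ r) * (1 - P.q₃ ^ r))⁻¹

lemma fockH_zero (P : Params) : fockH P 0 = 0 := rfl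

lemma fockH_neg (P : Params) (r : ℕ) (hr : 0 < r) :
    fockH P (-(r : ℤ)) = LinearMap.mulLeft ℂ (MvPolynomial.X (r.toPNat hr)) := by
  obtain ⟨n, rfl⟩ := Nat.exists_eq_succ_of_ne_zero hr.ne'
  rfl

lemma fockH_pos (P : Params) (r : ℕ) (hr : 0 < r) :
    fockH P r = fockLevel P r • (MvPolynomial.pderiv (R := ℂ) (r.toPNat hr)).toLinearMap := by
  obtain ⟨n, rfl⟩ := Nat.exists_eq_succ_of_ne_zero hr.ne'
  rfl

lemma fockH_neg_commute (P : Params) (i j : ℕ) :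
    Commute (fockH P (-(i : ℤ))) (fockH P (-(j : ℤ))) := by
  rcases Nat.eq_zero_or_pos i with rfl | hi
  · simp [fockH_zero]
  rcases Nat.eq_zero_or_pos j with rfl | hj
  · simp [fockH_zero]
  rw [fockH_neg P i hi, fockH_neg P j hj]
  refine LinearMap.ext fun w => ?_
  exact mul_left_comm _ _ _

lemma pderiv_comm {σ : Type*} (i j : σ) (w : MvPolynomial σ ℂ) :
    MvPolynomial.pderiv i (MvPolynomial.pderiv j w) =
      MvPolynomial.pderiv j (MvPolynomial.pderiv i w) := by
  classical
  induction w using MvPolynomial.induction_on with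
  | C a => simp
  | add p q hp hq => simp [hp, hq]
  | mul_X p k hp =>
    simp only [MvPolynomial.pderiv_mul, MvPolynomial.pderiv_X, map_add, hp]
    by_cases hik : i = k <;> by_cases hjk : j = k <;>
      simp [hik, hjk]

lemma fockH_pos_commute (P : Params) (i j : ℕ) : Commute (fockH P i) (fockH P j) := by
  rcases Nat.eq_zero_or_pos i with rfl | hi
  · simp [fockH_zero]
  rcases Nat.eq_zero_or_pos j with rfl | hj
  · simp [fockH_zero]
  rw [fockH_pos P i hi, fockH_pos P j hj]
  refine ((?_ : Commute _ _).smul_left _).smul_right _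
  refine LinearMap.ext fun w => ?_
  exact pderiv_comm _ _ _

lemma fockH_commutator (P : Params) {r s : ℕ} (hr : 0 < r) (hs : 0 < s) :
    fockH P r * fockH P (-(s : ℤ)) =
      fockH P (-(s : ℤ)) * fockH P r + if s = r then fockLevel P r • 1 else 0 := by
  rw [fockH_pos P r hr, fockH_neg P s hs]
  refine LinearMap.ext fun w => ?_
  change fockLevel P r • MvPolynomial.pderiv (r.toPNat hr) (MvPolynomial.X (s.toPNat hs) * w) =
    MvPolynomial.X (s.toPNat hs) * (fockLevel P r • MvPolynomial.pderiv (r.toPNat hr) w) +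
      (if s = r then fockLevel P r • (1 : End ℂ FockSpace) else 0) w
  rw [MvPolynomial.pderiv_mul, smul_add, mul_smul_comm, add_comm]
  congr 1
  split_ifs with h
  · subst h
    rw [MvPolynomial.pderiv_X_self, one_mul]
    rfl
  · have hne : s.toPNat hs ≠ r.toPNat hr := fun h' =>
      h (congrArg (fun n : ℕ+ => (n : ℕ)) h')
    rw [MvPolynomial.pderiv_X_of_ne hne, zero_mul, smul_zero]
    rfl

/-- The grading of the Fock space: `h_{-n}` has degree `-n`, and all weights are zero. -/
def fockGrading : ℤ × ℤ → Submodule ℂ FockSpace :=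
  MvPolynomial.weightedHomogeneousSubmodule ℂ fun n : ℕ+ => ((-(n : ℤ), 0) : ℤ × ℤ)

lemma hasDeg_fockH (P : Params) (r : ℤ) : HasDeg fockGrading r 0 (fockH P r) := by
  obtain ⟨n, rfl | rfl⟩ := r.eq_nat_or_neg
  · rcases Nat.eq_zero_or_pos n with rfl | hn
    · exact hasDeg_zero _ _
    rw [fockH_pos P n hn]
    refine HasDeg.smul (fun d w hw => ?_) _
    exact MvPolynomial.IsWeightedHomogeneous.pderiv hw (by ext <;> simp [Nat.toPNat])
  · rcases Nat.eq_zero_or_pos n with rfl | hn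
    · exact hasDeg_zero _ _
    rw [fockH_neg P n hn]
    intro d w hw
    have h1 := (MvPolynomial.isWeightedHomogeneous_X ℂ
      (fun n : ℕ+ => ((-(n : ℤ), 0) : ℤ × ℤ)) (n.toPNat hn)).mul hw
    rw [show ((-((n.toPNat hn : ℕ+) : ℤ), 0) : ℤ × ℤ) + d = (d.1 + -n, d.2 + 0) by
      ext <;> simp [add_comm, Nat.toPNat]] at h1
    exact h1

lemma fock_weight (d : ℕ+ →₀ ℕ) :
    Finsupp.weight (fun n : ℕ+ => ((-(n : ℤ), 0) : ℤ × ℤ)) d =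
      (-(d.sum fun n k => (k * n : ℤ)), 0) := by
  rw [Finsupp.weight_apply]
  ext
  · simp [Finsupp.sum, Prod.fst_sum]
  · simp [Finsupp.sum, Prod.snd_sum]

lemma fockGrading_eq_bot {d : ℤ × ℤ} (hd : 0 < d.1 ∨ d.2 ≠ 0) : fockGrading d = ⊥ := by
  rw [eq_bot_iff]
  intro w hw
  rw [Submodule.mem_bot]
  refine MvPolynomial.ext _ _ fun k => ?_
  rw [MvPolynomial.coeff_zero]
  by_contra hne
  have := hw hne
  rw [fock_weight] at this
  have h1 : (0 : ℤ) ≤ k.sum fun n j => (j * n : ℤ) := Finset.sum_nonneg fun _ _ => by positivity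
  subst this
  simp only at hd
  omega

/-- The Fock space has no positive degrees, so a monomial of degree `-d` is killed by every operator
of degree greater than `d`. -/
lemma smooth_of_hasDeg {T : ℤ → End ℂ FockSpace} (hT : ∀ n, HasDeg fockGrading n 0 (T n))
    (w : FockSpace) : ∃ M : ℤ, ∀ n > M, T n w = 0 := by
  induction w using MvPolynomial.induction_on' with
  | monomial k a =>
    refine ⟨k.sum fun n j => (j * n : ℤ), fun n hn => ?_⟩
    have h1 : MvPolynomial.monomial k a ∈ fockGrading (-(k.sum fun n j => (j * n : ℤ)), 0) :=
      MvPolynomial.isWeightedHomogeneous_monomial _ _ _ (fock_weight k)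
    have h2 := hT n _ _ h1
    rwa [fockGrading_eq_bot (Or.inl (by simp only; omega)), Submodule.mem_bot] at h2
  | add p q hp hq =>
    obtain ⟨M, hM⟩ := hp
    obtain ⟨M', hM'⟩ := hq
    refine ⟨max M M', fun n hn => ?_⟩
    rw [map_add, hM n (lt_of_le_of_lt (le_max_left _ _) hn),
      hM' n (lt_of_le_of_lt (le_max_right _ _) hn), add_zero]

lemma hasDeg_creation (P : Params) (a : ℕ → ℂ) (i : ℤ) : HasDeg fockGrading (-i) 0
    (posCur (expCoeff fun r => a r • fockH P (-(r : ℤ))) i) := by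
  rcases lt_or_ge i 0 with hi | hi
  · rw [posCur_of_neg _ hi]; exact hasDeg_zero _ _
  obtain ⟨n, rfl⟩ := Int.eq_ofNat_of_zero_le hi
  rw [posCur_natCast]
  have := (isExp_expCoeff_smul (fockH_neg_commute P) a).hasDeg (V := fockGrading) (σ := -1)
    (fun r _ => by
      rw [PowerSeries.coeff_mk, neg_one_mul]
      exact (hasDeg_fockH P _).smul _) n
  rwa [PowerSeries.coeff_mk, neg_one_mul] at this

lemma hasDeg_annihilation (P : Params) (b : ℕ → ℂ) (n : ℤ) : HasDeg fockGrading n 0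
    (posCur (expCoeff fun r => b r • fockH P r) n) := by
  rcases lt_or_ge n 0 with hi | hi
  · rw [posCur_of_neg _ hi]; exact hasDeg_zero _ _
  obtain ⟨n, rfl⟩ := Int.eq_ofNat_of_zero_le hi
  rw [posCur_natCast]
  have := (isExp_expCoeff_smul (fockH_pos_commute P) b).hasDeg (V := fockGrading) (σ := 1)
    (fun r _ => by
      rw [PowerSeries.coeff_mk, one_mul]
      exact (hasDeg_fockH P _).smul _) n
  rwa [PowerSeries.coeff_mk, one_mul] at this

/-- The vertex operator `exp (∑ a_r h_{-r} z^r) exp (∑ b_r h_r z^{-r})` on the Fock space. -/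
def fockPair (P : Params) (a b : ℕ → ℂ) : VertexPair FockSpace where
  A := posCur (expCoeff fun r => a r • fockH P (-(r : ℤ)))
  B := posCur (expCoeff fun r => b r • fockH P r)
  A_neg _ hi := posCur_of_neg _ hi
  B_neg _ hn := posCur_of_neg _ hn
  smooth := smooth_of_hasDeg (hasDeg_annihilation P b)

lemma fockPair_A (P : Params) (a b : ℕ → ℂ) :
    (fockPair P a b).A = posCur (expCoeff fun r => a r • fockH P (-(r : ℤ))) := rfl

lemma fockPair_B (P : Params) (a b : ℕ → ℂ) :
    (fockPair P a b).B = posCur (expCoeff fun r => b r • fockH P r) := rfl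

lemma hasDeg_fockPair (P : Params) (a b : ℕ → ℂ) (m : ℤ) :
    HasDeg fockGrading m 0 ((fockPair P a b).cur m) :=
  VertexPair.hasDeg_cur (hasDeg_creation P a) (hasDeg_annihilation P b) m

lemma fockVertex_eq (P : Params) (a b : ℕ → ℂ) : fockVertex P a b = (fockPair P a b).cur := by
  funext k
  rw [fockVertex, mulCur, VertexPair.cur, VertexPair.dress,
    ← locSum_congr_equiv (Equiv.addLeft k)]
  congr 1
  funext i
  rw [negCur_eq, one_mul, Equiv.coe_addLeft, show -(k - (k + i)) = i by ring]
  rfl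

lemma posCur_commute {W : Type*} [AddCommGroup W] [Module ℂ W] {E E' : ℕ → End ℂ W}
    (h : ∀ i j, Commute (E i) (E' j)) (m n : ℤ) : Commute (posCur E m) (posCur E' n) := by
  rw [posCur, posCur]
  split_ifs
  · exact h _ _
  · exact Commute.zero_right _
  · exact Commute.zero_left _
  · exact Commute.zero_left _

lemma expCoeff_commute {W : Type*} [AddCommGroup W] [Module ℂ W] {h : ℕ → End ℂ W}
    (hcomm : ∀ i j, Commute (h i) (h j)) (a a' : ℕ → ℂ) (m n : ℕ) :
    Commute (expCoeff (fun r => a r • h r) m) (expCoeff (fun r => a' r • h r) n) := by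
  have h1 := isExp_expCoeff_smul hcomm a
  have h2 := isExp_expCoeff_smul hcomm a'
  have h3 : ∀ i n, Commute (h i) (expCoeff (fun r => a' r • h r) n) := fun i n => by
    have := h2.commute_coeff (x := h i) (fun r _ => by
      rw [PowerSeries.coeff_mk]; exact (hcomm _ _).smul_right _) n
    rwa [PowerSeries.coeff_mk] at this
  have := h1.commute_coeff (x := expCoeff (fun r => a' r • h r) n) (fun r _ => by
      rw [PowerSeries.coeff_mk]; exact ((h3 _ _).symm).smul_right _) m
  rw [PowerSeries.coeff_mk] at this
  exact this.symm

lemma fockPair_compatible (P : Params) (a b a' b' : ℕ → ℂ) :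
    (fockPair P a b).Compatible (fockPair P a' b') :=
  ⟨posCur_commute (expCoeff_commute (fockH_neg_commute P) a a'),
    posCur_commute (expCoeff_commute (h := fun r : ℕ => fockH P r) (fockH_pos_commute P) b b')⟩

lemma fockH_mul_creation (P : Params) (a : ℕ → ℂ) {r : ℕ} (hr : 0 < r) (n : ℤ) :
    fockH P r * posCur (expCoeff fun r => a r • fockH P (-(r : ℤ))) n =
      posCur (expCoeff fun r => a r • fockH P (-(r : ℤ))) n * fockH P r +
        (a r * fockLevel P r) • posCur (expCoeff fun r => a r • fockH P (-(r : ℤ))) (n - r) := by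
  rcases lt_or_ge n 0 with hn | hn
  · rw [posCur_of_neg _ hn, posCur_of_neg _ (show n - r < 0 by omega)]
    simp
  obtain ⟨n, rfl⟩ := Int.eq_ofNat_of_zero_le hn
  have h1 := (isExp_expCoeff_smul (fockH_neg_commute P) a).commutator (x := fockH P r) hr
    (ν := a r * fockLevel P r) (fun s hs => by
      rw [PowerSeries.coeff_mk, mul_smul_comm, fockH_commutator P hr hs, smul_add, smul_mul_assoc]
      congr 1
      split_ifs with h
      · rw [h, smul_smul]
      · simp) n
  rw [PowerSeries.coeff_mk, PowerSeries.coeff_mk] at h1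
  rw [posCur_natCast, h1]
  congr 1
  split_ifs with h
  · rw [← Nat.cast_sub h, posCur_natCast]
  · rw [posCur_of_neg _ (by omega), smul_zero]

/-- Each `h_r` with `r > 0` shifts the creation current by the scalar `a' r * fockLevel P r`, so
moving the whole annihilation exponential across multiplies by `exp ν`. A contraction is thus found
by recognising `∑ b_r a'_r [h_r, h_{-r}] t^r` as the logarithm of a rational function. -/
lemma fockPair_contracts (P : Params) {a b a' b' : ℕ → ℂ} {ν g : PowerSeries ℂ} (hg : IsExp ν g)
    (hν : ∀ r, 0 < r → PowerSeries.coeff r ν = b r * a' r * fockLevel P r) :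
    (fockPair P a b).Contracts (fockPair P a' b') g := by
  intro p i L hL
  rcases lt_or_ge p 0 with hp | hp
  · rw [(fockPair P a b).B_neg p hp, zero_mul]
    refine (Finset.sum_eq_zero fun k _ => ?_).symm
    rw [(fockPair P a b).B_neg _ (by omega), mul_zero, smul_zero]
  obtain ⟨m, rfl⟩ := Int.eq_ofNat_of_zero_le hp
  have h1 := (isExp_expCoeff_smul (h := fun r : ℕ => fockH P r) (fockH_pos_commute P) b).mul_shift
    hg (T := (fockPair P a' b').A) (fun r hr n => by
      rw [PowerSeries.coeff_mk, smul_mul_assoc, mul_smul_comm, hν r hr, mul_assoc, mul_smul (b r),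
        ← smul_add]
      exact congrArg _ (fockH_mul_creation P a' hr n)) m i
  rw [PowerSeries.coeff_mk, Finset.Nat.sum_antidiagonal_eq_sum_range_succ_mk] at h1
  have h2 : (fockPair P a b).B m = expCoeff (fun r => b r • fockH P r) m  := by
    rw [fockPair_B, posCur_natCast]
  rw [h2, h1]
  have h3 : m + 1 ≤ L := by exact_mod_cast hL
  rw [← Finset.sum_subset (Finset.range_subset_range.2 h3)]
  · refine Finset.sum_congr rfl fun k hk => ?_
    rw [Finset.mem_range] at hk
    rw [← Nat.cast_sub (by omega : k ≤ m), PowerSeries.coeff_mk]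
    rw [fockPair_B, posCur_natCast]
  · intro k _ hk
    rw [Finset.mem_range] at hk
    rw [(fockPair P a b).B_neg _ (by omega), mul_zero, smul_zero]

lemma fockPair_contracts_one (P : Params) {a b a' b' : ℕ → ℂ}
    (h : (∀ r, 0 < r → b r = 0) ∨ ∀ r, 0 < r → a' r = 0) :
    (fockPair P a b).Contracts (fockPair P a' b') 1 :=
  fockPair_contracts P IsExp.zero fun r hr => by
    rcases h with h | h <;> simp [h r hr]

lemma onLine_fockPair (P : Params) {a b a' b' a'' b'' : ℕ → ℂ} {c : ℂ} (hc : c ≠ 0)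
    (ha : ∀ r, 0 < r → a'' r = c ^ r * a r + a' r)
    (hb : ∀ r, 0 < r → b'' r = c⁻¹ ^ r * b r + b' r) (m n : ℤ) (w : FockSpace) :
    onLine c ((fockPair P a b).normal (fockPair P a' b')) m n w =
      c ^ m • (fockPair P a'' b'').cur (m + n) w := by
  refine (fockPair_compatible P a b a' b').onLine_normal hc ?_ ?_ m n w
  · exact finsum_posCur_conv (expCoeff_conv (fockH_neg_commute P) (fockH_zero P) ha)
  · intro q w
    have := finsum_posCur_conv (expCoeff_conv (h := fun r : ℕ => fockH P r) (fockH_pos_commute P)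
      (fockH_zero P) hb) q w
    simp only [inv_zpow, ← zpow_neg] at this
    exact this

/-- With one of the two inner halves trivial, the product is already normally ordered, so setting
the arguments equal gives locally finite sums. -/
lemma mulCur_fockPair (P : Params) {a b a' b' a'' b'' : ℕ → ℂ}
    (h : (∀ r, 0 < r → b r = 0) ∨ ∀ r, 0 < r → a' r = 0)
    (ha : ∀ r, 0 < r → a'' r = a r + a' r) (hb : ∀ r, 0 < r → b'' r = b r + b' r) :
    mulCur (fockPair P a b).cur (fockPair P a' b').cur = (fockPair P a'' b'').cur := by
  refine (fockPair_compatible P a b a' b').mulCur_eq (fockPair_contracts_one P h) ?_ ?_ ?_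
  · intro K w
    have := finsum_posCur_conv (c := 1) (expCoeff_conv (fockH_neg_commute P) (fockH_zero P)
      (a := a) (a' := a') (a'' := a'') (c := 1) (by simpa using ha)) K w
    simpa [fockPair_A, fockPair_B] using this
  · intro K w
    have := finsum_posCur_conv (c := 1) (expCoeff_conv (h := fun r : ℕ => fockH P r)
      (fockH_pos_commute P) (fockH_zero P) (a := b) (a' := b') (a'' := b'')
      (c := 1) (by simpa using hb)) K w
    simpa [fockPair_A, fockPair_B] using this
  · intro k w
    obtain ⟨M, hM⟩ := (fockPair_compatible P a b a' b').smooth_normal w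
    refine (Set.finite_Icc (k - M) M).subset fun n hn => ?_
    rw [Set.mem_Icc]
    by_contra hne
    exact hn (hM _ _ (by omega))

/-- A vertex operator without creation part. -/
lemma fockPair_cur_annihilation (P : Params) {a b : ℕ → ℂ} (ha : ∀ r, 0 < r → a r = 0) :
    (fockPair P a b).cur = posCur (expCoeff fun r => b r • fockH P r) := by
  funext m
  rw [VertexPair.cur, VertexPair.dress, locSum_eq_single 0]
  · have h : (fockPair P a b).A ((0 : ℕ) : ℤ) = 1 := by
      rw [fockPair_A, posCur_natCast]
      exact expCoeff_of_zero (fockH_neg_commute P) (fockH_zero P) ha 0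
    rw [← Nat.cast_zero, h, one_mul, one_mul]
    simp [fockPair]
  · intro i hi
    have h : (fockPair P a b).A i = 0 := by
      rcases lt_or_ge i 0 with h0 | h0
      · exact (fockPair P a b).A_neg i h0
      obtain ⟨n, rfl⟩ := Int.eq_ofNat_of_zero_le h0
      rw [fockPair_A, posCur_natCast, expCoeff_of_zero (fockH_neg_commute P) (fockH_zero P) ha,
        if_neg (by exact_mod_cast hi)]
    rw [h, zero_mul]

/-- A vertex operator without annihilation part. -/
lemma fockPair_cur_creation (P : Params) {a b : ℕ → ℂ} (hb : ∀ r, 0 < r → b r = 0) :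
    (fockPair P a b).cur = negCur (expCoeff fun r => a r • fockH P (-(r : ℤ))) := by
  funext m
  rw [VertexPair.cur, VertexPair.dress, locSum_eq_single (-m), negCur_eq]
  · have h : (fockPair P a b).B ((0 : ℕ) : ℤ) = 1 := by
      rw [fockPair_B, posCur_natCast]
      exact expCoeff_of_zero (h := fun r : ℕ => fockH P r) (fockH_pos_commute P) (fockH_zero P) hb 0
    rw [show m + -m = ((0 : ℕ) : ℤ) by simp, h, one_mul, mul_one]
    simp [fockPair]
  · intro i hi
    have h : (fockPair P a b).B (m + i) = 0 := by
      rcases lt_or_ge (m + i) 0 with h0 | h0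
      · exact (fockPair P a b).B_neg _ h0
      obtain ⟨n, hn⟩ := Int.eq_ofNat_of_zero_le h0
      rw [hn]
      rw [fockPair_B, posCur_natCast,
        expCoeff_of_zero (h := fun r : ℕ => fockH P r) (fockH_pos_commute P) (fockH_zero P) hb,
        if_neg (by omega)]
    rw [h, mul_zero, mul_zero]

/-! ### Identities among the parameters -/

namespace Params

variable (P : Params)

lemma q₁_ne_zero : P.q₁ ≠ 0 := Complex.exp_ne_zero _
lemma q₂_ne_zero : P.q₂ ≠ 0 := Complex.exp_ne_zero _
lemma q₃_ne_zero : P.q₃ ≠ 0 := Complex.exp_ne_zero _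
lemma s₁_ne_zero : P.s₁ ≠ 0 := Complex.exp_ne_zero _

lemma s₁_sq : P.s₁ ^ 2 = P.q₁ := by
  rw [s₁, q₁, ← Complex.exp_nat_mul]; congr 1; push_cast; ring

lemma q_prod : P.q₁ * P.q₂ * P.q₃ = 1 := by
  rw [q₁, q₂, q₃, ← Complex.exp_add, ← Complex.exp_add, P.sum_eq, Complex.exp_zero]

lemma q₁_eq : P.q₁ = (P.q₂ * P.q₃)⁻¹ := by
  exact eq_inv_of_mul_eq_one_left (by rw [← mul_assoc, P.q_prod])

variable {P}

lemma Generic.q₁_pow_ne (h : P.Generic) {r : ℕ} (hr : 0 < r) : P.q₁ ^ r ≠ 1 := fun h' => by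
  have := (h r 0 (by simpa using h')).1
  omega

lemma Generic.q₂_pow_ne (h : P.Generic) {r : ℕ} (hr : 0 < r) : P.q₂ ^ r ≠ 1 := fun h' => by
  have := (h 0 r (by simpa using h')).2
  omega

lemma Generic.q₃_pow_ne (h : P.Generic) {r : ℕ} (hr : 0 < r) : P.q₃ ^ r ≠ 1 := fun h' => by
  have h1 : (P.q₁ * P.q₂) ^ r = 1 := by
    have := congrArg (· ^ r) P.q_prod
    simpa [mul_pow, h'] using this
  have := (h r r (by simpa [mul_pow] using h1)).1
  omega

lemma Generic.check (h : P.Generic) : P.check.Generic := fun a b hab => by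
  have h1 : P.check.q₁ = P.q₁⁻¹ := by simp [Params.check, q₁, Complex.exp_neg]
  have h2 : P.check.q₂ = P.q₂ := rfl
  rw [h1, h2, inv_zpow, ← zpow_neg] at hab
  have := h _ _ hab
  exact ⟨by omega, this.2⟩

/-- The `r`-th powers of the parameters. -/
lemma Generic.pow_data (h : P.Generic) {r : ℕ} (hr : 0 < r) : ∃ σ b c : ℂ,
    P.s₁ ^ r = σ ∧ P.q₂ ^ r = b ∧ P.q₃ ^ r = c ∧ P.q₁ ^ r = σ ^ 2 ∧ σ ≠ 0 ∧ b ≠ 0 ∧ c ≠ 0 ∧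
    σ ^ 2 * b * c = 1 ∧ 1 - b ≠ 0 ∧ 1 - c ≠ 0 ∧ (r : ℂ) ≠ 0 := by
  have h1 : P.q₁ ^ r = (P.s₁ ^ r) ^ 2 := by rw [← P.s₁_sq]; ring
  refine ⟨_, _, _, rfl, rfl, rfl, h1, pow_ne_zero _ P.s₁_ne_zero, pow_ne_zero _ P.q₂_ne_zero,
    pow_ne_zero _ P.q₃_ne_zero, ?_, sub_ne_zero.2 (h.q₂_pow_ne hr).symm,
    sub_ne_zero.2 (h.q₃_pow_ne hr).symm, by exact_mod_cast hr.ne'⟩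
  rw [← h1, ← mul_pow, ← mul_pow, P.q_prod, one_pow]

end Params

/-! ### The contraction functions -/

section Contractions

open PowerSeries

variable (P : Params)

/-- `(1 - t)(1 - p₂p₃t) / ((1 - p₂t)(1 - p₃t))`. -/
def gSame (p₂ p₃ : ℂ) : PowerSeries ℂ :=
  (1 - C 1 * X) * (1 - C (p₂ * p₃) * X) * (geom p₂ * geom p₃)

lemma isExp_gSame (p₂ p₃ : ℂ) :
    IsExp (-logInv 1 + -logInv (p₂ * p₃) + (logInv p₂ + logInv p₃)) (gSame p₂ p₃) :=
  ((isExp_one_sub _).mul_scalar (isExp_one_sub _)).mul_scalar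
    ((isExp_geom _).mul_scalar (isExp_geom _))

/-- `∏ (1 - q_i⁻¹ct) / (1 - q_i ct)`. -/
def gPsi (c : ℂ) : PowerSeries ℂ :=
  ((1 - C (P.q₁⁻¹ * c) * X) * ((1 - C (P.q₂⁻¹ * c) * X) * (1 - C (P.q₃⁻¹ * c) * X))) *
    (geom (P.q₁ * c) * (geom (P.q₂ * c) * geom (P.q₃ * c)))

/-- `∏ (1 - q_i ct) / (1 - q_i⁻¹ct)`. -/
def gPsiInv (c : ℂ) : PowerSeries ℂ :=
  ((1 - C (P.q₁ * c) * X) * ((1 - C (P.q₂ * c) * X) * (1 - C (P.q₃ * c) * X))) *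
    (geom (P.q₁⁻¹ * c) * (geom (P.q₂⁻¹ * c) * geom (P.q₃⁻¹ * c)))

/-- Because `q₁ q₂ q₃ = 1`, the product `κ_r` expands to `∑ (q_i^{-r} - q_i^r)`, which gives one
logarithm for each of the six linear factors. -/
lemma isExp_gPsi (c : ℂ) : ∃ ν, IsExp ν (gPsi P c) ∧
    ∀ r : ℕ, 0 < r → coeff r ν = -(P.κ r * c ^ r / r) := by
  refine ⟨_, ((isExp_one_sub _).mul_scalar ((isExp_one_sub _).mul_scalar
    (isExp_one_sub _))).mul_scalar ((isExp_geom _).mul_scalar ((isExp_geom _).mul_scalar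
    (isExp_geom _))), fun r hr => ?_⟩
  have h1 : (P.q₁ ^ r) * (P.q₂ ^ r) * (P.q₃ ^ r) = 1 := by
    rw [← mul_pow, ← mul_pow, P.q_prod, one_pow]
  have h2 := pow_ne_zero r P.q₁_ne_zero
  have h3 := pow_ne_zero r P.q₂_ne_zero
  have h4 := pow_ne_zero r P.q₃_ne_zero
  simp only [map_add, map_neg, logInv, coeff_mk, Params.κ, zpow_natCast, mul_pow, inv_pow]
  generalize P.q₁ ^ r = x at *
  generalize P.q₂ ^ r = y at *
  generalize P.q₃ ^ r = z at *
  have h5 : x⁻¹ = y * z := inv_eq_of_mul_eq_one_right (by linear_combination h1)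
  have h6 : y⁻¹ = x * z := inv_eq_of_mul_eq_one_right (by linear_combination h1)
  have h7 : z⁻¹ = x * y := inv_eq_of_mul_eq_one_right (by linear_combination h1)
  rw [h5, h6, h7]
  linear_combination (-(c ^ r / r)) * h1

lemma isExp_gPsiInv (c : ℂ) : ∃ ν, IsExp ν (gPsiInv P c) ∧
    ∀ r : ℕ, 0 < r → coeff r ν = P.κ r * c ^ r / r := by
  refine ⟨_, ((isExp_one_sub _).mul_scalar ((isExp_one_sub _).mul_scalar
    (isExp_one_sub _))).mul_scalar ((isExp_geom _).mul_scalar ((isExp_geom _).mul_scalar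
    (isExp_geom _))), fun r hr => ?_⟩
  have h1 : (P.q₁ ^ r) * (P.q₂ ^ r) * (P.q₃ ^ r) = 1 := by
    rw [← mul_pow, ← mul_pow, P.q_prod, one_pow]
  have h2 := pow_ne_zero r P.q₁_ne_zero
  have h3 := pow_ne_zero r P.q₂_ne_zero
  have h4 := pow_ne_zero r P.q₃_ne_zero
  simp only [map_add, map_neg, logInv, coeff_mk, Params.κ, zpow_natCast, mul_pow, inv_pow]
  generalize P.q₁ ^ r = x at *
  generalize P.q₂ ^ r = y at *
  generalize P.q₃ ^ r = z at *
  have h5 : x⁻¹ = y * z := inv_eq_of_mul_eq_one_right (by linear_combination h1)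
  have h6 : y⁻¹ = x * z := inv_eq_of_mul_eq_one_right (by linear_combination h1)
  have h7 : z⁻¹ = x * y := inv_eq_of_mul_eq_one_right (by linear_combination h1)
  rw [h5, h6, h7]
  linear_combination (c ^ r / r) * h1

lemma gPoly_eq {a : ℂ} (ha : a ≠ 0) (b : ℂ) : gPoly P a b = C (a ^ 3) *
    ((1 - C (P.q₁ * (b * a⁻¹)) * X) * ((1 - C (P.q₂ * (b * a⁻¹)) * X) *
      (1 - C (P.q₃ * (b * a⁻¹)) * X))) := by
  have h : ∀ q : ℂ, (C a + C (-(q * b)) * X : PowerSeries ℂ) =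
      C a * (1 - C (q * (b * a⁻¹)) * X) := fun q => by
    rw [mul_sub, ← mul_assoc, ← map_mul, mul_one, show a * (q * (b * a⁻¹)) = q * b by field_simp,
      map_neg]
    ring
  rw [gPoly, h, h, h, map_pow]
  ring

lemma gPolyRev_eq {a : ℂ} (ha : a ≠ 0) (b : ℂ) : gPolyRev P a b = -(C (a ^ 3) *
    ((1 - C (P.q₁⁻¹ * (b * a⁻¹)) * X) * ((1 - C (P.q₂⁻¹ * (b * a⁻¹)) * X) *
      (1 - C (P.q₃⁻¹ * (b * a⁻¹)) * X)))) := by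
  have h : ∀ q : ℂ, q ≠ 0 → (C (-(q * a)) + C b * X : PowerSeries ℂ) =
      -(C q * (C a * (1 - C (q⁻¹ * (b * a⁻¹)) * X))) := fun q hq => by
    have h1 : C b = C q * C a * (C (q⁻¹ * (b * a⁻¹)) : PowerSeries ℂ) := by
      rw [← map_mul, ← map_mul]; congr 1; field_simp
    rw [h1, map_neg, map_mul]
    ring
  have h1 : (C P.q₁ * C P.q₂ * C P.q₃ : PowerSeries ℂ) = 1 := by
    rw [← map_mul, ← map_mul, P.q_prod, map_one]
  rw [gPolyRev, h _ P.q₁_ne_zero, h _ P.q₂_ne_zero, h _ P.q₃_ne_zero, map_pow]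
  linear_combination (-(C a ^ 3 *
    ((1 - C (P.q₁⁻¹ * (b * a⁻¹)) * X) * ((1 - C (P.q₂⁻¹ * (b * a⁻¹)) * X) *
      (1 - C (P.q₃⁻¹ * (b * a⁻¹)) * X))))) * h1

/-- Pulling `-q_i a` out of each factor of `gPolyRev` leaves the numerator of `gPsi` times `-a³`,
again by `q₁ q₂ q₃ = 1`. -/
lemma gPoly_mul_gPsi {a : ℂ} (ha : a ≠ 0) (b : ℂ) :
    gPoly P a b * gPsi P (b * a⁻¹) + gPolyRev P a b = 0 := by
  rw [gPoly_eq P ha, gPolyRev_eq P ha, gPsi]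
  have h1 := one_sub_mul_geom (P.q₁ * (b * a⁻¹))
  have h2 := one_sub_mul_geom (P.q₂ * (b * a⁻¹))
  have h3 := one_sub_mul_geom (P.q₃ * (b * a⁻¹))
  set u := 1 - C (P.q₁ * (b * a⁻¹)) * X
  set v := 1 - C (P.q₂ * (b * a⁻¹)) * X
  set w := 1 - C (P.q₃ * (b * a⁻¹)) * X
  have h4 : u * geom (P.q₁ * (b * a⁻¹)) * (v * geom (P.q₂ * (b * a⁻¹))) *
      (w * geom (P.q₃ * (b * a⁻¹))) = 1 := by rw [h1, h2, h3, one_mul, one_mul]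
  linear_combination (C (a ^ 3) * ((1 - C (P.q₁⁻¹ * (b * a⁻¹)) * X) *
    ((1 - C (P.q₂⁻¹ * (b * a⁻¹)) * X) * (1 - C (P.q₃⁻¹ * (b * a⁻¹)) * X)))) * h4

lemma gPolyRev_mul_gPsiInv {a : ℂ} (ha : a ≠ 0) (b : ℂ) :
    gPolyRev P a b * gPsiInv P (b * a⁻¹) + gPoly P a b = 0 := by
  rw [gPoly_eq P ha, gPolyRev_eq P ha, gPsiInv]
  have h1 := one_sub_mul_geom (P.q₁⁻¹ * (b * a⁻¹))
  have h2 := one_sub_mul_geom (P.q₂⁻¹ * (b * a⁻¹))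
  have h3 := one_sub_mul_geom (P.q₃⁻¹ * (b * a⁻¹))
  set u := 1 - C (P.q₁⁻¹ * (b * a⁻¹)) * X
  set v := 1 - C (P.q₂⁻¹ * (b * a⁻¹)) * X
  set w := 1 - C (P.q₃⁻¹ * (b * a⁻¹)) * X
  have h4 : u * geom (P.q₁⁻¹ * (b * a⁻¹)) * (v * geom (P.q₂⁻¹ * (b * a⁻¹))) *
      (w * geom (P.q₃⁻¹ * (b * a⁻¹))) = 1 := by rw [h1, h2, h3, one_mul, one_mul]
  linear_combination (-(C (a ^ 3) * ((1 - C (P.q₁ * (b * a⁻¹)) * X) *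
    ((1 - C (P.q₂ * (b * a⁻¹)) * X) * (1 - C (P.q₃ * (b * a⁻¹)) * X))))) * h4

/-- The poles of the contraction cancel the `q₂` and `q₃` factors of `g`. As `q₂ q₃ = q₁⁻¹`, what
remains is the cubic of `series_cubic`; its roots `q₁^{±1}` later make the fused currents vanish. -/
lemma gPoly_mul_gSame : gPoly P 1 1 * gSame P.q₂ P.q₃ =
    C 1 * ((1 - C P.q₁ * X) * ((1 - X) * (1 - C P.q₁⁻¹ * X))) := by
  have h1 := one_sub_mul_geom P.q₂
  have h2 := one_sub_mul_geom P.q₃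
  have h0 : P.q₂ * P.q₃ = P.q₁⁻¹ := by rw [P.q₁_eq, inv_inv]
  rw [gPoly_eq P one_ne_zero, gSame, h0]
  simp only [inv_one, mul_one, one_pow, map_one, one_mul]
  have h3 : (1 - C P.q₂ * X) * geom P.q₂ * ((1 - C P.q₃ * X) * geom P.q₃) = 1 := by
    rw [h1, h2, one_mul]
  linear_combination ((1 - C P.q₁ * X) * ((1 - X) * (1 - C P.q₁⁻¹ * X))) * h3

lemma gPolyRev_mul_gSame : gPolyRev P 1 1 * gSame P.q₂⁻¹ P.q₃⁻¹ =
    C (-1) * ((1 - C P.q₁ * X) * ((1 - X) * (1 - C P.q₁⁻¹ * X))) := by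
  have h1 := one_sub_mul_geom P.q₂⁻¹
  have h2 := one_sub_mul_geom P.q₃⁻¹
  have h0 : P.q₂⁻¹ * P.q₃⁻¹ = P.q₁ := by rw [P.q₁_eq, mul_inv]
  rw [gPolyRev_eq P one_ne_zero, gSame, h0]
  simp only [inv_one, mul_one, one_pow, map_one, one_mul, map_neg]
  have h3 : (1 - C P.q₂⁻¹ * X) * geom P.q₂⁻¹ * ((1 - C P.q₃⁻¹ * X) * geom P.q₃⁻¹) = 1 := by
    rw [h1, h2, one_mul]
  linear_combination (-((1 - C P.q₁ * X) * ((1 - X) * (1 - C P.q₁⁻¹ * X)))) * h3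

/-- `(1 - q₂⁻¹s₁⁻¹t)(1 - q₃⁻¹s₁⁻¹t) / ((1 - s₁t)(1 - s₁⁻¹t))`. -/
def gMixed : PowerSeries ℂ :=
  (1 - C (P.q₂⁻¹ * P.s₁⁻¹) * X) * (1 - C (P.q₃⁻¹ * P.s₁⁻¹) * X) * (geom P.s₁ * geom P.s₁⁻¹)

lemma isExp_gMixed : IsExp (-logInv (P.q₂⁻¹ * P.s₁⁻¹) + -logInv (P.q₃⁻¹ * P.s₁⁻¹) +
    (logInv P.s₁ + logInv P.s₁⁻¹)) (gMixed P) :=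
  ((isExp_one_sub _).mul_scalar (isExp_one_sub _)).mul_scalar
    ((isExp_geom _).mul_scalar (isExp_geom _))

variable {P}

/-- Partial fractions. -/
lemma coeff_gMixed (hP : P.Generic) {k : ℕ} (hk : 0 < k) : coeff k (gMixed P) =
    ((1 - P.q₂⁻¹) * (1 - P.q₃⁻¹) / (P.q₁ - 1)) * (P.s₁ ^ k - P.s₁⁻¹ ^ k) := by
  have hs := P.s₁_ne_zero
  have hq : P.q₁ - 1 ≠ 0 := sub_ne_zero.2 (by simpa using hP.q₁_pow_ne one_pos)
  have hs2 : P.s₁ ^ 2 - 1 ≠ 0 := by rwa [P.s₁_sq]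
  set ρ := (1 - P.q₂⁻¹) * (1 - P.q₃⁻¹) / (P.q₁ - 1) with hρ
  have h1 := one_sub_mul_geom P.s₁
  have h2 := one_sub_mul_geom P.s₁⁻¹
  -- Numerator and denominator of `gMixed` agree in degrees `0` and `2` (`e2`), so they differ by a
  -- multiple of `t`. Its coefficient is `ρ (s₁ - s₁⁻¹)`, which accounts for the value of `ρ`.
  have e1 : ρ * (P.s₁ - P.s₁⁻¹) = P.s₁ + P.s₁⁻¹ - P.q₂⁻¹ * P.s₁⁻¹ - P.q₃⁻¹ * P.s₁⁻¹ := by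
    have hq1 : P.s₁ ^ 2 = P.q₂⁻¹ * P.q₃⁻¹ := by rw [P.s₁_sq, P.q₁_eq, mul_inv]
    rw [hρ, ← P.s₁_sq]
    generalize P.q₂⁻¹ = x at *
    generalize P.q₃⁻¹ = y at *
    field_simp
    linear_combination (-1 : ℂ) * (hq1)
  have e2 : P.q₂⁻¹ * P.s₁⁻¹ * (P.q₃⁻¹ * P.s₁⁻¹) = 1 := by
    have h3 : P.q₂⁻¹ * P.q₃⁻¹ = P.s₁ ^ 2 := by rw [P.s₁_sq, P.q₁_eq, mul_inv]
    calc _ = P.q₂⁻¹ * P.q₃⁻¹ * (P.s₁⁻¹ * P.s₁⁻¹) := by ring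
      _ = 1 := by rw [h3]; field_simp
  have key : gMixed P = 1 + C ρ * (geom P.s₁ - geom P.s₁⁻¹) := by
    have e1' : C ρ * (C P.s₁ - C P.s₁⁻¹) = C P.s₁ + C P.s₁⁻¹ -
        C (P.q₂⁻¹ * P.s₁⁻¹) - (C (P.q₃⁻¹ * P.s₁⁻¹) : PowerSeries ℂ) := by
      rw [← map_sub, ← map_mul, e1]; simp only [map_sub, map_add]
    have e2' : C (P.q₂⁻¹ * P.s₁⁻¹) * (C (P.q₃⁻¹ * P.s₁⁻¹) : PowerSeries ℂ) = 1 := by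
      rw [← map_mul, e2, map_one]
    have e3' : C P.s₁ * (C P.s₁⁻¹ : PowerSeries ℂ) = 1 := by
      rw [← map_mul, mul_inv_cancel₀ hs, map_one]
    rw [gMixed]
    generalize C (P.q₂⁻¹ * P.s₁⁻¹) = a at *
    generalize C (P.q₃⁻¹ * P.s₁⁻¹) = b at *
    generalize C ρ = r at *
    generalize C P.s₁ = s at *
    generalize C P.s₁⁻¹ = s' at *
    generalize geom P.s₁ = G at *
    generalize geom P.s₁⁻¹ = G' at *
    have h3 : (1 - s * X) * (1 - s' * X) * (G * G') = 1 := by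
      linear_combination (1 - s' * X) * G' * h1 + h2
    have h4 : G - G' = (s - s') * X * (G * G') := by
      linear_combination (-G) * h2 + G' * h1
    rw [h4]
    linear_combination h3 - X * G * G' * e1' + X ^ 2 * G * G' * e2' - X ^ 2 * G * G' * e3'
  rw [key, map_add, coeff_one, if_neg hk.ne', zero_add, coeff_C_mul, map_sub, geom, geom, coeff_mk,
    coeff_mk]

end Contractions

/-! ### The toroidal relations on the Fock space, apart from the Serre relations -/

section FockRelations

open PowerSeries

variable (P : Params) (v : ℂ)

/-- The vertex operator of `e(z)`. -/
def fockE : VertexPair FockSpace := fockPair P (fun r => (1 - P.q₂ ^ r) * (1 - P.q₃ ^ r))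
  (fun r => (1 - P.q₂⁻¹ ^ r) * (1 - P.q₃⁻¹ ^ r) * P.s₁⁻¹ ^ r)

/-- The vertex operator of `f(z)`. -/
def fockF : VertexPair FockSpace := fockPair P
  (fun r => -((1 - P.q₂ ^ r) * (1 - P.q₃ ^ r) * P.s₁ ^ r))
  (fun r => -((1 - P.q₂⁻¹ ^ r) * (1 - P.q₃⁻¹ ^ r)))

/-- The vertex operator of `ψ⁺(z)`. -/
def fockPsiP : VertexPair FockSpace := fockPair P (fun _ => 0) (fun r => P.κ r)

/-- The vertex operator of `ψ⁻(z)`. -/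
def fockPsiM : VertexPair FockSpace := fockPair P (fun r => P.κ r) (fun _ => 0)

/-- The normalization of `e(z)`. -/
def fockEConst : ℂ := P.s₁⁻¹ * v / ((1 - P.q₂) * (1 - P.q₃))

/-- The normalization of `f(z)`. -/
def fockFConst : ℂ := -(P.s₁⁻¹ * v⁻¹) / ((1 - P.q₂) * (1 - P.q₃))

lemma fock_e : (fock P v).e = fockEConst P v • (fockE P).cur := by
  rw [fockE, ← fockVertex_eq]; rfl

lemma fock_f : (fock P v).f = fockFConst P v • (fockF P).cur := by
  rw [fockF, ← fockVertex_eq]; rfl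

lemma fock_ψp : (fock P v).ψp P = (fockPsiP P).cur := by
  rw [fockPsiP, fockPair_cur_annihilation P fun _ _ => rfl, GL1Data.ψp]
  simp [fock]

lemma fock_ψm : (fock P v).ψm P = (fockPsiM P).cur := by
  rw [fockPsiM, fockPair_cur_creation P fun _ _ => rfl, GL1Data.ψm]
  simp [fock]

lemma coe_fock_C : ((fock P v).C : End ℂ FockSpace) = sca P.s₁ := rfl

lemma coe_fock_C_zpow (m : ℤ) :
    (((fock P v).C ^ m : (End ℂ FockSpace)ˣ) : End ℂ FockSpace) = sca (P.s₁ ^ m) :=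
  coe_expUnit_zpow _ _

variable {P}

/-- With `σ = s₁^r`, `b = q₂^r`, `c = q₃^r`, the comparison of logarithms in degree `r` is a
rational identity modulo `σ² b c = 1`. The other contractions are checked in the same way. -/
lemma fockE_contracts_fockE (hP : P.Generic) :
    (fockE P).Contracts (fockE P) (gSame P.q₂ P.q₃) := by
  refine fockPair_contracts P (isExp_gSame _ _) fun r hr => ?_
  obtain ⟨σ, b, c, hσ, hb, hc, h1, hσ0, hb0, hc0, hprod, hb1, hc1, hr0⟩ := hP.pow_data hr
  simp only [map_add, map_neg, logInv, coeff_mk, fockLevel, mul_pow, inv_pow, hσ, hb, hc, one_pow]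
  field_simp
  linear_combination (-(b * c - b - c + 1)) * hprod

lemma fockF_contracts_fockF (hP : P.Generic) :
    (fockF P).Contracts (fockF P) (gSame P.q₂⁻¹ P.q₃⁻¹) := by
  refine fockPair_contracts P (isExp_gSame _ _) fun r hr => ?_
  obtain ⟨σ, b, c, hσ, hb, hc, h1, hσ0, hb0, hc0, hprod, hb1, hc1, hr0⟩ := hP.pow_data hr
  simp only [map_add, map_neg, logInv, coeff_mk, fockLevel, mul_pow, inv_pow, hσ, hb, hc, one_pow]
  field_simp
  ring

lemma fockE_contracts_fockF (hP : P.Generic) : (fockE P).Contracts (fockF P) (gMixed P) := by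
  refine fockPair_contracts P (isExp_gMixed P) fun r hr => ?_
  obtain ⟨σ, b, c, hσ, hb, hc, h1, hσ0, hb0, hc0, hprod, hb1, hc1, hr0⟩ := hP.pow_data hr
  simp only [map_add, map_neg, logInv, coeff_mk, fockLevel, mul_pow, inv_pow, hσ, hb, hc]
  field_simp
  linear_combination hprod

lemma fockF_contracts_fockE (hP : P.Generic) : (fockF P).Contracts (fockE P) (gMixed P) := by
  refine fockPair_contracts P (isExp_gMixed P) fun r hr => ?_
  obtain ⟨σ, b, c, hσ, hb, hc, h1, hσ0, hb0, hc0, hprod, hb1, hc1, hr0⟩ := hP.pow_data hr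
  simp only [map_add, map_neg, logInv, coeff_mk, fockLevel, mul_pow, inv_pow, hσ, hb, hc]
  field_simp
  linear_combination hprod

lemma fockPsiP_contracts_fockE (hP : P.Generic) :
    (fockPsiP P).Contracts (fockE P) (gPsi P P.s₁⁻¹) := by
  obtain ⟨ν, hν, hc⟩ := isExp_gPsi P P.s₁⁻¹
  refine fockPair_contracts P hν fun r hr => ?_
  obtain ⟨σ, b, c, hσ, hb, hc', h1, hσ0, hb0, hc0, hprod, hb1, hc1, hr0⟩ := hP.pow_data hr
  rw [hc r hr]
  simp only [fockLevel, inv_pow, hσ, hb, hc']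
  field_simp

lemma fockPsiP_contracts_fockF (hP : P.Generic) :
    (fockPsiP P).Contracts (fockF P) (gPsiInv P 1) := by
  obtain ⟨ν, hν, hc⟩ := isExp_gPsiInv P 1
  refine fockPair_contracts P hν fun r hr => ?_
  obtain ⟨σ, b, c, hσ, hb, hc', h1, hσ0, hb0, hc0, hprod, hb1, hc1, hr0⟩ := hP.pow_data hr
  rw [hc r hr]
  simp only [fockLevel, one_pow, hσ, hb, hc']
  field_simp

lemma fockE_contracts_fockPsiM (hP : P.Generic) :
    (fockE P).Contracts (fockPsiM P) (gPsi P 1) := by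
  obtain ⟨ν, hν, hc⟩ := isExp_gPsi P 1
  refine fockPair_contracts P hν fun r hr => ?_
  obtain ⟨σ, b, c, hσ, hb, hc', h1, hσ0, hb0, hc0, hprod, hb1, hc1, hr0⟩ := hP.pow_data hr
  rw [hc r hr]
  simp only [fockLevel, one_pow, inv_pow, hσ, hb, hc']
  field_simp
  linear_combination (-P.κ r * (b * c - b - c + 1)) * hprod

lemma fockF_contracts_fockPsiM (hP : P.Generic) :
    (fockF P).Contracts (fockPsiM P) (gPsiInv P P.s₁) := by
  obtain ⟨ν, hν, hc⟩ := isExp_gPsiInv P P.s₁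
  refine fockPair_contracts P hν fun r hr => ?_
  obtain ⟨σ, b, c, hσ, hb, hc', h1, hσ0, hb0, hc0, hprod, hb1, hc1, hr0⟩ := hP.pow_data hr
  rw [hc r hr]
  simp only [fockLevel, inv_pow, hσ, hb, hc']
  field_simp
  linear_combination (P.κ r * (b * c - b - c + 1)) * hprod

variable (P)

lemma fock_hh (hP : P.Generic) (r s : ℤ) (hr : r ≠ 0) (hs : s ≠ 0) :
    ⁅(fock P v).h r, (fock P v).h s⁆ = if r + s = 0 then ((r : ℂ) * P.κ r)⁻¹ •
      ((((fock P v).C ^ r : (End ℂ FockSpace)ˣ) : End ℂ FockSpace) -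
        (((fock P v).C ^ (-r) : (End ℂ FockSpace)ˣ) : End ℂ FockSpace)) else 0 := by
  have key : ∀ n : ℕ, 0 < n → fockLevel P n =
      ((n : ℂ) * P.κ n)⁻¹ * (P.s₁ ^ n - (P.s₁ ^ n)⁻¹) := fun n hn => by
    obtain ⟨σ, b, c, hσ, hb, hc', h1, hσ0, hb0, hc0, hprod, hb1, hc1, hr0⟩ := hP.pow_data hn
    have h2 : 1 - σ ^ 2 ≠ 0 := by rw [← h1]; exact sub_ne_zero.2 (hP.q₁_pow_ne hn).symm
    simp only [fockLevel, Params.κ, zpow_natCast, hσ, hb, hc', h1]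
    field_simp
    ring
  have hz : ∀ c d : ℂ, (sca c - sca d : End ℂ FockSpace) = (c - d) • 1 := fun c d =>
    LinearMap.ext fun w => by
      rw [LinearMap.sub_apply, sca_apply, sca_apply, ← sub_smul]; rfl
  rw [coe_fock_C_zpow, coe_fock_C_zpow, hz, smul_smul, Ring.lie_def]
  change fockH P r * fockH P s - fockH P s * fockH P r = _
  obtain ⟨n, rfl | rfl⟩ := r.eq_nat_or_neg <;> obtain ⟨k, rfl | rfl⟩ := s.eq_nat_or_neg
  · rw [if_neg (by omega), (fockH_pos_commute P n k).eq, sub_self]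
  · have hn : 0 < n := by omega
    rw [fockH_commutator P hn (by omega), add_sub_cancel_left]
    by_cases h : k = n
    · subst h
      rw [if_pos rfl, if_pos (by omega), key k hn, zpow_neg]
      norm_cast
    · rw [if_neg h, if_neg (by omega)]
  · have hk : 0 < k := by omega
    rw [fockH_commutator P hk (by omega), sub_add_cancel_left]
    by_cases h : n = k
    · subst h
      rw [if_pos rfl, if_pos (by omega), key n hk, zpow_neg, neg_neg, zpow_natCast]
      refine (neg_smul _ (1 : End ℂ FockSpace)).symm.trans ?_
      congr 1
      -- Inverting the `q_i`, whose product is `1`, changes the sign of `κ`. So `r κ_r` is even in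
      -- `r` and the right side of the relation is odd, as a commutator requires.
      have h3 : P.κ (-(n : ℤ)) = -P.κ n := by
        obtain ⟨σ, b, c, hσ, hb, hc', h1, hσ0, hb0, hc0, hprod, hb1, hc1, hr0⟩ := hP.pow_data hk
        simp only [Params.κ, zpow_neg, zpow_natCast, hb, hc', h1]
        field_simp
        linear_combination ((1 - σ ^ 2) * (1 - b) * (1 - c)) * hprod
      rw [h3]
      push_cast
      rw [neg_mul_neg]
      ring
    · rw [if_neg h, if_neg (by omega), neg_zero]
  · rw [if_neg (by omega), (fockH_neg_commute P n k).eq, sub_self]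

/-- As `ψ⁺` has no creation part, `e(y) ψ⁺(x)` is already normally ordered, and only the other order
is contracted. -/
lemma fock_ψp_e (hP : P.Generic) :
    gXY P (fock P v).C 1 (prodXY ((fock P v).ψp P) (fock P v).e) +
      gYX P (fock P v).C 1 (prodYX (fock P v).e ((fock P v).ψp P)) = 0 := by
  have hc : (fockPsiP P).Compatible (fockE P) := fockPair_compatible _ _ _ _ _
  have h1 : (fockE P).Contracts (fockPsiP P) 1 := fockPair_contracts_one P (Or.inr fun _ _ => rfl)
  have hN := hc.smooth_normal
  rw [fock_ψp, fock_e, ← one_smul ℂ (fockPsiP P).cur, prodXY_smul, prodYX_smul, gXY_smul, gYX_smul,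
    one_mul, mul_one, ← smul_add, (fockPsiP_contracts_fockE hP).prodXY_eq hc, h1.prodYX_eq hc,
    seriesXY_one hN, ← seriesYX_one hN]
  rw [seriesYX_one hN, ← sca_one, coe_fock_C, gXY_seriesYX hN]
  -- The uncontracted product is written with the series `1`, so that both terms merge into one
  -- power series.
  nth_rewrite 2 [← seriesYX_one hN]
  rw [gYX_seriesYX hN, ← seriesYX_add hN.shiftX.shiftX.shiftX, mul_one, ← one_mul P.s₁⁻¹,
    gPoly_mul_gPsi P P.s₁_ne_zero, seriesYX_zero, smul_zero]

lemma fock_ψp_f (hP : P.Generic) :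
    gYX P 1 1 (prodXY ((fock P v).ψp P) (fock P v).f) +
      gXY P 1 1 (prodYX (fock P v).f ((fock P v).ψp P)) = 0 := by
  have hc : (fockPsiP P).Compatible (fockF P) := fockPair_compatible _ _ _ _ _
  have h1 : (fockF P).Contracts (fockPsiP P) 1 := fockPair_contracts_one P (Or.inr fun _ _ => rfl)
  have hN := hc.smooth_normal
  have h2 := gPolyRev_mul_gPsiInv P one_ne_zero 1
  rw [inv_one, one_mul] at h2
  rw [fock_ψp, fock_f, ← one_smul ℂ (fockPsiP P).cur, prodXY_smul, prodYX_smul, gXY_smul, gYX_smul,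
    one_mul, mul_one, ← smul_add, (fockPsiP_contracts_fockF hP).prodXY_eq hc, h1.prodYX_eq hc,
    seriesXY_one hN, ← sca_one, gYX_seriesYX hN]
  nth_rewrite 2 [← seriesYX_one hN]
  rw [gXY_seriesYX hN, ← seriesYX_add hN.shiftX.shiftX.shiftX, mul_one, h2, seriesYX_zero,
    smul_zero]

/-- As `ψ⁻` has no annihilation part, it is the product `e(y) ψ⁻(x)` that is contracted, with a
series in `x / y`. -/
lemma fock_ψm_e (hP : P.Generic) :
    gXY P 1 1 (prodXY ((fock P v).ψm P) (fock P v).e) +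
      gYX P 1 1 (prodYX (fock P v).e ((fock P v).ψm P)) = 0 := by
  have hc : (fockPsiM P).Compatible (fockE P) := fockPair_compatible _ _ _ _ _
  have h1 : (fockPsiM P).Contracts (fockE P) 1 := fockPair_contracts_one P (Or.inl fun _ _ => rfl)
  have hN := hc.smooth_normal
  have h2 := gPoly_mul_gPsi P one_ne_zero 1
  rw [inv_one, one_mul] at h2
  rw [fock_ψm, fock_e, ← one_smul ℂ (fockPsiM P).cur, prodXY_smul, prodYX_smul, gXY_smul, gYX_smul,
    one_mul, mul_one, ← smul_add, (fockE_contracts_fockPsiM hP).prodYX_eq hc, h1.prodXY_eq hc,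
    seriesYX_one hN, ← sca_one, gYX_seriesXY hN]
  nth_rewrite 1 [← seriesXY_one hN]
  rw [gXY_seriesXY hN, ← seriesXY_add hN.shiftY.shiftY.shiftY, mul_one, add_comm, h2, seriesXY_zero,
    smul_zero]

lemma fock_ψm_f (hP : P.Generic) :
    gYX P (fock P v).C 1 (prodXY ((fock P v).ψm P) (fock P v).f) +
      gXY P (fock P v).C 1 (prodYX (fock P v).f ((fock P v).ψm P)) = 0 := by
  have hc : (fockPsiM P).Compatible (fockF P) := fockPair_compatible _ _ _ _ _
  have h1 : (fockPsiM P).Contracts (fockF P) 1 := fockPair_contracts_one P (Or.inl fun _ _ => rfl)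
  have hN := hc.smooth_normal
  have h2 := gPolyRev_mul_gPsiInv P one_ne_zero P.s₁
  rw [inv_one, mul_one] at h2
  rw [fock_ψm, fock_f, ← one_smul ℂ (fockPsiM P).cur, prodXY_smul, prodYX_smul, gXY_smul, gYX_smul,
    one_mul, mul_one, ← smul_add, (fockF_contracts_fockPsiM hP).prodYX_eq hc, h1.prodXY_eq hc,
    seriesYX_one hN, ← sca_one, coe_fock_C, gXY_seriesXY hN]
  nth_rewrite 1 [← seriesXY_one hN]
  rw [gYX_seriesXY hN, ← seriesXY_add hN.shiftY.shiftY.shiftY, mul_one, add_comm, h2, seriesXY_zero,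
    smul_zero]

lemma fock_ee (hP : P.Generic) : gXY P 1 1 (prodXY (fock P v).e (fock P v).e) +
    gYX P 1 1 (prodYX (fock P v).e (fock P v).e) = 0 := by
  have hc : (fockE P).Compatible (fockE P) := fockPair_compatible _ _ _ _ _
  have hN := hc.smooth_normal
  rw [fock_e, prodXY_smul, prodYX_smul, gXY_smul, gYX_smul, ← smul_add,
    (fockE_contracts_fockE hP).prodYX_eq hc, (fockE_contracts_fockE hP).prodXY_eq hc, ← sca_one,
    gXY_seriesYX hN, gYX_seriesXY hN, gPoly_mul_gSame, series_cubic hN P.q₁_ne_zero, smul_zero]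

lemma fock_ff (hP : P.Generic) : gYX P 1 1 (prodXY (fock P v).f (fock P v).f) +
    gXY P 1 1 (prodYX (fock P v).f (fock P v).f) = 0 := by
  have hc : (fockF P).Compatible (fockF P) := fockPair_compatible _ _ _ _ _
  have hN := hc.smooth_normal
  rw [fock_f, prodXY_smul, prodYX_smul, gXY_smul, gYX_smul, ← smul_add,
    (fockF_contracts_fockF hP).prodYX_eq hc, (fockF_contracts_fockF hP).prodXY_eq hc, ← sca_one,
    gYX_seriesYX hN, gXY_seriesXY hN, gPolyRev_mul_gSame, series_cubic hN P.q₁_ne_zero, smul_zero]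

lemma cur_creation_rescale (a : ℕ → ℂ) {c : ℂ} (m : ℤ) :
    (fockPair P (fun r => c ^ r * a r) fun _ => 0).cur m =
      c ^ (-m) • (fockPair P a fun _ => 0).cur m := by
  rw [fockPair_cur_creation P fun _ _ => rfl, fockPair_cur_creation P fun _ _ => rfl, negCur_eq,
    negCur_eq]
  rcases lt_or_ge (-m) 0 with h | h
  · rw [posCur_of_neg _ h, posCur_of_neg _ h, smul_zero]
  obtain ⟨n, hn⟩ := Int.eq_ofNat_of_zero_le h
  rw [hn, posCur_natCast, posCur_natCast, zpow_natCast]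
  have h1 := (isExp_expCoeff_smul (fockH_neg_commute P) a).rescale c
  have h2 : (PowerSeries.mk fun n => c ^ n • coeff n (PowerSeries.mk fun r : ℕ =>
      a r • fockH P (-(r : ℤ)))) =
        PowerSeries.mk fun r : ℕ => (c ^ r * a r) • fockH P (-(r : ℤ)) := by
    ext1 r; simp [mul_smul]
  rw [h2] at h1
  have := congrArg (coeff n) ((isExp_expCoeff_smul (fockH_neg_commute P) _).unique h1)
  simpa only [coeff_mk] using this

lemma cur_annihilation_rescale (b : ℕ → ℂ) {c : ℂ} (m : ℤ) :
    (fockPair P (fun _ => 0) fun r => c ^ r * b r).cur m =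
      c ^ m • (fockPair P (fun _ => 0) b).cur m := by
  rw [fockPair_cur_annihilation P fun _ _ => rfl, fockPair_cur_annihilation P fun _ _ => rfl]
  rcases lt_or_ge m 0 with h | h
  · rw [posCur_of_neg _ h, posCur_of_neg _ h, smul_zero]
  obtain ⟨n, rfl⟩ := Int.eq_ofNat_of_zero_le h
  rw [posCur_natCast, posCur_natCast, zpow_natCast]
  have h1 := (isExp_expCoeff_smul (h := fun r : ℕ => fockH P r) (fockH_pos_commute P) b).rescale c
  have h2 : (PowerSeries.mk fun n => c ^ n • coeff n (PowerSeries.mk fun r : ℕ =>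
      b r • fockH P r)) = PowerSeries.mk fun r : ℕ => (c ^ r * b r) • fockH P r := by
    ext1 r; simp [mul_smul]
  rw [h2] at h1
  have := congrArg (coeff n) ((isExp_expCoeff_smul (h := fun r : ℕ => fockH P r)
    (fockH_pos_commute P) _).unique h1)
  simpa only [coeff_mk] using this

/-- Both orders carry `gMixed`, expanded in `y / x` and in `x / y`, so the commutator is supported
at the poles `x = s₁^{±1} y`. At `x = s₁ y` the creation halves of `e` and `f` cancel and leave
`ψ⁺`; at `x = s₁⁻¹ y` the annihilation halves cancel and leave `ψ⁻`. -/
lemma fock_ef (hP : P.Generic) (hv : v ≠ 0) :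
    prodXY (fock P v).e (fock P v).f - prodYX (fock P v).f (fock P v).e =
      (P.κ 1)⁻¹ • (deltaYX (fock P v).C (inY ((fock P v).ψp P)) -
        deltaXY (fock P v).C (inX ((fock P v).ψm P))) := by
  have hc : (fockE P).Compatible (fockF P) := fockPair_compatible _ _ _ _ _
  have hN := hc.smooth_normal
  have hs := P.s₁_ne_zero
  have hconst : fockEConst P v * fockFConst P v *
      ((1 - P.q₂⁻¹) * (1 - P.q₃⁻¹) / (P.q₁ - 1)) = (P.κ 1)⁻¹ := by
    obtain ⟨σ, b, c, hσ, hb, hc', h1, hσ0, hb0, hc0, hprod, hb1, hc1, hr0⟩ := hP.pow_data one_pos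
    have h2 : 1 - σ ^ 2 ≠ 0 := by rw [← h1]; exact sub_ne_zero.2 (hP.q₁_pow_ne one_pos).symm
    have h3 : σ ^ 2 - 1 ≠ 0 := fun h => h2 (by linear_combination -h)
    rw [pow_one] at hσ hb hc' h1
    simp only [fockEConst, fockFConst, Params.κ, zpow_one, hσ, hb, hc', h1]
    field_simp
    linear_combination ((b - 1) * (c - 1) * (1 - σ ^ 2)) * hprod
  rw [fock_ψp, fock_ψm, fock_e, fock_f, prodXY_smul, prodYX_smul, mul_comm (fockFConst P v),
    (fockE_contracts_fockF hP).prodXY_eq hc, (fockF_contracts_fockE hP).prodYX_eq hc, ← hconst]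
  funext m n
  refine LinearMap.ext fun w => ?_
  have hplus : onLine P.s₁ ((fockE P).normal (fockF P)) m n w =
      P.s₁ ^ m • (fockPsiP P).cur (m + n) w := by
    refine onLine_fockPair P hs (fun r hr => ?_) (fun r hr => ?_) m n w
    · ring
    · obtain ⟨σ, b, c, hσ, hb, hc', h1, hσ0, hb0, hc0, hprod, hb1, hc1, hr0⟩ := hP.pow_data hr
      simp only [Params.κ, zpow_natCast, inv_pow, hσ, hb, hc', h1]
      field_simp
      linear_combination ((1 - σ ^ 2) * (b - 1) * (c - 1)) * hprod
  have hminus : onLine P.s₁⁻¹ ((fockE P).normal (fockF P)) m n w =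
      P.s₁ ^ n • (fockPsiM P).cur (m + n) w := by
    -- The result comes out in the variable `y`; the factor `s₁⁻¹ ^ r` in the exponent passes to `x
    -- = s₁⁻¹ y`, the argument of `ψ⁻`.
    have h1 : onLine P.s₁⁻¹ ((fockE P).normal (fockF P)) m n w = P.s₁⁻¹ ^ m •
        (fockPair P (fun r => P.s₁⁻¹ ^ r * P.κ r) fun _ => 0).cur (m + n) w := by
      refine onLine_fockPair P (inv_ne_zero hs) (fun r hr => ?_) (fun r hr => ?_) m n w
      · obtain ⟨σ, b, c, hσ, hb, hc', h1, hσ0, hb0, hc0, hprod, hb1, hc1, hr0⟩ := hP.pow_data hr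
        simp only [Params.κ, zpow_natCast, inv_pow, hσ, hb, hc', h1]
        field_simp
        ring
      · have h2 : P.s₁⁻¹ ^ r * P.s₁ ^ r = 1 := by rw [← mul_pow, inv_mul_cancel₀ hs, one_pow]
        rw [inv_inv]
        linear_combination (-((1 - P.q₂⁻¹ ^ r) * (1 - P.q₃⁻¹ ^ r))) * h2
    rw [h1, cur_creation_rescale, LinearMap.smul_apply, smul_smul, fockPsiM, ← zpow_add₀
      (inv_ne_zero hs), inv_zpow, ← zpow_neg]
    congr 2
    ring
  have h3 := seriesYX_sub_seriesXY hN (fun k hk => coeff_gMixed hP hk) m n w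
  rw [hplus, hminus] at h3
  simp only [Pi.smul_apply, Pi.sub_apply, LinearMap.smul_apply, LinearMap.sub_apply,
    deltaYX_inY, deltaXY_inX, coe_fock_C_zpow, Module.End.mul_apply, sca_apply]
  rw [← smul_sub, h3, smul_smul (_ * _)]

end FockRelations

/-! ### The cubic Serre identity

The contraction function `g(u) = (1 - u)(1 - p₂p₃u) / ((1 - p₂u)(1 - p₃u))` is expanded in different
regions in the six terms of the identity. A formal parameter scaling `p₂` and `p₃` makes all the
expansions elements of a single ring. -/

section SerreIdentity

variable {S : Type*} [CommRing S]

/-- A common denominator for all six orders: the missing factors `e i j`, `e i k`, `e j k` are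
inserted together with their inverses. The prefactor is then symmetric in `i, j, k`, so the Serre
identity reduces to one between polynomials. -/
lemma serre_term {a b : S} {z y : Fin 3 → S} (hzy : ∀ i, z i * y i = 1) {e : Fin 3 → Fin 3 → S}
    (he : ∀ i j, e i j * ((1 - a * (z i * y j)) * (1 - b * (z i * y j))) = 1)
    {i j k : Fin 3} (c : S) :
    c * (((1 - z k * y j) * (1 - a * b * (z k * y j)) * e k j) *
      ((1 - z j * y i) * (1 - a * b * (z j * y i)) * e j i) *
      ((1 - z k * y i) * (1 - a * b * (z k * y i)) * e k i)) =
    (e i j * e i k * e j i * e j k * e k i * e k j) * (y i * y j * y k) ^ 4 *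
      (c * (((z i - z j) * ((z i - a * b * z j) * ((z j - a * z i) * (z j - b * z i)))) *
        ((z i - z k) * ((z i - a * b * z k) * ((z k - a * z i) * (z k - b * z i)))) *
        ((z j - z k) * ((z j - a * b * z k) * ((z k - a * z j) * (z k - b * z j)))))) := by
  have h1 : ∀ l m, 1 - z l * y m = y m * (z m - z l) := fun l m => by
    linear_combination -hzy m
  have h2 : ∀ l m, 1 - a * b * (z l * y m) = y m * (z m - a * b * z l) := fun l m => by
    linear_combination -hzy m
  have h3 : ∀ l m, e l m * (y m ^ 2 * ((z m - a * z l) * (z m - b * z l))) = 1 := fun l m => by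
    have h4 : (1 - a * (z l * y m)) * (1 - b * (z l * y m)) =
        y m ^ 2 * ((z m - a * z l) * (z m - b * z l)) := by
      have h5 : ∀ d, 1 - d * (z l * y m) = y m * (z m - d * z l) := fun d => by
        linear_combination -hzy m
      rw [h5, h5]
      ring
    rw [← h4, he]
  rw [h1, h1, h1, h2, h2, h2]
  have h4 : e i j * (y j ^ 2 * ((z j - a * z i) * (z j - b * z i))) *
      (e i k * (y k ^ 2 * ((z k - a * z i) * (z k - b * z i)))) *
      (e j k * (y k ^ 2 * ((z k - a * z j) * (z k - b * z j)))) = 1 := by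
    rw [h3, h3, h3, one_mul, one_mul]
  rw [← mul_one (c * _), ← h4]
  ring

open Equiv in
lemma sum_perm_fin_three {M : Type*} [AddCommMonoid M] (f : Perm (Fin 3) → M) :
    ∑ σ, f σ = f 1 + (f (swap 0 1) + (f (swap 0 2) + (f (swap 1 2) +
      (f (swap 0 1 * swap 1 2) + f (swap 1 2 * swap 0 1))))) := by
  have h : (Finset.univ : Finset (Perm (Fin 3))) =
    {1, swap 0 1, swap 0 2, swap 1 2, swap 0 1 * swap 1 2, swap 1 2 * swap 0 1} := by decide
  rw [h, Finset.sum_insert (by decide), Finset.sum_insert (by decide),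
    Finset.sum_insert (by decide),
    Finset.sum_insert (by decide), Finset.sum_insert (by decide), Finset.sum_singleton]

lemma serre_sum {a b : S} {z y : Fin 3 → S} (hzy : ∀ i, z i * y i = 1) {e : Fin 3 → Fin 3 → S}
    (he : ∀ i j, e i j * ((1 - a * (z i * y j)) * (1 - b * (z i * y j))) = 1) :
    ∑ σ : Equiv.Perm (Fin 3),
      (z (σ 0) * z (σ 1) ^ 2 - z (σ 0) * z (σ 2) ^ 2 - z (σ 2) * z (σ 0) ^ 2 +
        z (σ 2) * z (σ 1) ^ 2) *
      (((1 - z (σ 2) * y (σ 1)) * (1 - a * b * (z (σ 2) * y (σ 1))) * e (σ 2) (σ 1)) *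
      ((1 - z (σ 1) * y (σ 0)) * (1 - a * b * (z (σ 1) * y (σ 0))) * e (σ 1) (σ 0)) *
      ((1 - z (σ 2) * y (σ 0)) * (1 - a * b * (z (σ 2) * y (σ 0))) * e (σ 2) (σ 0))) = 0 := by
  obtain ⟨φ, hφ⟩ : ∃ φ : S → S → S, ∀ x y,
    (x - a * b * y) * ((y - a * x) * (y - b * x)) = φ x y := ⟨_, fun _ _ => rfl⟩
  have hm : ∀ x y : S, φ x y =
      a * b * x ^ 3 - (a + b + (a * b) ^ 2) * x ^ 2 * y + (1 + a * b * (a + b)) * x * y ^ 2 -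
        a * b * y ^ 3 := fun x y => by rw [← hφ]; ring
  -- The Vandermonde product has been divided out, which produces the signs of the permutations.
  -- Only the shape of `φ` matters, a binary cubic with opposite outer coefficients; `p`, `A`, `B`
  -- are arbitrary.
  have key : ∀ p A B x y z : S,
      let φ : S → S → S := fun x y => p * x ^ 3 - A * x ^ 2 * y + B * x * y ^ 2 - p * y ^ 3
      let c : S → S → S → S := fun x y z => x * y ^ 2 - x * z ^ 2 - z * x ^ 2 + z * y ^ 2
      c x y z * (φ x y * φ x z * φ y z) - c y x z * (φ y x * φ y z * φ x z) -
        c x z y * (φ x z * φ x y * φ z y) - c z y x * (φ z y * φ z x * φ y x) +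
        c y z x * (φ y z * φ y x * φ z x) + c z x y * (φ z x * φ z y * φ x y) = 0 := by
    intro p A B x y z φ c
    simp only [φ, c]
    ring
  have key' := key (a * b) (a + b + (a * b) ^ 2) (1 + a * b * (a + b)) (z 0) (z 1) (z 2)
  simp only [← hm] at key'
  clear key hm
  have e1 : (Equiv.swap 0 1 : Equiv.Perm (Fin 3)) 2 = 2 := by decide
  have e2 : (Equiv.swap 0 2 : Equiv.Perm (Fin 3)) 1 = 1 := by decide
  have e3 : (Equiv.swap 1 2 : Equiv.Perm (Fin 3)) 0 = 0 := by decide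
  simp only [serre_term hzy he, sum_perm_fin_three, Equiv.Perm.mul_apply, Equiv.Perm.one_apply,
    Equiv.swap_apply_left, Equiv.swap_apply_right, e1, e2, e3, hφ]
  linear_combination ((e 0 1 * e 0 2 * e 1 0 * e 1 2 * e 2 0 * e 2 1) * (y 0 * y 1 * y 2) ^ 4 *
    ((z 0 - z 1) * (z 0 - z 2) * (z 1 - z 2))) * key'

end SerreIdentity

/-! ### The contraction function with a formal parameter -/

section ScaledSeries

open PowerSeries

variable {R : Type*} [CommRing R] [Algebra ℂ R] (p₂ p₃ : ℂ)

/-- The expansion of `(1 - u)(1 - ε²p₂p₃u) / ((1 - εp₂u)(1 - εp₃u))` in `ε`. -/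
def scaledG (u : R) : PowerSeries R :=
  (1 - C u) * (1 - C (algebraMap ℂ R (p₂ * p₃) * u) * X ^ 2) *
    PowerSeries.rescale u (PowerSeries.map (algebraMap ℂ R) (geom p₂ * geom p₃))

/-- Each coefficient in `ε` is a universal polynomial in `u`. Statements about a ratio of variables
thereby reduce to the indeterminate, where they can be compared with `gSame`. -/
lemma coeff_scaledG (u : R) (k : ℕ) : coeff k (scaledG p₂ p₃ u) =
    Polynomial.aeval u (coeff k (scaledG p₂ p₃ (Polynomial.X : Polynomial ℂ))) := by
  have h : scaledG p₂ p₃ u = PowerSeries.map (Polynomial.aeval u : Polynomial ℂ →ₐ[ℂ] R).toRingHom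
      (scaledG p₂ p₃ Polynomial.X) := by
    have h1 : PowerSeries.rescale u (PowerSeries.map (algebraMap ℂ R) (geom p₂ * geom p₃)) =
        PowerSeries.map (Polynomial.aeval u : Polynomial ℂ →ₐ[ℂ] R).toRingHom (PowerSeries.rescale
          Polynomial.X (PowerSeries.map (algebraMap ℂ (Polynomial ℂ)) (geom p₂ * geom p₃))) := by
      generalize geom p₂ * geom p₃ = H
      ext n
      simp only [coeff_rescale, coeff_map]
      simp [mul_comm (u ^ n)]
    rw [scaledG, h1, scaledG]
    simp
  rw [h, coeff_map]
  rfl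

lemma scaledG_X : scaledG p₂ p₃ (Polynomial.X : Polynomial ℂ) =
    C (1 - Polynomial.X) * (PowerSeries.rescale Polynomial.X
        (PowerSeries.map (algebraMap ℂ (Polynomial ℂ)) (geom p₂ * geom p₃)) -
      C (Polynomial.C (p₂ * p₃) * Polynomial.X) * (X ^ 2 * PowerSeries.rescale Polynomial.X
        (PowerSeries.map (algebraMap ℂ (Polynomial ℂ)) (geom p₂ * geom p₃)))) := by
  rw [scaledG, map_sub, map_one, Polynomial.algebraMap_eq]
  ring

/-- The geometric part has equal powers of `ε` and `u`, and the numerator contributes at most one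
unmatched `ε`, through `ε² p₂ p₃ u`. So high powers of `ε` carry high powers of `u`. -/
lemma X_pow_dvd_coeff_scaledG (k : ℕ) :
    Polynomial.X ^ k ∣ coeff (k + 1) (scaledG p₂ p₃ (Polynomial.X : Polynomial ℂ)) := by
  rw [scaledG_X, coeff_C_mul, map_sub, coeff_C_mul, coeff_rescale]
  refine Dvd.dvd.mul_left (dvd_sub ((pow_dvd_pow _ k.le_succ).trans (dvd_mul_right _ _)) ?_) _
  rcases k with _ | k
  · simp
  · rw [show k + 1 + 1 = k + 2 from rfl, coeff_X_pow_mul, coeff_rescale, mul_assoc, pow_succ']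
    exact Dvd.dvd.mul_left (mul_dvd_mul_left _ (dvd_mul_right _ _)) _

/-- Summing over the powers of `ε` sets `ε = 1`. The factor `ε²` shortens one of the sums by two
terms, hence the range `K + 2` for degrees below `K`. -/
lemma coeff_sum_scaledG {j K : ℕ} (hj : j < K) :
    (∑ k ∈ Finset.range (K + 2),
      coeff k (scaledG p₂ p₃ (Polynomial.X : Polynomial ℂ))).coeff j =
    coeff j (gSame p₂ p₃) := by
  rw [scaledG_X, gSame]
  generalize geom p₂ * geom p₃ = H
  set F := PowerSeries.rescale (Polynomial.X : Polynomial ℂ)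
    (PowerSeries.map (algebraMap ℂ (Polynomial ℂ)) H) with hF
  have h1 : ∀ n i, i < n → (∑ k ∈ Finset.range n, coeff k F).coeff i = coeff i H := by
    intro n i hi
    rw [Polynomial.finsetSum_coeff, Finset.sum_eq_single i]
    · simp [hF, coeff_rescale]
    · intro k _ hk
      rw [hF, coeff_rescale, coeff_map, Polynomial.algebraMap_eq, mul_comm, Polynomial.coeff_C_mul,
        Polynomial.coeff_X_pow, if_neg hk.symm, mul_zero]
    · intro h
      exact absurd (Finset.mem_range.2 hi) h
  have h2 : ∑ k ∈ Finset.range (K + 2), coeff k (X ^ 2 * F) =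
      ∑ k ∈ Finset.range K, coeff k F := by
    rw [Finset.sum_range_succ', Finset.sum_range_succ']
    simp [coeff_X_pow_mul']
  simp only [coeff_C_mul, map_sub (coeff _), ← Finset.mul_sum, Finset.sum_sub_distrib, h2]
  set S := ∑ k ∈ Finset.range (K + 2), coeff k F
  set S' := ∑ k ∈ Finset.range K, coeff k F
  have h3 : (1 - Polynomial.X) * (S - Polynomial.C (p₂ * p₃) * Polynomial.X * S') =
      S - Polynomial.X * S - Polynomial.C (p₂ * p₃) * (Polynomial.X * S') +
        Polynomial.C (p₂ * p₃) * (Polynomial.X * (Polynomial.X * S')) := by ring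
  have h4 : (1 - C 1 * X) * (1 - C (p₂ * p₃) * X) * H =
      H - X * H - C (p₂ * p₃) * (X * H) + C (p₂ * p₃) * (X * (X * H)) := by
    rw [map_one]; ring
  rw [h3, h4]
  simp only [Polynomial.coeff_add, Polynomial.coeff_sub, Polynomial.coeff_C_mul, map_add, map_sub,
    coeff_C_mul]
  rcases j with _ | _ | j
  · simp [S, h1]
  · simp [S, S', h1 _ _ (show 0 < K by omega), h1, coeff_succ_X_mul, Polynomial.coeff_X_mul]
  · simp only [Polynomial.coeff_X_mul, coeff_succ_X_mul]
    rw [h1 _ _ (by omega), h1 _ _ (by omega), h1 _ _ (by omega), h1 _ _ (by omega)]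

/-- A functional on products of powers of three elements that vanishes on high powers. -/
structure Vanishes {W : Type*} [AddCommGroup W] [Module ℂ W] (Λ : R →ₗ[ℂ] W) (c x y w : R)
    (L : ℕ) : Prop where
  eq_zero : ∀ u s t : ℕ, L ≤ u ∨ L ≤ s ∨ L ≤ t → Λ (c * (x ^ u * y ^ s * w ^ t)) = 0

variable {W : Type*} [AddCommGroup W] [Module ℂ W] {Λ : R →ₗ[ℂ] W} {c x y w : R} {L : ℕ}

lemma aeval_triple_eq_sum (Λ : R →ₗ[ℂ] W) (c x y w : R) {a b d : Polynomial ℂ} {D : ℕ}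
    (ha : a.natDegree < D) (hb : b.natDegree < D) (hd : d.natDegree < D) :
    Λ (c * (Polynomial.aeval x a * Polynomial.aeval y b * Polynomial.aeval w d)) =
      ∑ u ∈ Finset.range D, ∑ s ∈ Finset.range D, ∑ t ∈ Finset.range D,
        (a.coeff u * b.coeff s * d.coeff t) • Λ (c * (x ^ u * y ^ s * w ^ t)) := by
  rw [Polynomial.aeval_eq_sum_range' ha, Polynomial.aeval_eq_sum_range' hb,
    Polynomial.aeval_eq_sum_range' hd]
  rw [Finset.sum_mul_sum, Finset.sum_mul, Finset.mul_sum, map_sum]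
  refine Finset.sum_congr rfl fun u _ => ?_
  rw [Finset.sum_mul, Finset.mul_sum, map_sum]
  refine Finset.sum_congr rfl fun s _ => ?_
  rw [Finset.mul_sum, Finset.mul_sum, map_sum]
  refine Finset.sum_congr rfl fun t _ => ?_
  simp only [smul_mul_assoc, mul_smul_comm, map_smul, smul_smul]
  congr 1
  ring

lemma Vanishes.aeval_congr (h : Vanishes Λ c x y w L) {a b d a' b' d' : Polynomial ℂ}
    (ha : ∀ j < L, a.coeff j = a'.coeff j) (hb : ∀ j < L, b.coeff j = b'.coeff j)
    (hd : ∀ j < L, d.coeff j = d'.coeff j) :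
    Λ (c * (Polynomial.aeval x a * Polynomial.aeval y b * Polynomial.aeval w d)) =
      Λ (c * (Polynomial.aeval x a' * Polynomial.aeval y b' * Polynomial.aeval w d')) := by
  obtain ⟨D, hD⟩ : ∃ D, ∀ q ∈ [a, b, d, a', b', d'], q.natDegree < D :=
    ⟨a.natDegree + b.natDegree + d.natDegree + a'.natDegree + b'.natDegree + d'.natDegree + 1, by
      simp; omega⟩
  simp only [List.mem_cons, List.not_mem_nil, or_false, forall_eq_or_imp, forall_eq] at hD
  obtain ⟨h1, h2, h3, h4, h5, h6⟩ := hD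
  rw [aeval_triple_eq_sum Λ c x y w h1 h2 h3, aeval_triple_eq_sum Λ c x y w h4 h5 h6]
  refine Finset.sum_congr rfl fun u _ => Finset.sum_congr rfl fun s _ =>
    Finset.sum_congr rfl fun t _ => ?_
  by_cases hlt : u < L ∧ s < L ∧ t < L
  · rw [ha u hlt.1, hb s hlt.2.1, hd t hlt.2.2]
  · rw [h.eq_zero u s t (by omega), smul_zero, smul_zero]

/-- Setting the scaling parameter to `1`. -/
lemma Vanishes.sum_coeff_scaledG (h : Vanishes Λ c x y w L) {K : ℕ} (hK : 3 * (L + 2) < K) :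
    ∑ k ∈ Finset.range K, Λ (coeff k
      (C c * (scaledG p₂ p₃ x * scaledG p₂ p₃ y * scaledG p₂ p₃ w))) =
    Λ (c * (Polynomial.aeval x (trunc L (gSame p₂ p₃)) *
      Polynomial.aeval y (trunc L (gSame p₂ p₃)) * Polynomial.aeval w (trunc L (gSame p₂ p₃)))) := by
  set A : R → Polynomial R := fun u => trunc (L + 2) (scaledG p₂ p₃ u) with hA
  -- Powers of `ε` from `L + 2` on carry only powers of `u` that `Λ` does not see, so truncation in
  -- `ε` is harmless and leaves a polynomial to evaluate at `1`.
  have hlow : ∀ k, L + 2 ≤ k → ∀ j < L,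
      (coeff k (scaledG p₂ p₃ (Polynomial.X : Polynomial ℂ))).coeff j = 0 := fun k hk j hj => by
    obtain ⟨k, rfl⟩ := Nat.exists_eq_add_of_le' (show 1 ≤ k by omega)
    exact Polynomial.X_pow_dvd_iff.1 (X_pow_dvd_coeff_scaledG p₂ p₃ k) j (by omega)
  have h1 : ∀ k, Λ (coeff k (C c * (scaledG p₂ p₃ x * scaledG p₂ p₃ y * scaledG p₂ p₃ w))) =
      Λ ((Polynomial.C c * (A x * A y * A w)).coeff k) := fun k => by
    rw [coeff_C_mul, Polynomial.coeff_C_mul, coeff_mul, Polynomial.coeff_mul]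
    simp only [coeff_mul, Polynomial.coeff_mul, Finset.sum_mul, Finset.mul_sum, map_sum]
    refine Finset.sum_congr rfl fun p _ => Finset.sum_congr rfl fun q _ => ?_
    simp only [hA, coeff_trunc, coeff_scaledG p₂ p₃ x, coeff_scaledG p₂ p₃ y, coeff_scaledG p₂ p₃ w]
    by_cases hlt : q.1 < L + 2 ∧ q.2 < L + 2 ∧ p.2 < L + 2
    · rw [if_pos hlt.1, if_pos hlt.2.1, if_pos hlt.2.2]
    · have h3 : Λ (c * ((if q.1 < L + 2 then Polynomial.aeval x
          (coeff q.1 (scaledG p₂ p₃ (Polynomial.X : Polynomial ℂ))) else 0) *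
          (if q.2 < L + 2 then Polynomial.aeval y
          (coeff q.2 (scaledG p₂ p₃ (Polynomial.X : Polynomial ℂ))) else 0) *
          (if p.2 < L + 2 then Polynomial.aeval w
          (coeff p.2 (scaledG p₂ p₃ (Polynomial.X : Polynomial ℂ))) else 0))) = 0 := by
        simp only [not_and_or] at hlt
        rcases hlt with h0 | h0 | h0 <;> simp [h0]
      rw [h3]
      simp only [not_and_or, not_lt] at hlt
      rcases hlt with h0 | h0 | h0
      · rw [h.aeval_congr (a' := 0) (by simpa using hlow _ h0) (fun _ _ => rfl) (fun _ _ => rfl)]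
        simp
      · rw [h.aeval_congr (b' := 0) (fun _ _ => rfl) (by simpa using hlow _ h0) (fun _ _ => rfl)]
        simp
      · rw [h.aeval_congr (d' := 0) (fun _ _ => rfl) (fun _ _ => rfl) (by simpa using hlow _ h0)]
        simp
  have h2 : ∀ u : R, (A u).eval 1 = Polynomial.aeval u (∑ k ∈ Finset.range (L + 2),
      coeff k (scaledG p₂ p₃ (Polynomial.X : Polynomial ℂ))) := fun u => by
    rw [Polynomial.eval_eq_sum_range' (natDegree_trunc_lt _ (L + 1)), map_sum]
    refine Finset.sum_congr rfl fun k hk => ?_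
    rw [coeff_trunc, if_pos (Finset.mem_range.1 hk), coeff_scaledG, one_pow, mul_one]
  have hdeg : (Polynomial.C c * (A x * A y * A w)).natDegree < K := by
    have hd : ∀ u, (A u).natDegree < L + 2 := fun u => natDegree_trunc_lt _ (L + 1)
    have e1 := Polynomial.natDegree_C_mul_le c (A x * A y * A w)
    have e2 := Polynomial.natDegree_mul_le (p := A x * A y) (q := A w)
    have e3 := Polynomial.natDegree_mul_le (p := A x) (q := A y)
    have := hd x
    have := hd y
    have := hd w
    omega
  have h4 := Polynomial.eval_eq_sum_range' hdeg 1
  simp only [h1, ← map_sum]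
  have h5 : ∑ k ∈ Finset.range K, (Polynomial.C c * (A x * A y * A w)).coeff k =
      (Polynomial.C c * (A x * A y * A w)).eval 1 := by
    rw [h4]; simp
  rw [h5, Polynomial.eval_C_mul, Polynomial.eval_mul, Polynomial.eval_mul, h2, h2, h2]
  have h6 : ∀ j < L, (∑ k ∈ Finset.range (L + 2),
      coeff k (scaledG p₂ p₃ (Polynomial.X : Polynomial ℂ))).coeff j =
      (trunc L (gSame p₂ p₃)).coeff j := fun j hj => by
    rw [coeff_sum_scaledG p₂ p₃ hj, coeff_trunc, if_pos hj]
  exact h.aeval_congr h6 h6 h6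

end ScaledSeries

/-! ### The Serre relations for vertex operators -/

section

variable {W : Type*} [AddCommGroup W] [Module ℂ W]

/-- Exchanges triangular and square truncations when `f` vanishes wherever they differ. -/
lemma sum_range_antidiagonal {M : Type*} [AddCommMonoid M] {f : ℕ → ℕ → M} {K L : ℕ}
    (hf : ∀ s t, (s + t < K ↔ s < L ∧ t < L) ∨ f s t = 0) :
    ∑ k ∈ Finset.range K, ∑ p ∈ Finset.HasAntidiagonal.antidiagonal k, f p.1 p.2 =
      ∑ s ∈ Finset.range L, ∑ t ∈ Finset.range L, f s t := by
  rw [← Finset.sum_product' (f := f), Finset.sum_sigma']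
  have h : ∑ x ∈ (Finset.range K).sigma fun k => Finset.HasAntidiagonal.antidiagonal k,
      f x.2.1 x.2.2 =
      ∑ p ∈ (Finset.range K ×ˢ Finset.range K).filter (fun p => p.1 + p.2 < K), f p.1 p.2 := by
    refine Finset.sum_nbij' (fun x => x.2) (fun p => ⟨p.1 + p.2, p⟩) ?_ ?_ ?_ ?_ ?_
    · rintro ⟨k, p⟩ h
      simp only [Finset.mem_sigma, Finset.mem_range, Finset.HasAntidiagonal.mem_antidiagonal,
        Finset.mem_filter,
        Finset.mem_product] at h ⊢
      omega
    · intro p h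
      simp only [Finset.mem_sigma, Finset.mem_range, Finset.HasAntidiagonal.mem_antidiagonal,
        Finset.mem_filter] at h ⊢
      exact ⟨h.2, trivial⟩
    · rintro ⟨k, p⟩ h
      simp only [Finset.mem_sigma, Finset.mem_range, Finset.HasAntidiagonal.mem_antidiagonal] at h
      obtain ⟨-, rfl⟩ := h
      rfl
    · intro p _
      rfl
    · intro x _
      rfl
  rw [h]
  refine Finset.sum_congr_of_eq_on_inter ?_ ?_ fun _ _ _ => rfl
  · rintro ⟨s, t⟩ h1 h2
    simp only [Finset.mem_range, Finset.mem_filter, Finset.mem_product] at h1 h2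
    exact (hf s t).resolve_left fun h3 => h2 (h3.1 h1.2)
  · rintro ⟨s, t⟩ h1 h2
    simp only [Finset.mem_range, Finset.mem_filter, Finset.mem_product] at h1 h2
    exact (hf s t).resolve_left fun h3 => h2 ⟨by have := h3.2 h1; omega, h3.2 h1⟩

namespace VertexPair

variable (V : VertexPair W)

/-- The normally ordered product of three copies of a vertex operator. -/
def normal₃ (a b c : ℤ) : End ℂ W := V.dress a (V.normal V b c)

lemma dress_sum {ι : Type*} (s : Finset ι) (m : ℤ) (T : ι → End ℂ W) :
    V.dress m (∑ i ∈ s, T i) = ∑ i ∈ s, V.dress m (T i) := by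
  ext w
  simp only [dress_apply, LinearMap.sum_apply, map_sum]
  exact finsum_sum_comm s _ fun i _ => V.dress_support m (T i) w

variable {V}

lemma normal₃_swap₀₁ (hc : Compatible V V) (a b c : ℤ) : V.normal₃ a b c = V.normal₃ b a c :=
  hc.dress_comm _ _ _

lemma normal₃_swap₁₂ (hc : Compatible V V) (a b c : ℤ) : V.normal₃ a b c = V.normal₃ a c b :=
  congrArg (V.dress a) (hc.normal_comm b c)

lemma normal₃_perm (hc : Compatible V V) (m : Fin 3 → ℤ) (σ : Equiv.Perm (Fin 3)) :
    V.normal₃ (m (σ 0)) (m (σ 1)) (m (σ 2)) = V.normal₃ (m 0) (m 1) (m 2) := by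
  have h : ∀ σ : Equiv.Perm (Fin 3), (σ 0 = 0 ∧ σ 1 = 1 ∧ σ 2 = 2) ∨
      (σ 0 = 0 ∧ σ 1 = 2 ∧ σ 2 = 1) ∨ (σ 0 = 1 ∧ σ 1 = 0 ∧ σ 2 = 2) ∨
      (σ 0 = 1 ∧ σ 1 = 2 ∧ σ 2 = 0) ∨ (σ 0 = 2 ∧ σ 1 = 0 ∧ σ 2 = 1) ∨
      (σ 0 = 2 ∧ σ 1 = 1 ∧ σ 2 = 0) := by decide
  rcases h σ with ⟨h0, h1, h2⟩ | ⟨h0, h1, h2⟩ | ⟨h0, h1, h2⟩ | ⟨h0, h1, h2⟩ | ⟨h0, h1, h2⟩ |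
    ⟨h0, h1, h2⟩ <;> rw [h0, h1, h2]
  · rw [normal₃_swap₁₂ hc]
  · rw [normal₃_swap₀₁ hc]
  · rw [normal₃_swap₁₂ hc, normal₃_swap₀₁ hc]
  · rw [normal₃_swap₀₁ hc, normal₃_swap₁₂ hc]
  · rw [normal₃_swap₀₁ hc, normal₃_swap₁₂ hc, normal₃_swap₀₁ hc]

lemma exists_normal₃_eq_zero (hc : Compatible V V) (w : W) :
    ∃ M : ℤ, ∀ a b c, M < a ∨ M < b ∨ M < c → V.normal₃ a b c w = 0 := by
  obtain ⟨M, hM⟩ := V.smooth w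
  have h : ∀ a b c, M < a → V.normal₃ a b c w = 0 := fun a b c ha =>
    dress_eq_zero_of_lt _ _ hM ha
  refine ⟨M, fun a b c habc => ?_⟩
  rcases habc with ha | hb | hc'
  · exact h _ _ _ ha
  · rw [normal₃_swap₀₁ hc, h _ _ _ hb]
  · rw [normal₃_swap₁₂ hc, normal₃_swap₀₁ hc, h _ _ _ hc']

/-- The annihilation half is contracted once with each of the two creation halves. -/
lemma Contracts.B_mul_normal {g : PowerSeries ℂ} (hg : Contracts V V g) (hc : Compatible V V)
    {p : ℤ} {L : ℕ} (hL : p < L) (b c : ℤ) : V.B p * V.normal V b c =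
    ∑ k ∈ Finset.range L, (∑ q ∈ Finset.HasAntidiagonal.antidiagonal k,
      (PowerSeries.coeff q.1 g * PowerSeries.coeff q.2 g) • V.normal V (b + q.1) (c + q.2)) *
        V.B (p - k) := by
  rw [normal, hg.B_mul_dress hL]
  have h1 : ∀ s : ℕ, V.dress (b + s) (V.B (p - s) * V.cur c) = ∑ t ∈ Finset.range L,
      PowerSeries.coeff t g • (V.normal V (b + s) (c + t) * V.B (p - s - t)) := fun s => by
    rw [hg.B_mul_cur hc (show p - s < L by omega), dress_sum]
    refine Finset.sum_congr rfl fun t _ => ?_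
    rw [smul_mul_assoc, dress_smul, V.dress_mul fun n => hc.B_comm _ _]
    rfl
  have h2 := sum_range_antidiagonal (K := L) (L := L) (f := fun s t =>
    (PowerSeries.coeff s g * PowerSeries.coeff t g) •
      (V.normal V (b + s) (c + t) * V.B (p - s - t))) fun s t => by
    by_cases h : s + t < L
    · exact Or.inl (by omega)
    · exact Or.inr (by rw [V.B_neg _ (by omega), mul_zero, smul_zero])
  simp only [h1, Finset.smul_sum, smul_smul]
  rw [← h2]
  refine Finset.sum_congr rfl fun k _ => ?_
  rw [Finset.sum_mul]
  refine Finset.sum_congr rfl fun q hq => ?_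
  rw [← Finset.HasAntidiagonal.mem_antidiagonal.1 hq, smul_mul_assoc]
  congr 3
  push_cast
  ring

/-- Wick's theorem for three factors: `u`, `s`, `t` are the exponents in the contractions of the
pairs `(b, c)`, `(a, b)`, `(a, c)`. -/
lemma Contracts.cur_triple {g : PowerSeries ℂ} (hg : Contracts V V g) (hc : Compatible V V)
    (a b c : ℤ) (w : W) : ∃ L₀ : ℕ, ∀ L ≥ L₀, V.cur a (V.cur b (V.cur c w)) =
      ∑ u ∈ Finset.range L, ∑ s ∈ Finset.range L, ∑ t ∈ Finset.range L,
        (PowerSeries.coeff u g * PowerSeries.coeff s g * PowerSeries.coeff t g) •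
          V.normal₃ (a - s - t) (b - u + s) (c + u + t) w := by
  obtain ⟨M, hM⟩ := V.smooth w
  have hN : ∀ m n, M < m ∨ M < n → ∀ q, V.normal V m n (V.B q w) = 0 := by
    have h : ∀ m n, M < m → ∀ q, V.normal V m n (V.B q w) = 0 := fun m n hm q => by
      rw [normal, ← Module.End.mul_apply, ← V.dress_mul fun n => hc.B_comm _ _]
      exact dress_eq_zero_of_lt _ _ hM hm
    rintro m n (hm | hn) q
    · exact h m n hm q
    · rw [hc.normal_comm, h n m hn q]
  -- If `u ≥ L` or `t ≥ L`, the last index `c + u + t` exceeds `M`. If `s ≥ L`, the last two indices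
  -- sum to more than `2 * M`, so one of them exceeds `M`.
  refine ⟨(M - c).toNat + (2 * M - b - c).toNat + 1, fun L hL => ?_⟩
  have h1 : V.cur b (V.cur c w) = ∑ u ∈ Finset.range L, PowerSeries.coeff u g •
      V.normal V (b - u) (c + u) w := by
    rw [← Module.End.mul_apply]
    change prodXY V.cur V.cur b c w = _
    rw [hg.prodXY_eq hc]
    refine seriesYX_apply hc.smooth_normal _ (fun m' n' h => ?_) _
    rw [hc.normal_comm]
    exact dress_eq_zero_of_lt _ _ hM (by omega)
  rw [h1, map_sum]
  refine Finset.sum_congr rfl fun u _ => ?_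
  have hST : ∀ s t : ℕ, L ≤ s ∨ L ≤ t → ∀ q,
      V.normal V (b - u + s) (c + u + t) (V.B q w) = 0 := fun s t hst => hN _ _ (by omega)
  have h2 := cur_mul_apply (V := V) (T := V.normal V (b - u) (c + u))
    (fun p L hp => hg.B_mul_normal hc hp (b - u) (c + u)) (w := w) (L := 2 * L) (fun k hk q => by
      rw [LinearMap.sum_apply]
      refine Finset.sum_eq_zero fun x hx => ?_
      rw [LinearMap.smul_apply, hST, smul_zero]
      have := Finset.HasAntidiagonal.mem_antidiagonal.1 hx
      omega) a
  have h3 := sum_range_antidiagonal (K := 2 * L) (L := L) (f := fun s t =>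
    (PowerSeries.coeff s g * PowerSeries.coeff t g) •
      V.normal₃ (a - s - t) (b - u + s) (c + u + t) w) fun s t => by
    by_cases h : s < L ∧ t < L
    · exact Or.inl (by omega)
    · refine Or.inr ?_
      rw [normal₃, V.dress_eq_zero fun q => hST s t (by omega) q, smul_zero]
  rw [map_smul, h2]
  simp only [mul_assoc, mul_smul, ← Finset.smul_sum] at h3 ⊢
  rw [← h3]
  congr 1
  refine Finset.sum_congr rfl fun k _ => ?_
  rw [dress_sum, LinearMap.sum_apply]
  refine Finset.sum_congr rfl fun x hx => ?_
  rw [dress_smul, dress_smul, LinearMap.smul_apply, LinearMap.smul_apply,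
    ← Finset.HasAntidiagonal.mem_antidiagonal.1 hx, Nat.cast_add, ← sub_sub]
  rfl

end VertexPair

end

/-! ### From Laurent polynomials to the Serre relation -/

section SerreFunctional

open PowerSeries VertexPair

variable {W : Type*} [AddCommGroup W] [Module ℂ W] {V : VertexPair W}

/-- Laurent polynomials in three variables. -/
abbrev Laurent₃ := AddMonoidAlgebra ℂ (Fin 3 → ℤ)

/-- The monomial with exponents `n`. -/
def mono (n : Fin 3 → ℤ) : Laurent₃ := AddMonoidAlgebra.single n 1

lemma mono_mul (m n : Fin 3 → ℤ) : mono m * mono n = mono (m + n) := by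
  rw [mono, mono, AddMonoidAlgebra.single_mul_single, one_mul, mono]

lemma mono_pow (m : Fin 3 → ℤ) (k : ℕ) : mono m ^ k = mono (k • m) := by
  rw [mono, AddMonoidAlgebra.single_pow, one_pow, mono]

lemma mono_zero : mono 0 = 1 := rfl

/-- The ratio of two variables. -/
def ratio (i j : Fin 3) : Laurent₃ := mono (Pi.single i 1) * mono (-Pi.single j 1)

variable (V) in
/-- The functional `z^n ↦ N_n w`, where `N_n` are the coefficients of the normally ordered
product. -/
def functional (w : W) : Laurent₃ →ₗ[ℂ] W :=
  (Finsupp.linearCombination ℂ fun n : Fin 3 → ℤ => V.normal₃ (n 0) (n 1) (n 2) w) ∘ₗ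
    (AddMonoidAlgebra.coeffLinearEquiv ℂ).toLinearMap

lemma functional_mono (w : W) (n : Fin 3 → ℤ) :
    functional V w (mono n) = V.normal₃ (n 0) (n 1) (n 2) w := by
  simp [functional, mono]

/-- Since the normally ordered coefficients are symmetric, one functional serves all six orders of
the factors. -/
lemma functional_ratio (hc : Compatible V V) (w : W) (n : Fin 3 → ℤ) (σ : Equiv.Perm (Fin 3))
    (u s t : ℕ) : functional V w (mono n * (ratio (σ 2) (σ 1) ^ u * ratio (σ 1) (σ 0) ^ s *
      ratio (σ 2) (σ 0) ^ t)) =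
    V.normal₃ (n (σ 0) - s - t) (n (σ 1) - u + s) (n (σ 2) + u + t) w := by
  simp only [ratio, mono_mul, mono_pow]
  rw [functional_mono, ← normal₃_perm hc _ σ]
  congr 2 <;> simp [σ.injective.eq_iff] <;> ring

lemma exists_vanishes (hc : Compatible V V) (w : W) (n : Fin 3 → ℤ) :
    ∃ L₀ : ℕ, ∀ L ≥ L₀, ∀ σ : Equiv.Perm (Fin 3),
      Vanishes (functional V w) (mono n) (ratio (σ 2) (σ 1)) (ratio (σ 1) (σ 0))
        (ratio (σ 2) (σ 0)) L := by
  obtain ⟨M, hM⟩ := exists_normal₃_eq_zero hc w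
  -- A large `u` or `t` raises the last index and a large `s` raises the sum of the last two. The
  -- sum of the absolute values bounds every `M - n i`, and it is taken twice because two indices
  -- may share the excess.
  refine ⟨(∑ i, |M - n i|).toNat + (∑ i, |M - n i|).toNat + 1, fun L hL σ =>
    ⟨fun u s t hust => ?_⟩⟩
  have h : ∀ i, M - n i ≤ (∑ i, |M - n i|).toNat := fun i =>
    ((le_abs_self _).trans (Finset.single_le_sum (f := fun i => |M - n i|)
      (fun i _ => abs_nonneg _) (Finset.mem_univ i))).trans (Int.self_le_toNat _)
  rw [functional_ratio hc]
  refine hM _ _ _ ?_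
  have h1 := h (σ 1)
  have h2 := h (σ 2)
  omega

lemma cur_triple_eq (hc : Compatible V V) {g : PowerSeries ℂ} (hg : V.Contracts V g) (w : W)
    (n : Fin 3 → ℤ) : ∃ L₀ : ℕ, ∀ L ≥ L₀, ∀ σ : Equiv.Perm (Fin 3),
      functional V w (mono n * (Polynomial.aeval (ratio (σ 2) (σ 1)) (trunc L g) *
        Polynomial.aeval (ratio (σ 1) (σ 0)) (trunc L g) *
        Polynomial.aeval (ratio (σ 2) (σ 0)) (trunc L g))) =
      V.cur (n (σ 0)) (V.cur (n (σ 1)) (V.cur (n (σ 2)) w)) := by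
  choose L₀ hL₀ using fun σ : Equiv.Perm (Fin 3) =>
    hg.cur_triple hc (n (σ 0)) (n (σ 1)) (n (σ 2)) w
  refine ⟨∑ σ, L₀ σ + 1, fun L hL σ => ?_⟩
  have h1 := Finset.single_le_sum (f := L₀) (fun i _ => Nat.zero_le _) (Finset.mem_univ σ)
  obtain ⟨L, rfl⟩ := Nat.exists_eq_add_of_le' (show 1 ≤ L by omega)
  rw [aeval_triple_eq_sum _ _ _ _ _ (natDegree_trunc_lt g L) (natDegree_trunc_lt g L)
    (natDegree_trunc_lt g L), hL₀ σ (L + 1) (by omega)]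
  refine Finset.sum_congr rfl fun u hu => Finset.sum_congr rfl fun s hs =>
    Finset.sum_congr rfl fun t ht => ?_
  rw [Finset.mem_range] at hu hs ht
  rw [functional_ratio hc, coeff_trunc, coeff_trunc, coeff_trunc, if_pos hu, if_pos hs, if_pos ht]

/-- The monomials `z₁z₂² - z₁z₃² - z₃z₁² + z₃z₂²` of the Serre relation, permuted by `σ`. -/
def serreCoeff (σ : Equiv.Perm (Fin 3)) : Laurent₃ :=
  let z : Fin 3 → Laurent₃ := fun i => mono (Pi.single i 1)
  z (σ 0) * z (σ 1) ^ 2 - z (σ 0) * z (σ 2) ^ 2 - z (σ 2) * z (σ 0) ^ 2 + z (σ 2) * z (σ 1) ^ 2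

/-- In power series in `ε` over Laurent polynomials all the denominators `(1 - ε p₂ z_i / z_j)(1 - ε
p₃ z_i / z_j)` are invertible, so `serre_sum` applies to the six expansions at once. -/
lemma sum_serreCoeff_scaledG (p₂ p₃ : ℂ) : ∑ σ : Equiv.Perm (Fin 3),
    C (serreCoeff σ) * (scaledG p₂ p₃ (ratio (σ 2) (σ 1)) * scaledG p₂ p₃ (ratio (σ 1) (σ 0)) *
      scaledG p₂ p₃ (ratio (σ 2) (σ 0))) = 0 := by
  have h1 := serre_sum (S := PowerSeries Laurent₃) (a := C (algebraMap ℂ _ p₂) * X)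
    (b := C (algebraMap ℂ _ p₃) * X)
    (z := fun i => C (mono (Pi.single i 1))) (y := fun i => C (mono (-Pi.single i 1)))
    (fun i => by rw [← map_mul, mono_mul, add_neg_cancel, mono_zero, map_one])
    (e := fun i j => PowerSeries.rescale (ratio i j)
      (PowerSeries.map (algebraMap ℂ _) (geom p₂ * geom p₃))) (fun i j => by
      have h2 : (geom p₂ * geom p₃) * ((1 - C p₂ * X) * (1 - C p₃ * X)) = 1 := by
        linear_combination ((1 - C p₃ * X) * geom p₃) * one_sub_mul_geom p₂ + one_sub_mul_geom p₃
      have h3 := congrArg (fun f => PowerSeries.rescale (ratio i j)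
        (PowerSeries.map (algebraMap ℂ Laurent₃) f)) h2
      simp only [map_mul, map_sub, map_one, map_X, rescale_X, map_C, ratio] at h3 ⊢
      have hC : ∀ r x : Laurent₃, PowerSeries.rescale r (C x) = C x := fun r x => by
        ext k
        rcases k with _ | k <;> simp [coeff_rescale, coeff_C]
      rw [hC, hC] at h3
      refine Eq.trans ?_ h3
      ring)
  rw [← h1]
  refine Finset.sum_congr rfl fun σ _ => ?_
  simp only [serreCoeff, scaledG, ratio, map_add, map_sub, map_mul, map_pow]
  ring

/-- Once the commutators are expanded and regrouped by the order of the factors, the product in the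
order `σ` has coefficient `serreCoeff σ`. The sum over `σ` is zero in each degree in `ε`, before the
functional is applied. -/
lemma serre_of_contracts (hc : Compatible V V) {p₂ p₃ : ℂ} (hg : V.Contracts V (gSame p₂ p₃))
    (n : Fin 3 → ℤ) : ∑ σ : Equiv.Perm (Fin 3),
      ⁅V.cur (n (σ 0) + 1), ⁅V.cur (n (σ 1) + 2), V.cur (n (σ 2))⁆⁆ = 0 := by
  refine LinearMap.ext fun w => ?_
  rw [LinearMap.sum_apply, LinearMap.zero_apply]
  set δ : Fin 3 → Fin 3 → ℤ := fun i => Pi.single i 1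
  have hδ : ∀ (σ : Equiv.Perm (Fin 3)) (i j : Fin 3), δ (σ i) (σ j) = if j = i then 1 else 0 :=
    fun σ i j => by simp [δ, Pi.single_apply, σ.injective.eq_iff]
  have hs₀₁ : (Equiv.swap 0 1 : Equiv.Perm (Fin 3)) 2 = 2 := by decide
  have hs₀₂ : (Equiv.swap 0 2 : Equiv.Perm (Fin 3)) 1 = 1 := by decide
  have hs₁₂ : (Equiv.swap 1 2 : Equiv.Perm (Fin 3)) 0 = 0 := by decide
  set T : (Fin 3 → ℤ) → Equiv.Perm (Fin 3) → W := fun m σ =>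
    V.cur (m (σ 0)) (V.cur (m (σ 1)) (V.cur (m (σ 2)) w)) with hT
  obtain ⟨m, hm⟩ : ∃ m : Fin 3 → Fin 3 → Fin 3 → ℤ, ∀ i j, m i j = n + (δ i + 2 • δ j) :=
    ⟨_, fun _ _ => rfl⟩
  have h1 : ∀ σ : Equiv.Perm (Fin 3),
      ⁅V.cur (n (σ 0) + 1), ⁅V.cur (n (σ 1) + 2), V.cur (n (σ 2))⁆⁆ w =
      T (m (σ 0) (σ 1)) σ - T (m (σ 0) (σ 1)) (σ * Equiv.swap 1 2) -
        T (m (σ 0) (σ 1)) (σ * (Equiv.swap 0 1 * Equiv.swap 1 2)) +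
        T (m (σ 0) (σ 1)) (σ * Equiv.swap 0 2) := fun σ => by
    have e0 : m (σ 0) (σ 1) (σ 0) = n (σ 0) + 1 := by simp [hm, hδ]
    have e1 : m (σ 0) (σ 1) (σ 1) = n (σ 1) + 2 := by simp [hm, hδ]
    have e2 : m (σ 0) (σ 1) (σ 2) = n (σ 2) := by simp [hm, hδ]
    simp only [hT, Equiv.Perm.mul_apply, Equiv.swap_apply_left, Equiv.swap_apply_right, hs₀₁, hs₀₂,
      hs₁₂, e0, e1, e2, Ring.lie_def, LinearMap.sub_apply, Module.End.mul_apply, map_sub]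
    abel
  -- Renaming `σ` restores the order `σ 0, σ 1, σ 2` of the factors and moves the permutation onto
  -- the monomial.
  have h2 : ∑ σ, T (m (σ 0) (σ 1)) (σ * Equiv.swap 1 2) = ∑ σ, T (m (σ 0) (σ 2)) σ := by
    rw [← Equiv.sum_comp (Equiv.mulRight (Equiv.swap (1 : Fin 3) 2))]
    refine Finset.sum_congr rfl fun σ _ => ?_
    simp only [Equiv.coe_mulRight, Equiv.Perm.mul_apply, Equiv.swap_apply_left, hs₁₂, mul_assoc,
      Equiv.swap_mul_self, mul_one]
  have h3 : ∑ σ, T (m (σ 0) (σ 1)) (σ * (Equiv.swap 0 1 * Equiv.swap 1 2)) =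
      ∑ σ, T (m (σ 2) (σ 0)) σ := by
    rw [← Equiv.sum_comp (Equiv.mulRight (Equiv.swap (1 : Fin 3) 2 * Equiv.swap 0 1))]
    refine Finset.sum_congr rfl fun σ _ => ?_
    have h : (Equiv.swap 1 2 * Equiv.swap 0 1 * (Equiv.swap 0 1 * Equiv.swap 1 2) :
      Equiv.Perm (Fin 3)) = 1 := by decide
    rw [Equiv.coe_mulRight, mul_assoc σ, h, mul_one]
    simp only [Equiv.Perm.mul_apply, Equiv.swap_apply_left, Equiv.swap_apply_right, hs₁₂]
  have h4 : ∑ σ, T (m (σ 0) (σ 1)) (σ * Equiv.swap 0 2) = ∑ σ, T (m (σ 2) (σ 1)) σ := by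
    rw [← Equiv.sum_comp (Equiv.mulRight (Equiv.swap (0 : Fin 3) 2))]
    refine Finset.sum_congr rfl fun σ _ => ?_
    simp only [Equiv.coe_mulRight, Equiv.Perm.mul_apply, Equiv.swap_apply_left, hs₀₂, mul_assoc,
      Equiv.swap_mul_self, mul_one]
  choose L₁ hL₁ using exists_vanishes hc w
  choose L₂ hL₂ using cur_triple_eq hc hg w
  set L := ∑ i, ∑ j, (L₁ (m i j) + L₂ (m i j)) with hL
  have hle : ∀ i j, L₁ (m i j) + L₂ (m i j) ≤ L := fun i j =>
    (Finset.single_le_sum (f := fun j => L₁ (m i j) + L₂ (m i j)) (fun _ _ => Nat.zero_le _)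
      (Finset.mem_univ j)).trans (Finset.single_le_sum
        (f := fun i => ∑ j, (L₁ (m i j) + L₂ (m i j))) (fun _ _ => Nat.zero_le _)
        (Finset.mem_univ i))
  set G : Equiv.Perm (Fin 3) → PowerSeries Laurent₃ := fun σ =>
    scaledG p₂ p₃ (ratio (σ 2) (σ 1)) * scaledG p₂ p₃ (ratio (σ 1) (σ 0)) *
      scaledG p₂ p₃ (ratio (σ 2) (σ 0)) with hG
  have h5 : ∀ i j σ, T (m i j) σ = ∑ k ∈ Finset.range (3 * (L + 2) + 1),
      functional V w (coeff k (C (mono (m i j)) * G σ)) := fun i j σ => by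
    have hij := hle i j
    refine (hL₂ (m i j) L (by omega) σ).symm.trans ?_
    exact ((hL₁ (m i j) L (by omega) σ).sum_coeff_scaledG p₂ p₃ (Nat.lt_succ_self _)).symm
  have h6 : ∑ σ : Equiv.Perm (Fin 3), (C (mono (m (σ 0) (σ 1))) * G σ -
      C (mono (m (σ 0) (σ 2))) * G σ - C (mono (m (σ 2) (σ 0))) * G σ +
      C (mono (m (σ 2) (σ 1))) * G σ) = 0 := by
    rw [← mul_zero (C (mono n)), ← sum_serreCoeff_scaledG p₂ p₃, Finset.mul_sum]
    refine Finset.sum_congr rfl fun σ _ => ?_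
    simp only [serreCoeff, hm, ← mono_mul, ← mono_pow, map_add, map_sub, map_mul, map_pow, hG]
    ring
  simp only [h1, Finset.sum_add_distrib, Finset.sum_sub_distrib, h2, h3, h4]
  simp only [h5, ← Finset.sum_add_distrib, ← Finset.sum_sub_distrib, ← map_add, ← map_sub]
  rw [Finset.sum_comm]
  simp only [← map_sum, h6, map_zero, Finset.sum_const_zero]

end SerreFunctional

/-! ### Fused currents -/

section Fusion

variable {W : Type*} [AddCommGroup W] [Module ℂ W]

lemma locSum_smul {ι : Type*} (c : ℂ) (F : ι → End ℂ W) :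
    locSum (fun i => c • F i) = c • locSum F := by
  rcases eq_or_ne c 0 with rfl | hc
  · simp only [zero_smul, locSum_zero]
  have hsupp : ∀ w, (Function.support fun i => (c • F i) w) = Function.support fun i => F i w :=
    fun w => Function.support_const_smul_of_ne_zero c (fun i => F i w) hc
  by_cases h : ∀ w, (Function.support fun i => F i w).Finite
  · refine LinearMap.ext fun w => ?_
    rw [LinearMap.smul_apply, locSum_apply h, locSum_apply fun w => by rw [hsupp]; exact h w,
      smul_finsum' c (h w)]
    rfl
  · rw [locSum, locSum, dif_neg h, dif_neg, smul_zero]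
    simpa only [hsupp] using h

lemma mulCur_smul (c d : ℂ) (a b : Cur W) : mulCur (c • a) (d • b) = (c * d) • mulCur a b := by
  funext k
  rw [Pi.smul_apply, mulCur, mulCur, ← locSum_smul]
  congr 1
  funext n
  rw [Pi.smul_apply, Pi.smul_apply, smul_mul_smul_comm]

lemma mulCur_oneCur (a : Cur W) : mulCur a oneCur = a := by
  funext k
  rw [mulCur, locSum_eq_single 0]
  · simp [oneCur]
  · intro n hn
    simp [oneCur, hn]

lemma oneCur_mulCur (a : Cur W) : mulCur oneCur a = a := by
  funext k
  rw [mulCur, locSum_eq_single k]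
  · simp [oneCur]
  · intro n hn
    rw [oneCur, if_neg (by omega), zero_mul]

lemma mulCur_zero (a : Cur W) : mulCur a 0 = 0 := by
  funext k
  simp [mulCur, locSum_zero]

lemma zero_mulCur (a : Cur W) : mulCur 0 a = 0 := by
  funext k
  simp [mulCur, locSum_zero]

lemma rescale_oneCur (c : ℂ) : rescale c (oneCur : Cur W) = oneCur := by
  funext k
  rcases eq_or_ne k 0 with rfl | hk
  · simp [rescale]
  · simp [rescale, oneCur, hk]

lemma rescale_zero (c : ℂ) : rescale c (0 : Cur W) = 0 := by
  funext k
  simp [rescale]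

lemma fuse_zero_right (Q : Polynomial ℂ) (α β : ℂ) (a : Cur W) : fuse Q α β a 0 = 0 := by
  funext k
  simp [fuse, Polynomial.sum, locSum_zero]

lemma fuse_zero_left (Q : Polynomial ℂ) (α β : ℂ) (a : Cur W) : fuse Q α β 0 a = 0 := by
  funext k
  simp [fuse, Polynomial.sum, locSum_zero]

lemma fuse_one_oneCur (a : Cur W) : fuse 1 1 1 a oneCur = a := by
  refine Eq.trans ?_ (mulCur_oneCur a)
  funext k
  have h : ∀ n, (1 : Polynomial ℂ).sum (fun i c => c • (a (k - n - i) * oneCur (n + i))) =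
      a (k - n) * oneCur n := fun n => by
    rw [← Polynomial.C_1, Polynomial.sum_C_index] <;> simp
  simp [fuse, mulCur, h]

lemma fuse_oneCur_one (a : Cur W) : fuse 1 1 1 oneCur a = a := by
  refine Eq.trans ?_ (oneCur_mulCur a)
  funext k
  have h : ∀ n, (1 : Polynomial ℂ).sum (fun i c => c • (oneCur (k - n - i) * a (n + i))) =
      oneCur (k - n) * a n := fun n => by
    rw [← Polynomial.C_1, Polynomial.sum_C_index] <;> simp
  simp [fuse, mulCur, h]

lemma fuse_smul (Q : Polynomial ℂ) (α β c d : ℂ) (a b : Cur W) :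
    fuse Q α β (c • a) (d • b) = (c * d) • fuse Q α β a b := by
  funext k
  rw [Pi.smul_apply, fuse, fuse, smul_comm (c * d)]
  congr 1
  rw [← locSum_smul]
  congr 1
  funext n
  simp only [Polynomial.sum, Finset.smul_sum, Pi.smul_apply, smul_mul_smul_comm, smul_smul]
  refine Finset.sum_congr rfl fun i _ => ?_
  congr 1
  ring

-- Clearing poles in `fuse` amounts to multiplying the contraction by `Q`.
open PowerSeries in
lemma sum_seriesYX {F : Cur₂ W} (hF : Smooth₂ F) (Q : Polynomial ℂ) (g : PowerSeries ℂ) (m n : ℤ) :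
    Q.sum (fun i c => c • seriesYX g 1 F (m - i) (n + i)) =
      seriesYX ((Q : PowerSeries ℂ) * g) 1 F m n := by
  induction Q using Polynomial.induction_on' with
  | add p q hp hq =>
    rw [Polynomial.sum_add_index p q (fun (i : ℕ) (c : ℂ) => c • seriesYX g 1 F (m - i) (n + i))
      (fun _ => zero_smul _ _) (fun _ _ _ => add_smul _ _ _), hp, hq, Polynomial.coe_add, add_mul,
      seriesYX_add hF]
    rfl
  | monomial i c =>
    rw [Polynomial.sum_monomial_index c (fun (i : ℕ) (c : ℂ) =>
      c • seriesYX g 1 F (m - i) (n + i)) (zero_smul _ _)]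
    refine LinearMap.ext fun w => ?_
    obtain ⟨L, hL⟩ := hF.exists_bound w n
    rw [LinearMap.smul_apply, seriesYX_apply hF _ (hL (i + L) (by omega)),
      seriesYX_apply hF (L := L) _ (fun m' n' h => hL L le_rfl m' n' (by omega)), Finset.smul_sum,
      Finset.sum_range_add]
    refine (Eq.trans (congrArg₂ (· + ·) (Finset.sum_eq_zero fun k hk => ?_)
      (Finset.sum_congr rfl fun k _ => ?_)) (zero_add _)).symm
    swap
    · rw [← Polynomial.C_mul_X_pow_eq_monomial, Polynomial.coe_mul, Polynomial.coe_pow,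
        Polynomial.coe_C, Polynomial.coe_X, mul_assoc, coeff_C_mul, add_comm i k, coeff_X_pow_mul,
        mul_smul]
      congr 4 <;> push_cast <;> ring
    · rw [← Polynomial.C_mul_X_pow_eq_monomial, Polynomial.coe_mul, Polynomial.coe_pow,
        Polynomial.coe_C, Polynomial.coe_X, mul_assoc, coeff_C_mul, coeff_X_pow_mul',
        if_neg (by simpa using hk), mul_zero, zero_smul]

lemma serre_smul {V : VertexPair W} (hc : V.Compatible V) {p₂ p₃ : ℂ}
    (hg : V.Contracts V (gSame p₂ p₃)) (c : ℂ) (n : Fin 3 → ℤ) : ∑ σ : Equiv.Perm (Fin 3),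
      ⁅(c • V.cur) (n (σ 0) + 1), ⁅(c • V.cur) (n (σ 1) + 2), (c • V.cur) (n (σ 2))⁆⁆ = 0 := by
  have h : ∀ x y z : End ℂ W, ⁅c • x, ⁅c • y, c • z⁆⁆ = (c * c * c) • ⁅x, ⁅y, z⁆⁆ := fun x y z => by
    simp only [Ring.lie_def, smul_mul_smul_comm, ← smul_sub, mul_assoc]
  simp only [Pi.smul_apply, h, ← Finset.smul_sum]
  rw [serre_of_contracts hc hg, smul_zero]

namespace VertexPair

open PowerSeries in
/-- A fused current vanishes when the contraction, cleared of its poles, does. -/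
lemma Contracts.fuse_eq_zero {V V' : VertexPair W} {g : PowerSeries ℂ} (hg : Contracts V V' g)
    (hc : Compatible V V') {Q R : Polynomial ℂ} (hR : (Q : PowerSeries ℂ) * g = R) {α β : ℂ}
    (hα : α ≠ 0) (hβ : β ≠ 0) (h0 : R.eval (β / α) = 0) : fuse Q α β V.cur V'.cur = 0 := by
  have hN := hc.smooth_normal
  have h1 : ∀ m n : ℤ, Q.sum (fun i c => c • (V.cur (m - i) * V'.cur (n + i))) =
      R.sum fun i c => c • normal V V' (m - i) (n + i) := fun m n => by
    have h2 : ∀ m n, V.cur m * V'.cur n = seriesYX g 1 (normal V V') m n := fun m n => by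
      rw [← hg.prodXY_eq hc]; rfl
    simp only [h2]
    rw [sum_seriesYX hN, hR, ← mul_one (R : PowerSeries ℂ), ← sum_seriesYX hN, seriesYX_one hN]
  funext k
  rw [fuse]
  simp only [h1]
  -- The normalization by `Q(β / α)` is irrelevant here: the other factor vanishes.
  rw [Pi.zero_apply, smul_eq_zero]
  right
  have hfin : ∀ w, (Function.support fun n : ℤ => normal V V' (k - n) n w).Finite := fun w => by
    obtain ⟨M, hM⟩ := hN w
    refine (Set.finite_Icc (k - M) M).subset fun n hn => ?_
    rw [Set.mem_Icc]
    by_contra h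
    exact hn (hM _ _ (by omega))
  have hfin' : ∀ w (i : ℕ) (c : ℂ), (Function.support fun n : ℤ => (α ^ (-(k - n)) * β ^ (-n)) •
      c • normal V V' (k - n - i) (n + i) w).Finite := fun w i c => by
    refine ((hfin w).preimage (f := fun n : ℤ => n + i) (add_left_injective _).injOn).subset
      fun n hn => ?_
    intro h
    refine hn ?_
    dsimp only at h ⊢
    rw [← sub_sub] at h
    rw [h, smul_zero, smul_zero]
  have hsum : ∀ (w : W) (n : ℤ), ((α ^ (-(k - n)) * β ^ (-n)) • R.sum fun i c =>
      c • normal V V' (k - n - i) (n + i)) w = ∑ i ∈ R.support, (α ^ (-(k - n)) * β ^ (-n)) •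
        R.coeff i • normal V V' (k - n - i) (n + i) w := fun w n => by
    simp [Polynomial.sum, Finset.smul_sum]
  refine LinearMap.ext fun w => ?_
  rw [locSum_apply]
  swap
  · intro w
    simp only [hsum]
    refine (R.support.finite_toSet.biUnion fun i _ => hfin' w i (R.coeff i)).subset fun n hn => ?_
    obtain ⟨i, hi, h⟩ := Finset.exists_ne_zero_of_sum_ne_zero hn
    exact Set.mem_biUnion hi h
  simp only [hsum]
  rw [finsum_sum_comm _ _ fun i _ => hfin' w i _]
  -- At `x = αz`, `y = βz` each power of `y / x` becomes the same power of `β / α`, so `R`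
  -- contributes the scalar `R(β / α)`.
  have hterm : ∀ i : ℕ, ∑ᶠ n : ℤ, (α ^ (-(k - n)) * β ^ (-n)) •
      R.coeff i • normal V V' (k - n - i) (n + i) w = (R.coeff i * (β / α) ^ i) •
        ∑ᶠ n : ℤ, (α ^ (-(k - n)) * β ^ (-n)) • normal V V' (k - n) n w := fun i => by
    have hfin0 : (Function.support fun n : ℤ =>
        (α ^ (-(k - n)) * β ^ (-n)) • normal V V' (k - n) n w).Finite :=
      (hfin w).subset fun n hn h => hn (by dsimp only at h ⊢; rw [h, smul_zero])
    rw [smul_finsum' _ hfin0]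
    refine (finsum_congr fun n => ?_).trans (finsum_comp_equiv (Equiv.addRight (i : ℤ)))
    rw [Equiv.coe_addRight, smul_smul, smul_smul, ← sub_sub]
    congr 1
    rw [show -(k - n - i) = -(k - n) + i by ring, neg_add, zpow_add₀ hα, zpow_add₀ hβ, zpow_neg β i,
      zpow_natCast, zpow_natCast, div_pow]
    field_simp
  simp only [hterm, ← Finset.sum_smul]
  rw [Polynomial.eval_eq_sum, Polynomial.sum] at h0
  rw [h0, zero_smul, LinearMap.zero_apply]

end VertexPair

end Fusion

/-! ### Fused currents and `k_r^±` on the Fock space -/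

section FockFusion

variable (P : Params) (v : ℂ)

lemma isGL1_fock (hP : P.Generic) (hv : v ≠ 0) : IsGL1 P (fock P v) where
  h_zero := rfl
  C_central _ _ := Algebra.commutes _ _
  ψ₀_central _ _ := Commute.one_left _
  hh := fock_hh P v hP
  ψp_e := fock_ψp_e P v hP
  ψm_e := fock_ψm_e P v hP
  ψp_f := fock_ψp_f P v hP
  ψm_f := fock_ψm_f P v hP
  ef := fock_ef P v hP hv
  ee := fock_ee P v hP
  ff := fock_ff P v hP
  serre_e n := by
    rw [fock_e]
    exact serre_smul (fockPair_compatible _ _ _ _ _) (fockE_contracts_fockE hP) _ n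
  serre_f n := by
    rw [fock_f]
    exact serre_smul (fockPair_compatible _ _ _ _ _) (fockF_contracts_fockF hP) _ n

lemma eFused_one (D : GL1Data FockSpace) : D.eFused P 1 = P.c₁ • D.e := by
  simp [GL1Data.eFused, fuse_oneCur_one]

lemma fFused_one (D : GL1Data FockSpace) : D.fFused P 1 = (-P.c₁) • D.f := by
  simp [GL1Data.fFused, fuse_one_oneCur]

/-- Fusing `e(z) e(q₁z)` evaluates at `y / x = q₁`, a root of the contraction cleared of poles;
longer fused currents contain this one. -/
lemma eFused_fock (hP : P.Generic) (r : ℕ) : (fock P v).eFused P (r + 2) = 0 := by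
  induction r with
  | zero =>
    rw [GL1Data.eFused, eFused_one, fock_e, smul_smul, fuse_smul,
      (fockE_contracts_fockE hP).fuse_eq_zero (fockPair_compatible _ _ _ _ _)
        (R := (1 - Polynomial.C P.q₁ * Polynomial.X) * ((1 - Polynomial.X) *
          (1 - Polynomial.C P.q₁⁻¹ * Polynomial.X))) ?_ one_ne_zero ?_ ?_, smul_zero, smul_zero]
    · have h := gPoly_mul_gSame P
      simp only [gPoly, map_neg, mul_one, map_one] at h
      simp
      linear_combination h
    · simpa using P.q₁_ne_zero
    · simp [P.q₁_ne_zero]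
  | succ r ih => rw [GL1Data.eFused, ih, fuse_zero_left, smul_zero]

/-- For `f(q₁z) f(z)` the ratio is `q₁⁻¹`, the opposite root. -/
lemma fFused_fock (hP : P.Generic) (r : ℕ) : (fock P v).fFused P (r + 2) = 0 := by
  induction r with
  | zero =>
    rw [GL1Data.fFused, fFused_one, fock_f, smul_smul, fuse_smul,
      (fockF_contracts_fockF hP).fuse_eq_zero (fockPair_compatible _ _ _ _ _)
        (R := -((1 - Polynomial.C P.q₁ * Polynomial.X) * ((1 - Polynomial.X) *
          (1 - Polynomial.C P.q₁⁻¹ * Polynomial.X)))) ?_ ?_ one_ne_zero ?_, smul_zero, smul_zero]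
    · have h := gPolyRev_mul_gSame P
      simp only [gPolyRev, map_neg, mul_one, map_one] at h
      simp
      linear_combination h
    · simpa using P.q₁_ne_zero
    · simp [P.q₁_ne_zero]
  | succ r ih => rw [GL1Data.fFused, ih, fuse_zero_right, smul_zero]

variable {K : (End ℂ FockSpace)ˣ} {κ : ℂ}

/-- The coefficients of `h_{-r}` in `k₀⁻`. -/
def kCreation (r : ℕ) : ℂ := P.κ r / (P.q₁ ^ (r : ℤ) - 1)

/-- The coefficients of `h_r` in `k₀⁺`. -/
def kAnnihilation (r : ℕ) : ℂ := P.κ r / (P.q₁ ^ (-(r : ℤ)) - 1)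

variable {P} in
-- This is minus the creation exponent of `e`, so `k₀⁻` strips `e` of its creation half.
lemma kCreation_eq (hP : P.Generic) {r : ℕ} (hr : 0 < r) :
    kCreation P r = -((1 - P.q₂ ^ r) * (1 - P.q₃ ^ r)) := by
  have h := sub_ne_zero.2 (hP.q₁_pow_ne hr)
  rw [kCreation, zpow_natCast, div_eq_iff h, Params.κ, zpow_natCast, zpow_natCast, zpow_natCast]
  ring

variable {P} in
-- Cancelling `1 - q₁^r` leaves a factor `q₁^r = q₂^{-r} q₃^{-r}`. The result is minus the
-- annihilation exponent of `f`.
lemma kAnnihilation_eq (hP : P.Generic) {r : ℕ} (hr : 0 < r) :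
    kAnnihilation P r = (1 - P.q₂⁻¹ ^ r) * (1 - P.q₃⁻¹ ^ r) := by
  obtain ⟨σ, b, c, hσ, hb, hc, h1, hσ0, hb0, hc0, hprod, hb1, hc1, hr0⟩ := hP.pow_data hr
  have h2 : (σ ^ 2)⁻¹ - 1 ≠ 0 := by
    rw [← h1]
    exact sub_ne_zero.2 fun h => hP.q₁_pow_ne hr (inv_eq_one.1 h)
  rw [kAnnihilation, zpow_neg, zpow_natCast, Params.κ, zpow_natCast, zpow_natCast, zpow_natCast,
    inv_pow, inv_pow, h1, hb, hc, div_eq_iff h2]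
  field_simp
  linear_combination ((1 - σ ^ 2) * (1 - b) * (1 - c)) * hprod

lemma c₁_mul_fockEConst (hP : P.Generic) : P.c₁ * fockEConst P v = -v := by
  obtain ⟨σ, b, c, hσ, hb, hc, h1, hσ0, hb0, hc0, hprod, hb1, hc1, hr0⟩ := hP.pow_data one_pos
  have h2 : σ ^ 2 - 1 ≠ 0 := by rw [← h1]; exact sub_ne_zero.2 (hP.q₁_pow_ne one_pos)
  rw [pow_one] at hσ hb hc h1
  rw [Params.c₁, fockEConst, Params.κ, zpow_one, zpow_one, zpow_one, hσ, hb, hc, h1]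
  have h3 : σ - σ⁻¹ = (σ ^ 2 - 1) / σ := by field_simp
  rw [h3]
  field_simp
  ring

lemma c₁_mul_fockFConst (hP : P.Generic) : P.c₁ * fockFConst P v = v⁻¹ := by
  obtain ⟨σ, b, c, hσ, hb, hc, h1, hσ0, hb0, hc0, hprod, hb1, hc1, hr0⟩ := hP.pow_data one_pos
  have h2 : σ ^ 2 - 1 ≠ 0 := by rw [← h1]; exact sub_ne_zero.2 (hP.q₁_pow_ne one_pos)
  rw [pow_one] at hσ hb hc h1
  rw [Params.c₁, fockFConst, Params.κ, zpow_one, zpow_one, zpow_one, hσ, hb, hc, h1]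
  have h3 : σ - σ⁻¹ = (σ ^ 2 - 1) / σ := by field_simp
  rw [h3]
  field_simp
  ring

lemma k₀p_fock (hK : (K : End ℂ FockSpace) = sca κ) :
    (fock P v).k₀p P K = κ • (fockPair P (fun _ => 0) (kAnnihilation P)).cur := by
  rw [fockPair_cur_annihilation P fun _ _ => rfl]
  funext m
  simp only [GL1Data.k₀p, hK, sca_mul, Pi.smul_apply, posCur, smul_ite, smul_zero]
  rfl

lemma k₀m_fock (hK : ((K⁻¹ : (End ℂ FockSpace)ˣ) : End ℂ FockSpace) = sca κ⁻¹) :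
    (fock P v).k₀m P K = κ⁻¹ • (fockPair P (kCreation P) fun _ => 0).cur := by
  rw [fockPair_cur_creation P fun _ _ => rfl]
  funext m
  simp only [GL1Data.k₀m, hK, sca_mul, Pi.smul_apply, negCur, smul_ite, smul_zero]
  rfl

lemma kp_fock_zero (D : GL1Data FockSpace) : D.kp P K 0 = D.k₀p P K := by
  rw [GL1Data.kp, GL1Data.fFused, oneCur_mulCur]

lemma km_fock_zero (D : GL1Data FockSpace) : D.km P K 0 = D.k₀m P K := by
  rw [GL1Data.km, GL1Data.eFused, mulCur_oneCur]

lemma kp_fock_eq_zero (hP : P.Generic) (r : ℕ) : (fock P v).kp P K (r + 2) = 0 := by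
  rw [GL1Data.kp, fFused_fock P v hP, zero_mulCur]

lemma km_fock_eq_zero (hP : P.Generic) (r : ℕ) : (fock P v).km P K (r + 2) = 0 := by
  rw [GL1Data.km, eFused_fock P v hP, mulCur_zero]

/-- In `k₁⁻` the creation halves of `k₀⁻` and `e` cancel, and the annihilation half of `e` is that
of `k₀⁺` at a shifted argument. The constants are `κ` and `κ⁻¹ * (-v)`, which is where `κ² = v`
enters. -/
lemma kp_zero_eq_neg_km_one (hP : P.Generic) (hκ : κ ^ 2 = v) (hv : v ≠ 0)
    (hK : (K : End ℂ FockSpace) = sca κ)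
    (hK' : ((K⁻¹ : (End ℂ FockSpace)ˣ) : End ℂ FockSpace) = sca κ⁻¹) (p : ℤ) :
    (fock P v).kp P K 0 p = -(P.s₁ ^ p • (fock P v).km P K 1 p) := by
  have hs := P.s₁_ne_zero
  have hκ0 : κ ≠ 0 := by rintro rfl; exact hv (by rw [← hκ]; ring)
  have hm : mulCur (fockPair P (kCreation P) fun _ => 0).cur (fockE P).cur =
      (fockPair P (fun _ => 0) fun r => P.s₁⁻¹ ^ r * kAnnihilation P r).cur := by
    refine mulCur_fockPair P (Or.inl fun _ _ => rfl) (fun r hr => ?_) fun r hr => ?_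
    · rw [kCreation_eq hP hr, neg_add_cancel]
    · rw [kAnnihilation_eq hP hr]
      ring
  rw [kp_fock_zero, GL1Data.km, eFused_one, fock_e, smul_smul, k₀m_fock P v hK', mulCur_smul, hm,
    k₀p_fock P v hK, Pi.smul_apply, Pi.smul_apply, cur_annihilation_rescale, smul_smul, smul_smul,
    ← neg_smul, c₁_mul_fockEConst P v hP]
  congr 1
  rw [← hκ, inv_zpow]
  field_simp

/-- The mirror image: the annihilation halves of `f` and `k₀⁺` cancel, and the constants are `κ⁻¹`
and `-v⁻¹ * κ`. -/
lemma km_zero_eq_neg_kp_one (hP : P.Generic) (hκ : κ ^ 2 = v) (hv : v ≠ 0)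
    (hK : (K : End ℂ FockSpace) = sca κ)
    (hK' : ((K⁻¹ : (End ℂ FockSpace)ˣ) : End ℂ FockSpace) = sca κ⁻¹) (p : ℤ) :
    (fock P v).km P K 0 p = -(P.s₁ ^ p • (fock P v).kp P K 1 p) := by
  have hs := P.s₁_ne_zero
  have hκ0 : κ ≠ 0 := by rintro rfl; exact hv (by rw [← hκ]; ring)
  have hm : mulCur (fockF P).cur (fockPair P (fun _ => 0) (kAnnihilation P)).cur =
      (fockPair P (fun r => P.s₁ ^ r * kCreation P r) fun _ => 0).cur := by
    refine mulCur_fockPair P (Or.inr fun _ _ => rfl) (fun r hr => ?_) fun r hr => ?_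
    · rw [kCreation_eq hP hr]
      ring
    · rw [kAnnihilation_eq hP hr, neg_add_cancel]
  rw [km_fock_zero, GL1Data.kp, fFused_one, fock_f, smul_smul, k₀p_fock P v hK, mulCur_smul, hm,
    k₀m_fock P v hK', Pi.smul_apply, Pi.smul_apply, cur_creation_rescale, smul_smul, smul_smul,
    ← neg_smul, neg_mul, c₁_mul_fockFConst P v hP]
  congr 1
  rw [← hκ, zpow_neg]
  field_simp

end FockFusion

/-! ### Currents acting by zero -/

section Zero

variable {W : Type*} [AddCommGroup W] [Module ℂ W]

@[simp] lemma prodXY_zero_left (b : Cur W) : prodXY 0 b = 0 := by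
  funext m n; simp [prodXY]

@[simp] lemma prodXY_zero_right (a : Cur W) : prodXY a 0 = 0 := by
  funext m n; simp [prodXY]

@[simp] lemma prodYX_zero_left (a : Cur W) : prodYX 0 a = 0 := by
  funext m n; simp [prodYX]

@[simp] lemma prodYX_zero_right (b : Cur W) : prodYX b 0 = 0 := by
  funext m n; simp [prodYX]

@[simp] lemma linMul_zero (a b : End ℂ W) : linMul a b 0 = 0 := by
  funext m n; simp [linMul]

@[simp] lemma gXY_zero (P : Params) (a b : End ℂ W) : gXY P a b 0 = 0 := by simp [gXY]

@[simp] lemma gYX_zero (P : Params) (a b : End ℂ W) : gYX P a b 0 = 0 := by simp [gYX]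

@[simp] lemma linProd_zero (S : List (ℂ × ℂ)) : linProd S (0 : Cur₂ W) = 0 := by
  induction S with
  | nil => rfl
  | cons p S ih => rw [linProd, List.foldr_cons]; change linMul _ _ (linProd S 0) = 0; simp [ih]

@[simp] lemma seriesXY_apply_zero (φ : PowerSeries ℂ) (c : (End ℂ W)ˣ) :
    seriesXY φ c (0 : Cur₂ W) = 0 := by
  funext m n; simp [seriesXY, locSum_zero]

@[simp] lemma seriesYX_apply_zero (φ : PowerSeries ℂ) (c : (End ℂ W)ˣ) :
    seriesYX φ c (0 : Cur₂ W) = 0 := by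
  funext m n; simp [seriesYX, locSum_zero]

@[simp] lemma deltaYX_zero (c : (End ℂ W)ˣ) : deltaYX c (0 : Cur₂ W) = 0 := by
  funext m n; simp [deltaYX, locSum_zero]

@[simp] lemma deltaXY_zero (c : (End ℂ W)ˣ) : deltaXY c (0 : Cur₂ W) = 0 := by
  funext m n; simp [deltaXY, locSum_zero]

@[simp] lemma inY_zero : inY (0 : Cur W) = 0 := by
  funext m n; simp [inY]

@[simp] lemma inX_zero : inX (0 : Cur W) = 0 := by
  funext m n; simp [inX]

variable (W) in
/-- The trivial representation of a toroidal algebra. -/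
def trivialData : GL1Data W where
  e := 0
  f := 0
  h := 0
  C := 1
  ψ₀ := 1

lemma expCoeff_smul_zero (a : ℕ → ℂ) (n : ℕ) :
    expCoeff (fun r => a r • (0 : End ℂ W)) n = if n = 0 then 1 else 0 := by
  refine Eq.trans ?_ (expCoeff_of_zero (W := W) (h := fun _ => 0) (fun _ _ => Commute.zero_left _)
    rfl (a := 0) (fun _ _ => rfl) n)
  simp

lemma posCur_expCoeff_zero (a : ℕ → ℂ) :
    posCur (fun n => expCoeff (fun r => a r • (0 : End ℂ W)) n) = oneCur := by
  funext m
  simp only [expCoeff_smul_zero, posCur, oneCur]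
  rcases lt_trichotomy m 0 with h | rfl | h
  · rw [if_neg (by omega), if_neg (by omega)]
  · simp
  · rw [if_pos h.le, if_neg (by omega), if_neg (by omega)]

lemma negCur_expCoeff_zero (a : ℕ → ℂ) :
    negCur (fun n => expCoeff (fun r => a r • (0 : End ℂ W)) n) = oneCur := by
  funext m
  rw [negCur_eq, posCur_expCoeff_zero]
  simp [oneCur]

lemma trivialData_ψp (P : Params) : (trivialData W).ψp P = oneCur := by
  simp only [GL1Data.ψp, trivialData, Units.val_one, one_mul, Pi.zero_apply]
  exact posCur_expCoeff_zero _

lemma trivialData_ψm (P : Params) : (trivialData W).ψm P = oneCur := by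
  simp only [GL1Data.ψm, trivialData, Units.val_one, one_mul, Pi.zero_apply, inv_one]
  exact negCur_expCoeff_zero _

lemma isGL1_trivialData (P : Params) : IsGL1 P (trivialData W) where
  h_zero := rfl
  C_central _ _ := Commute.one_left _
  ψ₀_central _ _ := Commute.one_left _
  hh r s _ _ := by simp [trivialData, Ring.lie_def]
  ψp_e := by simp [trivialData]
  ψm_e := by simp [trivialData]
  ψp_f := by simp [trivialData]
  ψm_f := by simp [trivialData]
  ef := by
    rw [trivialData_ψp, trivialData_ψm]
    funext m n
    simp only [Pi.smul_apply, Pi.sub_apply, deltaYX_inY, deltaXY_inX]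
    simp [trivialData]
  ee := by simp [trivialData]
  ff := by simp [trivialData]
  serre_e n := by simp [trivialData, Ring.lie_def]
  serre_f n := by simp [trivialData, Ring.lie_def]

lemma trivialData_kp (P : Params) (r : ℕ) :
    (trivialData W).kp P 1 r = if r = 0 then oneCur else 0 := by
  rcases r with _ | r
  · rw [GL1Data.kp, GL1Data.fFused, oneCur_mulCur, if_pos rfl]
    simp only [GL1Data.k₀p, trivialData, Units.val_one, one_mul, Pi.zero_apply]
    exact posCur_expCoeff_zero _
  · rw [GL1Data.kp, GL1Data.fFused, if_neg r.succ_ne_zero]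
    simp [trivialData, fuse_zero_left, zero_mulCur]

lemma trivialData_km (P : Params) (r : ℕ) :
    (trivialData W).km P 1 r = if r = 0 then oneCur else 0 := by
  rcases r with _ | r
  · rw [GL1Data.km, GL1Data.eFused, mulCur_oneCur, if_pos rfl]
    simp only [GL1Data.k₀m, trivialData, Units.val_one, one_mul, Pi.zero_apply, inv_one]
    exact negCur_expCoeff_zero _
  · rw [GL1Data.km, GL1Data.eFused, if_neg r.succ_ne_zero]
    simp [trivialData, fuse_zero_right, mulCur_zero]

lemma trivialData_gens {T : End ℂ W} (hT : T ∈ (trivialData W).gens) : T = 0 ∨ T = 1 := by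
  simp only [GL1Data.gens, trivialData, Set.mem_union, Set.mem_range, Set.mem_insert_iff,
    Set.mem_singleton_iff, Pi.zero_apply, Units.val_one] at hT
  rcases hT with ((⟨_, h⟩ | ⟨_, h⟩) | ⟨_, h⟩) | h | h
  · exact Or.inl h.symm
  · exact Or.inl h.symm
  · exact Or.inl h.symm
  · exact Or.inr h
  · exact Or.inr h

lemma commute_trivialData {S T : End ℂ W} (hT : T ∈ (trivialData W).gens) : Commute S T := by
  rcases trivialData_gens hT with rfl | rfl
  · exact Commute.zero_right _
  · exact Commute.one_right _

lemma trivialData_graded (V : ℤ × ℤ → Submodule ℂ W) : (trivialData W).Graded V where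
  e _ := hasDeg_zero _ _
  f _ := hasDeg_zero _ _
  h _ := hasDeg_zero _ _
  C := hasDeg_one
  C_inv := by rw [trivialData, inv_one]; exact hasDeg_one
  ψ₀ := hasDeg_one
  ψ₀_inv := by rw [trivialData, inv_one]; exact hasDeg_one

lemma a1First_of_zero (P : Params) (β : ℂ) (E Ec : GL1Data W) (K Kc : (End ℂ W)ˣ) :
    A1First P β ⟨E, Ec, K, Kc, 0, 0⟩ := by
  constructor <;> intros <;> simp [rescale_zero]

lemma a1Second_of_zero (P : Params) (E Ec : GL1Data W) (K Kc : (End ℂ W)ˣ) :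
    A1Second P ⟨E, Ec, K, Kc, 0, 0⟩ := by
  constructor <;> intros <;> simp

lemma sumPairs_left {G : Type*} [AddCommMonoid G] {F : ℕ → ℕ → G}
    (hF : ∀ r r', r' ≠ 0 → F r r' = 0) (M : ℤ) :
    sumPairs M F = if 0 ≤ M then F M.toNat 0 else 0 := by
  rw [sumPairs]
  split_ifs with h
  · refine Finset.sum_eq_single (M.toNat, 0) (fun p hp hne => hF _ _ fun h0 => hne ?_)
      fun hne => (hne (by simp)).elim
    have := Finset.HasAntidiagonal.mem_antidiagonal.1 hp
    ext <;> simp <;> omega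
  · rfl

lemma sumPairs_right {G : Type*} [AddCommMonoid G] {F : ℕ → ℕ → G}
    (hF : ∀ r r', r ≠ 0 → F r r' = 0) (M : ℤ) :
    sumPairs M F = if 0 ≤ M then F 0 M.toNat else 0 := by
  rw [sumPairs]
  split_ifs with h
  · refine Finset.sum_eq_single (0, M.toNat) (fun p hp hne => hF _ _ fun h0 => hne ?_)
      fun hne => (hne (by simp)).elim
    have := Finset.HasAntidiagonal.mem_antidiagonal.1 hp
    ext <;> simp <;> omega
  · rfl

end Zero

/-! ### The grading of the Fock space -/

section Grading

lemma fockGrading_isInternal : DirectSum.IsInternal fockGrading :=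
  (MvPolynomial.weightedDecomposition ℂ (fun n : ℕ+ => ((-(n : ℤ), 0) : ℤ × ℤ))).isInternal

lemma fockGrading_finite (d : ℤ × ℤ) : FiniteDimensional ℂ (fockGrading d) := by
  classical
  set m := (-d.1).toNat with hm
  -- A factor `h_{-n}` with exponent `k n > 0` contributes `k n * n ≤ m` to the degree, so both `n`
  -- and `k n` are at most `m`. The interval ends at `m + 1` only because its endpoints lie in `ℕ+`.
  set k₀ : ℕ+ →₀ ℕ := Finsupp.indicator (Finset.Icc 1 m.succPNat) fun _ _ => m
  have hle : ∀ k, Finsupp.weight (fun n : ℕ+ => ((-(n : ℤ), 0) : ℤ × ℤ)) k = d → k ≤ k₀ := by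
    intro k hk n
    rw [fock_weight] at hk
    rcases Nat.eq_zero_or_pos (k n) with h0 | h0
    · rw [h0]; exact Nat.zero_le _
    have h1 : (k n * n : ℤ) ≤ m := by
      have h2 : (k n * n : ℤ) ≤ k.sum fun n j => (j * n : ℤ) :=
        Finset.single_le_sum (f := fun n : ℕ+ => (k n * n : ℤ)) (fun _ _ => by positivity)
          (Finsupp.mem_support_iff.2 h0.ne')
      have h3 : k.sum (fun n j => (j * n : ℤ)) = -d.1 := by rw [← hk]; simp
      rw [h3] at h2
      exact h2.trans (Int.self_le_toNat _)
    have h2 : k n * (n : ℕ) ≤ m := by exact_mod_cast h1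
    have h3 : (n : ℕ) ≤ m := (Nat.le_mul_of_pos_left _ h0).trans h2
    have h4 : n ∈ Finset.Icc 1 m.succPNat := by
      rw [Finset.mem_Icc, ← PNat.coe_le_coe n, Nat.succPNat_coe]
      exact ⟨one_le, h3.trans m.le_succ⟩
    rw [Finsupp.indicator_of_mem h4]
    exact (Nat.le_mul_of_pos_right _ n.pos).trans h2
  have hspan : fockGrading d ≤ Submodule.span ℂ
      ((fun k => MvPolynomial.monomial k (1 : ℂ)) '' Set.Iic k₀) := by
    intro w hw
    rw [w.as_sum]
    refine Submodule.sum_mem _ fun k hk => ?_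
    rw [← mul_one (MvPolynomial.coeff k w), ← smul_eq_mul, ← MvPolynomial.smul_monomial]
    exact Submodule.smul_mem _ _ (Submodule.subset_span
      ⟨k, hle k (hw (MvPolynomial.mem_support_iff.1 hk)), rfl⟩)
  have := FiniteDimensional.span_of_finite ℂ
    ((Set.finite_Iic k₀).image fun k => MvPolynomial.monomial k (1 : ℂ))
  exact Submodule.finiteDimensional_of_le hspan

lemma fock_graded (P : Params) (v : ℂ) : (fock P v).Graded fockGrading where
  e k := by
    rw [fock_e]
    exact (hasDeg_fockPair P _ _ k).smul _
  f k := by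
    rw [fock_f]
    exact (hasDeg_fockPair P _ _ k).smul _
  h r := hasDeg_fockH P r
  C := hasDeg_sca _
  C_inv := hasDeg_sca _
  ψ₀ := hasDeg_one
  ψ₀_inv := by rw [fock, inv_one]; exact hasDeg_one

lemma isAdmissibleFor_fockGrading {E Ec : GL1Data FockSpace} {K Kc : (End ℂ FockSpace)ˣ}
    {κ κc : ℂ} (hE : E.Graded fockGrading) (hEc : Ec.Graded fockGrading)
    (hK : (K : End ℂ FockSpace) = sca κ)
    (hK' : ((K⁻¹ : (End ℂ FockSpace)ˣ) : End ℂ FockSpace) = sca κ⁻¹)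
    (hKc : (Kc : End ℂ FockSpace) = sca κc)
    (hKc' : ((Kc⁻¹ : (End ℂ FockSpace)ˣ) : End ℂ FockSpace) = sca κc⁻¹) :
    A1Data.IsAdmissibleFor fockGrading ⟨E, Ec, K, Kc, 0, 0⟩ where
  internal := fockGrading_isInternal
  finite := fockGrading_finite
  bounded _ := ⟨0, fun _ h => fockGrading_eq_bot (Or.inl h)⟩
  E := hE
  Ec := hEc
  K := hK ▸ hasDeg_sca _
  K_inv := hK' ▸ hasDeg_sca _
  Kc := hKc ▸ hasDeg_sca _
  Kc_inv := hKc' ▸ hasDeg_sca _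
  Xp _ _ := hasDeg_zero _ _
  Xm _ _ := hasDeg_zero _ _

end Grading

/-! ### The modules -/

section Modules

variable (P : Params) {v κ : ℂ}

/-- Multiplication by a nonzero number, as a unit. -/
def scaUnit {κ : ℂ} (hκ : κ ≠ 0) : (End ℂ FockSpace)ˣ :=
  Units.map (algebraMap ℂ (End ℂ FockSpace)).toMonoidHom (Units.mk0 κ hκ)

lemma coe_scaUnit (hκ : κ ≠ 0) : (scaUnit hκ : End ℂ FockSpace) = sca κ := rfl

lemma coe_scaUnit_inv (hκ : κ ≠ 0) :
    (((scaUnit hκ)⁻¹ : (End ℂ FockSpace)ˣ) : End ℂ FockSpace) = sca κ⁻¹ := rfl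

lemma coe_one_eq_sca : ((1 : (End ℂ FockSpace)ˣ) : End ℂ FockSpace) = sca 1 :=
  (map_one (algebraMap ℂ (End ℂ FockSpace))).symm

lemma coe_one_inv_eq_sca :
    (((1 : (End ℂ FockSpace)ˣ)⁻¹ : (End ℂ FockSpace)ˣ) : End ℂ FockSpace) = sca 1⁻¹ := by
  rw [inv_one, inv_one, coe_one_eq_sca]

/-- The first Fock module. -/
def fockModule (v : ℂ) (hκ : κ ≠ 0) : A1Data FockSpace :=
  ⟨fock P v, trivialData FockSpace, scaUnit hκ, 1, 0, 0⟩

/-- The second Fock module. -/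
def fockModuleCheck (v : ℂ) (hκ : κ ≠ 0) : A1Data FockSpace :=
  ⟨trivialData FockSpace, fock P.check v, 1, scaUnit hκ, 0, 0⟩

/-- This makes the level of the checked Fock module compatible with `C = 1` in the first factor. -/
lemma check_s₁ : P.check.s₁ = P.s₁⁻¹ := by
  rw [Params.s₁, Params.s₁, ← Complex.exp_neg, Params.check]
  ring_nf

variable {P}

lemma a1Cartan_fockModule (hP : P.Generic) (hv : v ≠ 0) (hκ : κ ≠ 0) :
    A1Cartan P (fockModule P v hκ) where
  E_rel := isGL1_fock P v hP hv
  Ec_rel := isGL1_trivialData _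
  E_Ec _ _ _ hb := commute_trivialData hb
  K_central _ _ := Algebra.commutes _ _
  Kc_central _ _ := Commute.one_left _
  K_Kc := Commute.one_right _
  ψ₀_eq := rfl
  ψ₀c_eq := rfl
  C_eq := by
    change sca P.s₁ = P.s₁ • ((1 : (End ℂ FockSpace)ˣ) : End ℂ FockSpace)
    rw [coe_one_eq_sca, smul_sca, mul_one]

lemma a1Cartan_fockModuleCheck (hP : P.Generic) (hv : v ≠ 0) (hκ : κ ≠ 0) :
    A1Cartan P (fockModuleCheck P v hκ) where
  E_rel := isGL1_trivialData _
  Ec_rel := isGL1_fock P.check v hP.check hv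
  E_Ec _ ha _ _ := (commute_trivialData ha).symm
  K_central _ _ := Commute.one_left _
  Kc_central _ _ := Algebra.commutes _ _
  K_Kc := Commute.one_left _
  ψ₀_eq := rfl
  ψ₀c_eq := rfl
  C_eq := by
    change ((1 : (End ℂ FockSpace)ˣ) : End ℂ FockSpace) = P.s₁ • sca P.check.s₁
    rw [smul_sca, check_s₁, mul_inv_cancel₀ P.s₁_ne_zero, coe_one_eq_sca]

lemma exp_neg_l₁ (r : ℕ) : Complex.exp (-r * P.l₁) = P.s₁ ^ (-(2 * r : ℤ)) := by
  rw [Params.s₁, ← Complex.exp_int_mul]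
  congr 1
  push_cast
  ring

lemma q₁_zpow (r : ℤ) : P.q₁ ^ r = P.s₁ ^ (2 * r) := by
  rw [← P.s₁_sq, zpow_mul, zpow_ofNat]

lemma q₁half_eq (i : ℤ) : P.q₁half i = P.s₁ ^ (2 * i + 1) := by
  rw [Params.q₁half, Params.s₁, ← Complex.exp_int_mul]
  congr 1
  push_cast
  ring

lemma deltaYX_expUnit (c : (End ℂ FockSpace)ˣ) {s : ℂ} (r : ℕ)
    (hc : ∀ m : ℤ, ((c ^ m : (End ℂ FockSpace)ˣ) : End ℂ FockSpace) = sca (s ^ m))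
    (G : Cur FockSpace) (m n : ℤ) :
    deltaYX (c * expUnit FockSpace (-r * P.l₁)) (inY G) m n =
      (s ^ m * P.s₁ ^ (-(2 * r * m))) • G (m + n) := by
  have hcomm : Commute c (expUnit FockSpace (-r * P.l₁)) :=
    Units.ext (Algebra.commutes _ _).symm
  rw [deltaYX_inY, hcomm.mul_zpow, Units.val_mul, hc, coe_expUnit_zpow, sca_mul, smul_sca, sca_mul,
    exp_neg_l₁, ← zpow_mul, neg_mul]

lemma deltaXY_expUnit (c : (End ℂ FockSpace)ˣ) {s : ℂ} (r : ℕ)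
    (hc : ∀ m : ℤ, ((c ^ m : (End ℂ FockSpace)ˣ) : End ℂ FockSpace) = sca (s ^ m))
    (G : Cur FockSpace) (m n : ℤ) :
    deltaXY (c * expUnit FockSpace (-r * P.l₁)) (inX G) m n =
      (s ^ n * P.s₁ ^ (-(2 * r * n))) • G (m + n) := by
  have hcomm : Commute c (expUnit FockSpace (-r * P.l₁)) :=
    Units.ext (Algebra.commutes _ _).symm
  rw [deltaXY_inX, hcomm.mul_zpow, Units.val_mul, hc, coe_expUnit_zpow, sca_mul, smul_sca, sca_mul,
    exp_neg_l₁, ← zpow_mul, neg_mul]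

/-- The trivial factor leaves only `r' = 0`. With `M = i + j + 1`, the two sums contain `k_M⁺` and
`k_{1-M}⁻`. For `M ≥ 2` or `M ≤ -1` only one of them is present, and it is zero by fusion; for `M =
0` and `M = 1` both delta functions have the same support and the terms cancel. -/
lemma a1Third_fockModule (hP : P.Generic) (hv : v ≠ 0) (hκ : κ ≠ 0) (hκv : κ ^ 2 = v) :
    A1Third P (fockModule P v hκ) := by
  intro i j
  have hs := P.s₁_ne_zero
  have h0 := kp_zero_eq_neg_km_one P v hP hκv hv (coe_scaUnit hκ) (coe_scaUnit_inv hκ)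
  have h1 := km_zero_eq_neg_kp_one P v hP hκv hv (coe_scaUnit hκ) (coe_scaUnit_inv hκ)
  simp only [fockModule, Pi.zero_apply, prodXY_zero_left, prodYX_zero_left, sub_zero]
  rw [sumPairs_left, sumPairs_left]
  rotate_left
  · intro r r' hr
    rw [trivialData_km, if_neg hr, rescale_zero, mulCur_zero, inX_zero, deltaXY_zero]
  · intro r r' hr
    rw [trivialData_kp, if_neg hr, rescale_zero, mulCur_zero, inY_zero, deltaYX_zero]
  simp only [trivialData_kp, trivialData_km, if_true, rescale_oneCur, mulCur_oneCur]
  rcases lt_trichotomy (i + j + 1) 0 with hM | hM | hM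
  · obtain ⟨r, hr⟩ : ∃ r : ℕ, -i - j = (r + 2 : ℕ) := ⟨(-i - j - 2).toNat, by omega⟩
    rw [if_neg (by omega), if_pos (by omega), hr, Int.toNat_natCast, km_fock_eq_zero P v hP]
    simp [rescale_zero]
  · rw [hM, show -i - j = (1 : ℕ) by omega, if_pos le_rfl, if_pos (by simp), Int.toNat_natCast,
      Int.toNat_zero]
    funext m n
    rw [Pi.zero_apply, Pi.zero_apply, Pi.add_apply, Pi.add_apply,
      deltaYX_expUnit _ _ (coe_fock_C_zpow P v), deltaXY_expUnit _ _ (coe_fock_C_zpow P v), rescale,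
      rescale, h0,
      smul_neg, smul_neg, smul_smul, smul_smul, smul_smul, eq_comm, neg_add_eq_zero]
    -- Equality of the powers of `s₁` expresses that the supports and the shifted arguments of the
    -- two terms agree at level `C = s₁`.
    congr 1
    simp only [q₁_zpow, ← zpow_mul, ← zpow_add₀ hs]
    congr 1
    push_cast
    ring
  · rcases eq_or_ne (i + j + 1) 1 with hM' | hM'
    · rw [show i + j + 1 = (1 : ℕ) by omega, show -i - j = 0 by omega, if_pos le_rfl,
        if_pos (by simp), Int.toNat_natCast, Int.toNat_zero]
      funext m n
      rw [Pi.zero_apply, Pi.zero_apply, Pi.add_apply, Pi.add_apply,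
        deltaYX_expUnit _ _ (coe_fock_C_zpow P v), deltaXY_expUnit _ _ (coe_fock_C_zpow P v),
        rescale, rescale, h1,
        smul_neg, smul_neg, smul_smul, smul_smul, smul_smul, eq_comm, add_neg_eq_zero]
      congr 1
      simp only [q₁_zpow, ← zpow_mul, ← zpow_add₀ hs]
      congr 1
      push_cast
      ring
    · obtain ⟨r, hr⟩ : ∃ r : ℕ, i + j + 1 = (r + 2 : ℕ) := ⟨(i + j - 1).toNat, by omega⟩
      rw [if_pos (by omega), if_neg (by omega), hr, Int.toNat_natCast, kp_fock_eq_zero P v hP]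
      simp [rescale_zero]

lemma a1Third_fockModuleCheck (hP : P.Generic) (hv : v ≠ 0) (hκ : κ ≠ 0) (hκv : κ ^ 2 = v) :
    A1Third P (fockModuleCheck P v hκ) := by
  intro i j
  have hs := P.s₁_ne_zero
  have h0 := kp_zero_eq_neg_km_one P.check v hP.check hκv hv (coe_scaUnit hκ) (coe_scaUnit_inv hκ)
  have h1 := km_zero_eq_neg_kp_one P.check v hP.check hκv hv (coe_scaUnit hκ) (coe_scaUnit_inv hκ)
  have hC : ∀ m : ℤ, (((trivialData FockSpace).C ^ m : (End ℂ FockSpace)ˣ) : End ℂ FockSpace) =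
      sca (1 ^ m) := fun m => by
    rw [trivialData, one_zpow, one_zpow, coe_one_eq_sca]
  simp only [fockModuleCheck, Pi.zero_apply, prodXY_zero_left, prodYX_zero_left, sub_zero]
  rw [sumPairs_right, sumPairs_right]
  rotate_left
  · intro r r' hr
    rw [trivialData_km, if_neg hr, rescale_zero, zero_mulCur, inX_zero, deltaXY_zero]
  · intro r r' hr
    rw [trivialData_kp, if_neg hr, rescale_zero, zero_mulCur, inY_zero, deltaYX_zero]
  simp only [trivialData_kp, trivialData_km, if_true, rescale_oneCur, oneCur_mulCur]
  rcases lt_trichotomy (i + j + 1) 0 with hM | hM | hM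
  · obtain ⟨r, hr⟩ : ∃ r : ℕ, -i - j = (r + 2 : ℕ) := ⟨(-i - j - 2).toNat, by omega⟩
    rw [if_neg (by omega), if_pos (by omega), hr, Int.toNat_natCast,
      km_fock_eq_zero P.check v hP.check]
    simp [rescale_zero]
  · rw [hM, show -i - j = (1 : ℕ) by omega, if_pos le_rfl, if_pos (by simp), Int.toNat_natCast,
      Int.toNat_zero]
    funext m n
    rw [Pi.zero_apply, Pi.zero_apply, Pi.add_apply, Pi.add_apply,
      deltaYX_expUnit _ _ hC, deltaXY_expUnit _ _ hC, rescale, rescale, h0,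
      smul_neg, smul_neg, smul_smul, smul_smul, smul_smul, eq_comm, neg_add_eq_zero]
    congr 1
    simp only [check_s₁, inv_zpow', q₁_zpow, q₁half_eq, one_zpow, one_mul,
      ← zpow_mul, ← zpow_add₀ hs]
    congr 1
    push_cast
    -- The arguments contain `q₁^{-j}` and `q₁^{i+1/2}`, so the exponents depend on `i` and `j` and
    -- agree because `i + j = -1`.
    linear_combination 2 * (m + n) * hM
  · rcases eq_or_ne (i + j + 1) 1 with hM' | hM'
    · rw [show i + j + 1 = (1 : ℕ) by omega, show -i - j = 0 by omega, if_pos le_rfl,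
        if_pos (by simp), Int.toNat_natCast, Int.toNat_zero]
      funext m n
      rw [Pi.zero_apply, Pi.zero_apply, Pi.add_apply, Pi.add_apply,
        deltaYX_expUnit _ _ hC, deltaXY_expUnit _ _ hC, rescale, rescale, h1,
        smul_neg, smul_neg, smul_smul, smul_smul, smul_smul, eq_comm, add_neg_eq_zero]
      congr 1
      simp only [check_s₁, inv_zpow', q₁_zpow, q₁half_eq, one_zpow, one_mul,
      ← zpow_mul, ← zpow_add₀ hs]
      congr 1
      push_cast
      linear_combination 2 * (m + n) * hM'
    · obtain ⟨r, hr⟩ : ∃ r : ℕ, i + j + 1 = (r + 2 : ℕ) := ⟨(i + j - 1).toNat, by omega⟩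
      rw [if_pos (by omega), if_neg (by omega), hr, Int.toNat_natCast,
        kp_fock_eq_zero P.check v hP.check]
      simp [rescale_zero]

end Modules

end

end Toroidal

theorem lemma5p6 (P : Params) (hP : P.Generic)
    (β : ℂ) (hβ : Complex.exp (-β * P.l₁) = P.q₃)
    (v : ℂ) (hv : v ≠ 0) (κ : ℂ) (hκ : κ ^ 2 = v) :
    (∃ A : A1Data FockSpace, IsAdmissibleA1Module P β A ∧ A.E = fock P v ∧
      (∀ i, A.Xp i = 0) ∧ (∀ j, A.Xm j = 0) ∧ A.Ec.e = 0 ∧ A.Ec.f = 0 ∧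
      A.Ec.ψ₀ = 1 ∧ A.Ec.C = 1 ∧
      (A.K : Module.End ℂ FockSpace) = sca κ ∧ A.Kc = 1) ∧
    (∃ A : A1Data FockSpace, IsAdmissibleA1Module P β A ∧ A.Ec = fock P.check v ∧
      (∀ i, A.Xp i = 0) ∧ (∀ j, A.Xm j = 0) ∧ A.E.e = 0 ∧ A.E.f = 0 ∧
      A.E.ψ₀ = 1 ∧ A.E.C = 1 ∧
      A.K = 1 ∧ (A.Kc : Module.End ℂ FockSpace) = sca κ) := by
  have hκ0 : κ ≠ 0 := by rintro rfl; exact hv (by rw [← hκ]; ring)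
  refine ⟨⟨fockModule P v hκ0, ⟨⟨a1Cartan_fockModule hP hv hκ0, a1First_of_zero _ _ _ _ _ _,
      a1Second_of_zero _ _ _ _ _, a1Third_fockModule hP hv hκ0 hκ⟩, fockGrading,
      isAdmissibleFor_fockGrading (fock_graded P v) (trivialData_graded _) (coe_scaUnit hκ0)
        (coe_scaUnit_inv hκ0) coe_one_eq_sca coe_one_inv_eq_sca⟩, rfl, fun _ => rfl, fun _ => rfl,
      rfl, rfl, rfl, rfl, rfl, rfl⟩,
    ⟨fockModuleCheck P v hκ0, ⟨⟨a1Cartan_fockModuleCheck hP hv hκ0, a1First_of_zero _ _ _ _ _ _,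
      a1Second_of_zero _ _ _ _ _, a1Third_fockModuleCheck hP hv hκ0 hκ⟩, fockGrading,
      isAdmissibleFor_fockGrading (trivialData_graded _) (fock_graded P.check v) coe_one_eq_sca
        coe_one_inv_eq_sca (coe_scaUnit hκ0) (coe_scaUnit_inv hκ0)⟩, rfl, fun _ => rfl,
      fun _ => rfl, rfl, rfl, rfl, rfl, rfl, rfl⟩⟩
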